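/- Let $N\ge 2$, $m>0$, $\mu>0$, and write $\hat\xi(p)=(2\pi)^{-3(N-1)/2}\int e^{-ip\cdot x}\xi(x)\,dx$. The subscript "as" denotes functions on $\mathbb{R}^{3(N-1)}=(\mathbb{R}^3)^{N-1}$ antisymmetric under permutations of the $N-1$ variables in $\mathbb{R}^3$. Put $$G(q_1,\dots,q_N)=\Big(\sum_{i=1}^N q_i^2+\tfrac{2}{m+1}\sum_{i<j}q_i\cdot q_j+\mu\Big)^{-1},$$ $$L(q_1,\dots,q_{N-1})=2\pi^2\Big(\tfrac{m(m+2)}{(m+1)^2}\sum_{i=1}^{N-1}q_i^2+\tfrac{2m}{(m+1)^2}\sum_{i<j}q_i\cdot q_j+\mu\Big)^{1/2},$$ and let $L$ also denote the operator of multiplication by this function in momentum space, acting in $L^2_{\rm as}(\mathbb{R}^{3(N-1)})$ with its maximal domain $D(L)$. On $H^{1/2}_{\rm as}(\mathbb{R}^{3(N-1)})$ consider the quadratic form $T_{\rm diag}+T_{\rm off}$, $$T_{\rm diag}(\xi)=\int|\hat\xi(s,\vec q)|^2L(s,\vec q)\,ds\,d\vec q,\qquad T_{\rm off}(\xi)=(N-1)\int\overline{\hat\xi(s,\vec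 q)}\,\hat\xi(t,\vec q)\,G(s,t,\vec q)\,ds\,dt\,d\vec q,$$ with $s,t\in\mathbb{R}^3$, $\vec q\in\mathbb{R}^{3(N-2)}$, and let $t(\zeta,\xi)$ be the corresponding sesquilinear form. Let $\Gamma$ be the operator in $L^2_{\rm as}$ associated with it: $\xi\in D(\Gamma)$ and $\Gamma\xi=\eta$ iff $\xi\in H^{1/2}_{\rm as}$, $\eta\in L^2_{\rm as}$ and $\langle\zeta|\eta\rangle=t(\zeta,\xi)$ for all $\zeta\in H^{1/2}_{\rm as}$. For general $\xi\in H^{1/2}_{\rm as}$, $\Gamma\xi\in H^{-1/2}_{\rm as}$ is defined by the same identity. For $\beta\ge 0$ let, with $A=(2+m)^{-1}$ and $\ell_m(s,K,Q)=\big(\tfrac{m}{(m+1)^2}(s+K)^2+\tfrac{m}{m+1}(s^2+Q^2)\big)^{1/2}$, $$\Lambda_\beta(m)=\sup_{s,K\in\mathbb{R}^3,\,Q>0}\frac{s^2+Q^2}{\pi^2(1+m)}\int_{\mathbb{R}^3}\frac1{t^2}\left(\frac{\ell_m(s,K,Q)^{(\beta-1)/2}}{\ell_m(t,K,Q)^{(\beta+1)/2}}+\frac{\ell_m(t,K,Q)^{(\beta-1)/2}}{\ell_m(s,K,Q)^{(\beta+1)/2}}\right)\frac{|(s+AK)\cdot(t+AK)|\;dt}{\big[(s+AK)^2+(t+AK)^2+\frac{m}{1+m}(Q^2+AK^2)\big]^2-\big[\frac{2}{1+m}(s+AK)\cdot(t+AK)\big]^2}.$$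 Then: (i) Every $\xi\in H^1_{\rm as}(\mathbb{R}^{3(N-1)})$ lies in $D(\Gamma)$, $\Gamma\xi$ is uniquely determined, and $$\|\Gamma\xi\|^2_{L^2}\ge(1-\Lambda_1(m))\,\|L\xi\|^2_{L^2}.$$ (ii) If $\Lambda_1(m)<1$, then $D(\Gamma)=D(L)=H^1_{\rm as}(\mathbb{R}^{3(N-1)})$. (iii) For $0\le\beta\le2$, $\Lambda_\beta(m)$ is finite, and for every $\xi\in H^{(\beta+1)/2}_{\rm as}(\mathbb{R}^{3(N-1)})$ the element $\Gamma\xi\in H^{-1/2}_{\rm as}$ exists and $$\|L^{(\beta-1)/2}\Gamma\xi\|^2_{L^2}\ge(1-\Lambda_\beta(m))\,\|L^{(\beta+1)/2}\xi\|^2_{L^2},$$ where the left side may a priori be $+\infty$. -/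

import Mathlib

open MeasureTheory FourierTransform
open scoped ENNReal SchwartzMap ComplexConjugate

noncomputable section

namespace PointInteraction

/-- One-particle space `ℝ³`. -/
abbrev E3 : Type := EuclideanSpace ℝ (Fin 3)

/-- `ℝ^{3k}` as the Euclidean space of `k`-tuples of vectors in `ℝ³`. -/
abbrev Config (k : ℕ) : Type := PiLp 2 (fun _ : Fin k => E3)

/-- `L²(ℝ^{3k})`, complex valued. -/
abbrev L2 (k : ℕ) : Type := Lp (α := Config k) ℂ 2 (volume : Measure (Config k))

/-- Unitary Fourier transform `ξ̂(p) = (2π)^{-3k/2} ∫ e^{-i p·x} ξ(x) dx`, obtained by rescaling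
Mathlib's `L²` Fourier transform (which uses the phase `e^{-2πi p·x}`). -/
def hat {k : ℕ} (ξ : L2 k) (p : Config k) : ℂ :=
  (((2 * Real.pi) ^ (-(3 * (k : ℝ)) / 2) : ℝ) : ℂ) * (𝓕 ξ : L2 k) ((2 * Real.pi)⁻¹ • p)

/-- The tuple `(x_{σ 1}, …, x_{σ k})`. -/
def permute {k : ℕ} (σ : Equiv.Perm (Fin k)) (x : Config k) : Config k :=
  WithLp.toLp 2 (fun i => x (σ i))

/-- Antisymmetry (almost everywhere) under permutations of the `k` vector variables. -/
def Antisymm {k : ℕ} (f : Config k → ℂ) : Prop :=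
  ∀ σ : Equiv.Perm (Fin k),
    (fun x => f (permute σ x)) =ᵐ[volume] fun x => ((Equiv.Perm.sign σ : ℤ) : ℂ) * f x

/-- `L²_as(ℝ^{3k})`. -/
def L2as (k : ℕ) : Set (L2 k) := {ξ | Antisymm (ξ : Config k → ℂ)}

/-- `H^r_as(ℝ^{3k})` for `r ≥ 0`, as a subset of `L²(ℝ^{3k})`. -/
def Has (k : ℕ) (r : ℝ) : Set (L2 k) :=
  {ξ | ξ ∈ L2as k ∧ TemperedDistribution.MemSobolev r 2 (ξ : 𝓢'(Config k, ℂ))}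

/-- `G(q₁, …, q_k) = (∑ q_i² + 2/(m+1) ∑_{i<j} q_i·q_j + μ)⁻¹`. -/
def G {k : ℕ} (m μ : ℝ) (q : Fin k → E3) : ℝ :=
  (∑ i, ‖q i‖ ^ 2 + 2 / (m + 1) * ∑ i, ∑ j ∈ Finset.Ioi i, inner ℝ (q i) (q j) + μ)⁻¹

/-- The symbol
`L(q₁, …, q_k) = 2π² (m(m+2)/(m+1)² ∑ q_i² + 2m/(m+1)² ∑_{i<j} q_i·q_j + μ)^{1/2}`. -/
def L {k : ℕ} (m μ : ℝ) (q : Config k) : ℝ :=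
  2 * Real.pi ^ 2 * Real.sqrt (m * (m + 2) / (m + 1) ^ 2 * ∑ i, ‖q i‖ ^ 2
    + 2 * m / (m + 1) ^ 2 * ∑ i, ∑ j ∈ Finset.Ioi i, inner ℝ (q i) (q j) + μ)

/-- For a function `g` of momentum, `∫ |L^r g|² ∈ [0, ∞]`; with `g = û` this is `‖L^r u‖²`. -/
def LpowNormSq {k : ℕ} (m μ r : ℝ) (g : Config k → ℂ) : ℝ≥0∞ :=
  ∫⁻ p, ‖((L m μ p ^ r : ℝ) : ℂ) * g p‖ₑ ^ 2

/-- The domain of the multiplication operator `L` in `L²_as`. -/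
def domL (k : ℕ) (m μ : ℝ) : Set (L2 k) :=
  {ξ | ξ ∈ L2as k ∧ LpowNormSq m μ 1 (hat ξ) < ⊤}

/-- The vector `(s, q₁, …, q_n)`. -/
def cons {n : ℕ} (s : E3) (q : Fin n → E3) : Config (n + 1) :=
  WithLp.toLp 2 (Fin.cons s q : Fin (n + 1) → E3)

/-- Sesquilinear version of the diagonal form; `Tdiag m μ ξ ξ` is the quadratic form. -/
def Tdiag {k : ℕ} (m μ : ℝ) (ζ ξ : L2 k) : ℂ :=
  ∫ p, conj (hat ζ p) * hat ξ p * (L m μ p : ℂ)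

/-- Sesquilinear version of the off-diagonal form for `N = n + 2`, so that `N - 1 = n + 1`
and `q` runs over `ℝ^{3(N-2)}`; `Toff m μ ξ ξ` is the quadratic form. -/
def Toff {n : ℕ} (m μ : ℝ) (ζ ξ : L2 (n + 1)) : ℂ :=
  ((n : ℂ) + 1) * ∫ x : E3 × E3 × (Fin n → E3),
    conj (hat ζ (cons x.1 x.2.2)) * hat ξ (cons x.2.1 x.2.2)
      * (G m μ (Fin.cons x.1 (Fin.cons x.2.1 x.2.2 : Fin (n + 1) → E3) : Fin (n + 2) → E3) : ℂ)

/-- The relation `Γ ξ = η`, where `Γ` is the operator in `L²_as` associated with the form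
`Tdiag + Toff` on the form domain `H^{1/2}_as`. -/
def IsGamma {n : ℕ} (m μ : ℝ) (ξ η : L2 (n + 1)) : Prop :=
  ξ ∈ Has (n + 1) (1 / 2) ∧ η ∈ L2as (n + 1) ∧
    ∀ ζ ∈ Has (n + 1) (1 / 2), inner ℂ ζ η = Tdiag m μ ζ ξ + Toff m μ ζ ξ

/-- The operator domain `D(Γ)`. -/
def domGamma (n : ℕ) (m μ : ℝ) : Set (L2 (n + 1)) := {ξ | ∃ η, IsGamma m μ ξ η}

/-- `g` is the Fourier transform of `Γ ξ`, where `Γ` is understood as the operator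
`H^{1/2}_as → H^{-1/2}_as` given by the form (it extends the operator of `IsGamma`). -/
structure IsGammaHat {n : ℕ} (m μ : ℝ) (ξ : L2 (n + 1)) (g : Config (n + 1) → ℂ) : Prop where
  mem_form_domain : ξ ∈ Has (n + 1) (1 / 2)
  aestronglyMeasurable : AEStronglyMeasurable g volume
  antisymm : Antisymm g
  finite_norm : LpowNormSq m μ (-1 / 2) g < ⊤
  form_eq : ∀ ζ ∈ Has (n + 1) (1 / 2),
    ∫ p, conj (hat ζ p) * g p = Tdiag m μ ζ ξ + Toff m μ ζ ξ

/-- `ℓ_m(s, K, Q)`. -/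
def ell (m : ℝ) (s K : E3) (Q : ℝ) : ℝ :=
  Real.sqrt (m / (m + 1) ^ 2 * ‖s + K‖ ^ 2 + m / (m + 1) * (‖s‖ ^ 2 + Q ^ 2))

/-- The integrand (including the factor `1 / t²`) in the definition of `Λ_β(m)`, with
`A = 1 / (2 + m)`. -/
def LambdaIntegrand (β m : ℝ) (s K : E3) (Q : ℝ) (t : E3) : ℝ :=
  let A : ℝ := (2 + m)⁻¹
  1 / ‖t‖ ^ 2
    * (ell m s K Q ^ ((β - 1) / 2) / ell m t K Q ^ ((β + 1) / 2)
      + ell m t K Q ^ ((β - 1) / 2) / ell m s K Q ^ ((β + 1) / 2))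
    * (|inner ℝ (s + A • K) (t + A • K)|
      / ((‖s + A • K‖ ^ 2 + ‖t + A • K‖ ^ 2 + m / (1 + m) * (Q ^ 2 + A * ‖K‖ ^ 2)) ^ 2
        - (2 / (1 + m) * inner ℝ (s + A • K) (t + A • K)) ^ 2))

/-- `Λ_β(m)`, as a supremum in `[0, ∞]`. -/
def Lambda (β m : ℝ) : ℝ≥0∞ :=
  ⨆ (s : E3) (K : E3) (Q : ℝ) (_ : 0 < Q),
    ENNReal.ofReal ((‖s‖ ^ 2 + Q ^ 2) / (Real.pi ^ 2 * (1 + m)))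
      * ∫⁻ t, ENNReal.ofReal (LambdaIntegrand β m s K Q t)

end PointInteraction

end

open PointInteraction

/-!
Test the identity defining `Γ ξ` against `f(L) ξ`, where `f` is a bounded regularisation of
`x ↦ x ^ β`. The diagonal part of the form then gives the energy `∫ f(L) L |ξ̂|²`, and the
off-diagonal part symmetrises to the kernel `(f(L(s, q)) + f(L(t, q))) G(s, t, q)`. For fixed `q`
with sum `K`, split `G` into its parts even and odd under the reflection of `s + A K`. Together with
the factor `f(L(s, q)) + f(L(t, q))` the even part is still a positive semidefinite kernel in
`(s, t)`, so it can be dropped from a lower bound. The odd part is bounded by a Schur test with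
weight `‖s‖ / ‖t‖`: by antisymmetry, `|ξ̂(s, q)|²` times a function of `L` is symmetric in all
momenta, so the factor `N - 1` in front of the form turns `‖s‖²` into `∑ i, ‖p i‖²`, which is at
most the factor `‖s‖² + Q²` that appears in `Λ_β`. This bounds the off-diagonal part below by
`-Λ_β / 2` times the energy. By Cauchy-Schwarz
`(1 - Λ_β / 2)² ∫ f(L) L |ξ̂|² ≤ ‖L^{(β - 1)/2} Γ ξ‖²`, and Fatou's lemma removes the
regularisation.

Existence of `Γ ξ` also comes from a Schur test: `L^{-α} G L^{α - 1}` is bounded on `L²` for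
`0 ≤ α ≤ 1`, so the form is represented by an element of the dual of the domain of `L^α`, with
`α = 1/2` for `ξ ∈ H^{1/2}` and `α = 0` for `ξ ∈ H¹`.
-/

namespace PointInteraction

section PosSemidefKernel

variable {X : Type*}

theorem posSemidef_inner {E : Type*} [NormedAddCommGroup E] [InnerProductSpace ℝ E] (f : X → E) :
    (Matrix.of fun x y => inner ℝ (f x) (f y)).PosSemidef := by
  refine ⟨Matrix.IsHermitian.ext fun x y => real_inner_comm _ _, fun c => ?_⟩
  have h : (c.sum fun x a => c.sum fun y b => star a * inner ℝ (f x) (f y) * b)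
      = inner ℝ (c.sum fun x a => a • f x) (c.sum fun y b => b • f y) := by
    simp only [Finsupp.sum, sum_inner, inner_sum, real_inner_smul_left, real_inner_smul_right,
      star_trivial]
    rw [Finset.sum_comm]
    refine Finset.sum_congr rfl fun x _ => Finset.sum_congr rfl fun y _ => ?_
    rw [real_inner_comm]
    ring
  exact h ▸ real_inner_self_nonneg

theorem posSemidef_mul_self (f : X → ℝ) : (Matrix.of fun x y => f x * f y).PosSemidef := by
  convert posSemidef_inner f using 1
  ext x y
  exact mul_comm _ _

theorem posSemidef_const {a : ℝ} (ha : 0 ≤ a) : (Matrix.of fun _ _ : X => a).PosSemidef := by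
  convert (posSemidef_mul_self fun _ : X => (1 : ℝ)).smul ha using 1
  ext x y
  simp

theorem posSemidef_pow {K : Matrix X X ℝ} (hK : K.PosSemidef) (n : ℕ) :
    (Matrix.of fun x y => K x y ^ n).PosSemidef := by
  induction n with
  | zero => simpa only [pow_zero] using posSemidef_const (X := X) zero_le_one
  | succ n ih => exact ih.hadamard hK

theorem posSemidef_of_hasSum {ι : Type*} {k : ι → Matrix X X ℝ} {K : Matrix X X ℝ}
    (hk : ∀ n, (k n).PosSemidef) (h : ∀ x y, HasSum (fun n => k n x y) (K x y)) :
    K.PosSemidef := by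
  refine ⟨Matrix.IsHermitian.ext fun x y => (h y x).unique ?_, fun c => ?_⟩
  · have hsymm : ∀ n, k n y x = k n x y := fun n => (hk n).isHermitian.apply x y
    simpa only [hsymm] using h x y
  · have hsum : HasSum (fun n => c.sum fun x a => c.sum fun y b => star a * k n x y * b)
        (c.sum fun x a => c.sum fun y b => star a * K x y * b) :=
      hasSum_sum fun x _ => hasSum_sum fun y _ => ((h x y).mul_left _).mul_right _
    exact hsum.nonneg fun n => (hk n).2 c

theorem posSemidef_integral {T : Type*} [MeasurableSpace T] {ν : Measure T}
    {k : T → Matrix X X ℝ} (hk : ∀ᵐ t ∂ν, (k t).PosSemidef)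
    (hi : ∀ x y, Integrable (fun t => k t x y) ν) :
    (Matrix.of fun x y => ∫ t, k t x y ∂ν).PosSemidef := by
  refine ⟨Matrix.IsHermitian.ext fun x y => integral_congr_ae
    (hk.mono fun t h => h.isHermitian.apply x y), fun c => ?_⟩
  have hterm : ∀ x y, Integrable (fun t => star (c x) * k t x y * c y) ν := fun x y =>
    ((hi x y).const_mul _).mul_const _
  have h : (c.sum fun x a => c.sum fun y b => star a * (∫ t, k t x y ∂ν) * b)
      = ∫ t, c.sum fun x a => c.sum fun y b => star a * k t x y * b ∂ν := by
    simp only [Finsupp.sum]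
    rw [integral_finsetSum _ fun x _ => integrable_finsetSum _ fun y _ => hterm x y]
    refine Finset.sum_congr rfl fun x _ => ?_
    rw [integral_finsetSum _ fun y _ => hterm x y]
    simp only [integral_mul_const, integral_const_mul]
  exact h ▸ integral_nonneg_of_ae (hk.mono fun t h => h.2 c)

theorem posSemidef_inv_add {u : X → ℝ} (hu : ∀ x, 0 < u x) :
    (Matrix.of fun x y => (u x + u y)⁻¹).PosSemidef := by
  have hneg : ∀ x y, -u x + -u y < 0 := fun x y => by linarith [hu x, hu y]
  have h : ∀ x y, (u x + u y)⁻¹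
      = ∫ r in Set.Ioi (0 : ℝ), Real.exp (-(u x) * r) * Real.exp (-(u y) * r) := by
    intro x y
    simp_rw [← Real.exp_add, ← add_mul]
    rw [integral_exp_mul_Ioi (hneg x y), mul_zero, Real.exp_zero, ← neg_add, neg_div_neg_eq,
      one_div]
  simp_rw [h]
  refine posSemidef_integral (k := fun r => Matrix.of fun x y =>
    Real.exp (-(u x) * r) * Real.exp (-(u y) * r)) (.of_forall fun r => posSemidef_mul_self _)
    fun x y => ?_
  simp_rw [Matrix.of_apply, ← Real.exp_add, ← add_mul]
  exact integrableOn_exp_mul_Ioi (hneg x y) 0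

theorem posSemidef_rpowIntegrand₀₁_add_div {u : X → ℝ} (hu : ∀ x, 0 < u x) {t : ℝ} (ht : 0 < t)
    (θ : ℝ) :
    (Matrix.of fun x y => (Real.rpowIntegrand₀₁ θ t (u x) + Real.rpowIntegrand₀₁ θ t (u y))
      / (u x + u y)).PosSemidef := by
  have hnum := (((posSemidef_inv_add hu).smul (zero_le_two (α := ℝ))).hadamard
    (posSemidef_mul_self u)).add (posSemidef_const ht.le)
  have hc : 0 ≤ t ^ θ * t⁻¹ := by positivity
  refine (congrArg Matrix.PosSemidef (Matrix.ext fun x y => ?_)).mpr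
    ((hnum.hadamard (posSemidef_mul_self fun x => (t + u x)⁻¹)).smul hc)
  have := hu x
  have := hu y
  simp only [Real.rpowIntegrand₀₁, Matrix.of_apply, Matrix.smul_apply, Matrix.add_apply,
    Matrix.hadamard_apply, smul_eq_mul]
  field_simp
  ring

theorem posSemidef_rpow_add_div {u : X → ℝ} (hu : ∀ x, 0 < u x) {θ : ℝ} (h0 : 0 ≤ θ)
    (h1 : θ ≤ 1) : (Matrix.of fun x y => (u x ^ θ + u y ^ θ) / (u x + u y)).PosSemidef := by
  rcases h0.eq_or_lt with rfl | h0
  · convert (posSemidef_inv_add hu).smul (zero_le_two (α := ℝ)) using 1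
    ext x y
    simp [div_eq_mul_inv, one_add_one_eq_two]
  rcases h1.eq_or_lt with rfl | h1
  · convert posSemidef_const (X := X) zero_le_one using 1
    ext x y
    simpa using div_self (add_pos (hu x) (hu y)).ne'
  obtain ⟨ν, hν⟩ := Real.exists_measure_rpow_eq_integral_rpowIntegrand₀₁ (p := θ) ⟨h0, h1⟩
  have hi := fun x => (hν (u x) (hu x).le).1
  have h : ∀ x y, (u x ^ θ + u y ^ θ) / (u x + u y) = ∫ t in Set.Ioi 0,
      (Real.rpowIntegrand₀₁ θ t (u x) + Real.rpowIntegrand₀₁ θ t (u y)) / (u x + u y) ∂ν := by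
    intro x y
    rw [integral_div, integral_add (hi x) (hi y), ← (hν (u x) (hu x).le).2,
      ← (hν (u y) (hu y).le).2]
  simp_rw [h]
  exact posSemidef_integral (k := fun t => Matrix.of fun x y => _)
    ((ae_restrict_mem measurableSet_Ioi).mono fun t ht =>
      posSemidef_rpowIntegrand₀₁_add_div hu ht θ)
    fun x y => ((hi x).add (hi y)).div_const _

theorem sum_sum_nonneg_of_posSemidef {ι : Type*} [Fintype ι] {K : Matrix X X ℝ}
    (hK : K.PosSemidef) (w : ι → X) : 0 ≤ ∑ i, ∑ j, K (w i) (w j) := by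
  simpa [dotProduct, Matrix.mulVec] using (hK.submatrix w).dotProduct_mulVec_nonneg 1

theorem measurePreserving_eval_prodMk {ι : Type*} [Fintype ι] {X : ι → Type*}
    [∀ i, MeasurableSpace (X i)] (μ : ∀ i, Measure (X i)) [∀ i, IsProbabilityMeasure (μ i)]
    {i j : ι} (hij : i ≠ j) :
    MeasurePreserving (fun w : ∀ i, X i => (w i, w j)) (Measure.pi μ) ((μ i).prod (μ j)) := by
  have hind : ProbabilityTheory.IndepFun (fun w : ∀ i, X i => w i) (fun w => w j) (Measure.pi μ) :=
    (ProbabilityTheory.iIndepFun_pi (X := fun _ x => x) fun _ => aemeasurable_id).indepFun hij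
  refine ⟨by fun_prop, ?_⟩
  rw [(ProbabilityTheory.indepFun_iff_map_prod_eq_prod_map_map
    (measurable_pi_apply i).aemeasurable (measurable_pi_apply j).aemeasurable).1 hind,
    (measurePreserving_eval μ i).map_eq, (measurePreserving_eval μ j).map_eq]

variable [MeasurableSpace X]

theorem integral_sum_sum_eval {ι : Type*} [Fintype ι] (P : Measure X) [IsProbabilityMeasure P]
    {f : X → X → ℝ} (hd : Integrable (fun x => f x x) P)
    (hf : Integrable (fun z : X × X => f z.1 z.2) (P.prod P)) :
    ∫ w : ι → X, ∑ i, ∑ j, f (w i) (w j) ∂Measure.pi (fun _ => P)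
      = Fintype.card ι * ∫ x, f x x ∂P
        + Fintype.card ι * (Fintype.card ι - 1) * ∫ z, f z.1 z.2 ∂P.prod P := by
  classical
  have hpair : ∀ i j : ι, Integrable (fun w : ι → X => f (w i) (w j)) (Measure.pi fun _ => P) ∧
      ∫ w : ι → X, f (w i) (w j) ∂Measure.pi (fun _ => P)
        = (if i = j then ∫ x, f x x ∂P - ∫ z, f z.1 z.2 ∂P.prod P else 0)
          + ∫ z, f z.1 z.2 ∂P.prod P := by
    intro i j
    rcases eq_or_ne i j with rfl | hij
    · rw [if_pos rfl, sub_add_cancel]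
      exact ⟨integrable_comp_eval (μ := fun _ : ι => P) hd,
        integral_comp_eval (μ := fun _ : ι => P) hd.aestronglyMeasurable⟩
    · have hp := measurePreserving_eval_prodMk (fun _ : ι => P) hij
      rw [if_neg hij, zero_add]
      refine ⟨hp.integrable_comp_of_integrable hf, ?_⟩
      rw [← hp.map_eq, integral_map hp.measurable.aemeasurable
        (hp.map_eq ▸ hf.aestronglyMeasurable)]
  rw [integral_finsetSum _ fun i _ => integrable_finsetSum _ fun j _ => (hpair i j).1]
  simp_rw [integral_finsetSum _ fun j _ => (hpair _ j).1, (hpair _ _).2, Finset.sum_add_distrib]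
  simp only [Finset.sum_ite_eq, Finset.mem_univ, if_true, Finset.sum_const, Finset.card_univ,
    nsmul_eq_mul]
  ring

variable {K : Matrix X X ℝ}

theorem integral_prod_nonneg_of_isProbabilityMeasure (P : Measure X) [IsProbabilityMeasure P]
    (hK : K.PosSemidef) (hd : Integrable (fun x => K x x) P)
    (hi : Integrable (fun z : X × X => K z.1 z.2) (P.prod P)) :
    0 ≤ ∫ z, K z.1 z.2 ∂P.prod P := by
  by_contra! hneg
  obtain ⟨N, hN⟩ := exists_nat_gt ((∫ x, K x x ∂P) / -(∫ z, K z.1 z.2 ∂P.prod P))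
  rw [div_lt_iff₀ (neg_pos.2 hneg)] at hN
  have hsample := integral_sum_sum_eval (ι := Fin (N + 1)) P hd hi
  have hnonneg : 0 ≤ ∫ w : Fin (N + 1) → X, ∑ i, ∑ j, K (w i) (w j) ∂Measure.pi (fun _ => P) :=
    integral_nonneg fun w => sum_sum_nonneg_of_posSemidef hK w
  rw [hsample, Fintype.card_fin] at hnonneg
  push_cast at hnonneg
  nlinarith

theorem integral_prod_nonneg_of_isFiniteMeasure (ν : Measure X) [IsFiniteMeasure ν]
    (hK : K.PosSemidef) (hd : Integrable (fun x => K x x) ν)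
    (hi : Integrable (fun z : X × X => K z.1 z.2) (ν.prod ν)) :
    0 ≤ ∫ z, K z.1 z.2 ∂ν.prod ν := by
  rcases eq_or_ne ν 0 with rfl | hν
  · simp
  have : NeZero ν := ⟨hν⟩
  have hc : (ν Set.univ)⁻¹ ≠ ⊤ := ENNReal.inv_ne_top.2 (by simpa using hν)
  have hprod : ((ν Set.univ)⁻¹ • ν).prod ((ν Set.univ)⁻¹ • ν)
      = (ν Set.univ)⁻¹ • (ν Set.univ)⁻¹ • ν.prod ν := by
    rw [Measure.prod_smul_left, Measure.prod_smul_right]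
  have h := integral_prod_nonneg_of_isProbabilityMeasure ((ν Set.univ)⁻¹ • ν) hK
    (hd.smul_measure hc) (by rw [hprod]; exact (hi.smul_measure hc).smul_measure hc)
  rw [hprod, integral_smul_measure, integral_smul_measure, smul_smul, smul_eq_mul] at h
  have hc0 : 0 < ((ν Set.univ)⁻¹).toReal :=
    ENNReal.toReal_pos (ENNReal.inv_ne_zero.2 (measure_ne_top _ _)) hc
  exact nonneg_of_mul_nonneg_right h (mul_pos hc0 hc0)

theorem exists_monotone_integrableOn {ν : Measure X} [SigmaFinite ν] {f : X → ℝ}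
    (hf : Measurable f) (h0 : ∀ x, 0 ≤ f x) :
    ∃ S : ℕ → Set X, Monotone S ∧ (∀ n, MeasurableSet (S n)) ∧ ⋃ n, S n = Set.univ ∧
      ∀ n, ν (S n) < ⊤ ∧ IntegrableOn f (S n) ν := by
  have hS : ∀ n : ℕ, MeasurableSet (spanningSets ν n ∩ {x | f x ≤ n}) := fun n =>
    (measurableSet_spanningSets ν n).inter (measurableSet_le hf measurable_const)
  have hfin : ∀ n : ℕ, ν (spanningSets ν n ∩ {x | f x ≤ n}) < ⊤ := fun n =>
    (measure_mono Set.inter_subset_left).trans_lt (measure_spanningSets_lt_top ν n)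
  refine ⟨fun n => spanningSets ν n ∩ {x | f x ≤ n}, fun i j hij => Set.inter_subset_inter
    (monotone_spanningSets ν hij) fun x (hx : f x ≤ i) => hx.trans (by exact_mod_cast hij), hS,
    Set.eq_univ_of_forall fun x => ?_, fun n => ⟨hfin n, ?_⟩⟩
  · obtain ⟨N, hN⟩ := Set.mem_iUnion.1 ((iUnion_spanningSets ν).symm ▸ Set.mem_univ x)
    obtain ⟨M, hM⟩ := exists_nat_ge (f x)
    exact Set.mem_iUnion.2 ⟨max N M, monotone_spanningSets ν (le_max_left _ _) hN,
      hM.trans (by exact_mod_cast le_max_right _ _)⟩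
  · refine Measure.integrableOn_of_bounded (M := n) (hfin n).ne hf.aestronglyMeasurable ?_
    filter_upwards [ae_restrict_mem (hS n)] with x hx
    rw [Real.norm_of_nonneg (h0 x)]
    exact hx.2

theorem integral_prod_nonneg_of_posSemidef {ν : Measure X} [SigmaFinite ν] (hK : K.PosSemidef)
    (hm : Measurable fun z : X × X => K z.1 z.2)
    (hi : Integrable (fun z : X × X => K z.1 z.2) (ν.prod ν)) :
    0 ≤ ∫ z, K z.1 z.2 ∂ν.prod ν := by
  have hdiag : Measurable fun x => K x x := hm.comp (measurable_id.prodMk measurable_id)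
  obtain ⟨S, hmono, hS, hun, hfin⟩ :=
    exists_monotone_integrableOn (ν := ν) hdiag fun _ => hK.diag_nonneg
  have hcover : ⋃ n, S n ×ˢ S n = Set.univ := by
    rw [Set.iUnion_prod_of_monotone hmono hmono, hun, Set.univ_prod_univ]
  have hlim := tendsto_setIntegral_of_monotone (μ := ν.prod ν) (s := fun n => S n ×ˢ S n)
    (fun n => (hS n).prod (hS n)) (fun i j hij => Set.prod_mono (hmono hij) (hmono hij))
    hi.integrableOn
  rw [hcover, setIntegral_univ] at hlim
  refine ge_of_tendsto' hlim fun n => ?_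
  have : IsFiniteMeasure (ν.restrict (S n)) := isFiniteMeasure_restrict.2 (hfin n).1.ne
  rw [← Measure.prod_restrict]
  exact integral_prod_nonneg_of_isFiniteMeasure _ hK (hfin n).2
    (by rw [Measure.prod_restrict]; exact hi.integrableOn)

end PosSemidefKernel

/-- The bounded increasing regularisation `x ^ β / (1 + ε x ^ β)` of `x ^ β`. -/
noncomputable def reg (β ε x : ℝ) : ℝ := x ^ β / (1 + ε * x ^ β)

section Regularisation

variable {β ε x y : ℝ}

theorem reg_nonneg (hε : 0 ≤ ε) (hx : 0 ≤ x) : 0 ≤ reg β ε x := by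
  unfold reg; positivity

theorem reg_pos (hε : 0 ≤ ε) (hx : 0 < x) : 0 < reg β ε x := by
  unfold reg; positivity

@[fun_prop]
theorem measurable_reg (β ε : ℝ) : Measurable (reg β ε) := by
  unfold reg; fun_prop

theorem reg_le_rpow (hε : 0 ≤ ε) (hx : 0 ≤ x) : reg β ε x ≤ x ^ β :=
  div_le_self (by positivity) (le_add_of_nonneg_right (by positivity))

theorem reg_le_inv (hε : 0 < ε) (hx : 0 ≤ x) : reg β ε x ≤ ε⁻¹ := by
  have : 0 ≤ x ^ β := by positivity
  rw [reg, div_le_iff₀ (by positivity), mul_add, inv_mul_cancel_left₀ hε.ne']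
  exact le_add_of_nonneg_left (by positivity)

theorem reg_add_reg (hε : 0 ≤ ε) (hx : 0 ≤ x) (hy : 0 ≤ y) :
    reg β ε x + reg β ε y = (x ^ β + y ^ β + 2 * ε * (x ^ β * y ^ β))
      / ((1 + ε * x ^ β) * (1 + ε * y ^ β)) := by
  have : 1 + ε * x ^ β ≠ 0 := by positivity
  have : 1 + ε * y ^ β ≠ 0 := by positivity
  unfold reg
  field_simp
  ring

theorem add_add_two_mul_le_add_mul_sqrt (hε : 0 ≤ ε) (hx : 0 ≤ x) (hy : 0 ≤ y) :
    x + y + 2 * ε * (x * y) ≤ (x + y) * Real.sqrt ((1 + ε * x) * (1 + ε * y)) := by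
  refine le_of_sq_le_sq ?_ (by positivity)
  rw [mul_pow, Real.sq_sqrt (by positivity)]
  have h1 : 0 ≤ ε * (x + y) * (x - y) ^ 2 := by positivity
  have h2 : 0 ≤ ε ^ 2 * (x * y) * (x - y) ^ 2 := by positivity
  nlinarith

theorem reg_add_mul_sqrt_le (hε : 0 ≤ ε) (hx : 0 < x) (hy : 0 < y) :
    (reg β ε x + reg β ε y) * Real.sqrt (x ^ β * y ^ β)
      ≤ (x ^ β + y ^ β) * Real.sqrt (reg β ε x * reg β ε y) := by
  have hsqrt : Real.sqrt (reg β ε x * reg β ε y)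
      = Real.sqrt (x ^ β * y ^ β) / Real.sqrt ((1 + ε * x ^ β) * (1 + ε * y ^ β)) := by
    rw [reg, reg, div_mul_div_comm, Real.sqrt_div (by positivity)]
  rw [reg_add_reg hε hx.le hy.le, hsqrt]
  have hD : 0 < (1 + ε * x ^ β) * (1 + ε * y ^ β) := by positivity
  have key := add_add_two_mul_le_add_mul_sqrt hε (Real.rpow_nonneg hx.le β)
    (Real.rpow_nonneg hy.le β)
  set D := (1 + ε * x ^ β) * (1 + ε * y ^ β)
  calc (x ^ β + y ^ β + 2 * ε * (x ^ β * y ^ β)) / D * Real.sqrt (x ^ β * y ^ β)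
      ≤ (x ^ β + y ^ β) * Real.sqrt D / D * Real.sqrt (x ^ β * y ^ β) := by gcongr
    _ = _ := by rw [mul_div_assoc, Real.sqrt_div_self', mul_assoc, one_div_mul_eq_div]

theorem posSemidef_reg_add_mul {X : Type*} {u : X → ℝ} (hu : ∀ x, 0 ≤ u x) {K : Matrix X X ℝ}
    (hε : 0 ≤ ε) (hK : K.PosSemidef)
    (huK : (Matrix.of fun x y => (u x ^ β + u y ^ β) * K x y).PosSemidef) :
    (Matrix.of fun x y => (reg β ε (u x) + reg β ε (u y)) * K x y).PosSemidef := by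
  have h2ε : 0 ≤ 2 * ε := by positivity
  have h := (huK.add (((posSemidef_mul_self fun x => u x ^ β).hadamard hK).smul h2ε)).hadamard
    (posSemidef_mul_self fun x => (1 + ε * u x ^ β)⁻¹)
  refine (congrArg Matrix.PosSemidef (Matrix.ext fun x y => ?_)).mpr h
  simp only [Matrix.of_apply, Matrix.hadamard_apply, Matrix.add_apply, Matrix.smul_apply,
    smul_eq_mul, reg_add_reg hε (hu x) (hu y)]
  rw [← mul_inv, div_eq_mul_inv]
  ring

end Regularisation

section PairKernel

variable {E : Type*} [NormedAddCommGroup E] {θ e : ℝ}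

/-- The part `‖a‖² + ‖b‖² + e` of the pair energy `‖a‖² + 2 θ ⟪a, b⟫ + ‖b‖² + e` that is even under
`a ↦ -a`. -/
def pairEven (e : ℝ) (a b : E) : ℝ := ‖a‖ ^ 2 + ‖b‖ ^ 2 + e

/-- The square root `((1 - θ²) ‖a‖² + e)^{1/2}` of the minimum over `b` of the pair energy
`‖a‖² + 2 θ ⟪a, b⟫ + ‖b‖² + e`. -/
noncomputable def pairSymbol (θ e : ℝ) (a : E) : ℝ := Real.sqrt ((1 - θ ^ 2) * ‖a‖ ^ 2 + e)

theorem pairEven_comm (a b : E) : pairEven e a b = pairEven e b a := by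
  unfold pairEven; ring

theorem pairEven_pos (he : 0 < e) (a b : E) : 0 < pairEven e a b := by
  unfold pairEven; positivity

theorem pairSymbol_sq (h1 : θ ^ 2 ≤ 1) (he : 0 ≤ e) (a : E) :
    pairSymbol θ e a ^ 2 = (1 - θ ^ 2) * ‖a‖ ^ 2 + e :=
  Real.sq_sqrt (add_nonneg (mul_nonneg (sub_nonneg.2 h1) (sq_nonneg _)) he)

theorem pairSymbol_pos (h1 : θ ^ 2 ≤ 1) (he : 0 < e) (a : E) : 0 < pairSymbol θ e a :=
  Real.sqrt_pos.2 (add_pos_of_nonneg_of_pos (mul_nonneg (sub_nonneg.2 h1) (sq_nonneg _)) he)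

theorem pairSymbol_sq_add_pairSymbol_sq (h1 : θ ^ 2 ≤ 1) (he : 0 ≤ e) (a b : E) :
    pairSymbol θ e a ^ 2 + pairSymbol θ e b ^ 2
      = (1 - θ ^ 2) * pairEven e a b + (1 + θ ^ 2) * e := by
  rw [pairSymbol_sq h1 he, pairSymbol_sq h1 he, pairEven]
  ring

theorem half_pairSymbol_sq_add_le_pairEven (h1 : θ ^ 2 ≤ 1) (he : 0 ≤ e) (a b : E) :
    (pairSymbol θ e a ^ 2 + pairSymbol θ e b ^ 2) / 2 ≤ pairEven e a b := by
  rw [pairSymbol_sq h1 he, pairSymbol_sq h1 he, pairEven]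
  have h : 0 ≤ (1 + θ ^ 2) * (‖a‖ ^ 2 + ‖b‖ ^ 2) := by positivity
  linarith

theorem posSemidef_inv_pairEven (he : 0 < e) :
    (Matrix.of fun a b : E => (pairEven e a b)⁻¹).PosSemidef := by
  have h := posSemidef_inv_add (u := fun a : E => ‖a‖ ^ 2 + e / 2) fun a => by positivity
  refine (congrArg Matrix.PosSemidef (Matrix.ext fun a b => congrArg (·⁻¹) ?_)).mpr h
  rw [pairEven]
  ring

theorem posSemidef_pairSymbol_rpow_add_div (h1 : θ ^ 2 ≤ 1) (he : 0 < e) {β : ℝ}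
    (hβ0 : 0 ≤ β) (hβ2 : β ≤ 2) :
    (Matrix.of fun a b : E =>
      (pairSymbol θ e a ^ β + pairSymbol θ e b ^ β) / pairEven e a b).PosSemidef := by
  have hl := fun a : E => pairSymbol_pos h1 he a
  have h1' : 0 ≤ 1 - θ ^ 2 := sub_nonneg.2 h1
  have he' : 0 ≤ (1 + θ ^ 2) * e := by positivity
  have h := (posSemidef_rpow_add_div (u := fun a : E => pairSymbol θ e a ^ 2)
    (fun a => pow_pos (hl a) 2) (θ := β / 2) (by linarith) (by linarith)).hadamard
    ((posSemidef_const h1').add ((posSemidef_inv_pairEven he).smul he'))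
  refine (congrArg Matrix.PosSemidef (Matrix.ext fun a b => ?_)).mpr h
  have hpow : ∀ a : E, (pairSymbol θ e a ^ 2) ^ (β / 2) = pairSymbol θ e a ^ β := fun a => by
    rw [← Real.rpow_natCast_mul (hl a).le, Nat.cast_ofNat, mul_div_cancel₀ β two_ne_zero]
  have hX := pairEven_pos he a b
  have : (1 - θ ^ 2) * pairEven e a b + (1 + θ ^ 2) * e ≠ 0 := by positivity
  simp only [Matrix.of_apply, Matrix.hadamard_apply, Matrix.add_apply, Matrix.smul_apply,
    smul_eq_mul, hpow, pairSymbol_sq_add_pairSymbol_sq h1 he.le]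
  field_simp

variable [InnerProductSpace ℝ E]

/-- The part `2 θ ⟪a, b⟫` of the pair energy `‖a‖² + 2 θ ⟪a, b⟫ + ‖b‖² + e` that is odd under
`a ↦ -a`. -/
def pairOdd (θ : ℝ) (a b : E) : ℝ := 2 * θ * inner ℝ a b

theorem pairOdd_comm (a b : E) : pairOdd θ a b = pairOdd θ b a := by
  rw [pairOdd, pairOdd, real_inner_comm]

theorem abs_pairOdd_le (h0 : 0 ≤ θ) (he : 0 ≤ e) (a b : E) :
    |pairOdd θ a b| ≤ θ * pairEven e a b := by
  have hab : 2 * |inner ℝ a b| ≤ pairEven e a b := by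
    unfold pairEven
    linarith [abs_real_inner_le_norm a b, two_mul_le_add_sq ‖a‖ ‖b‖]
  rw [pairOdd, abs_mul, abs_mul, abs_two, abs_of_nonneg h0]
  linarith [mul_le_mul_of_nonneg_left hab h0]

theorem abs_pairOdd_lt (h0 : 0 ≤ θ) (h1 : θ < 1) (he : 0 < e) (a b : E) :
    |pairOdd θ a b| < pairEven e a b :=
  (abs_pairOdd_le h0 he.le a b).trans_lt (mul_lt_of_lt_one_left (pairEven_pos he a b) h1)

theorem mul_pairEven_le_add (h0 : 0 ≤ θ) (he : 0 ≤ e) (a b : E) :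
    (1 - θ) * pairEven e a b ≤ pairEven e a b + pairOdd θ a b := by
  linarith [(abs_le.1 (abs_pairOdd_le h0 he a b)).1]

theorem mul_pairEven_le_sub (h0 : 0 ≤ θ) (he : 0 ≤ e) (a b : E) :
    (1 - θ) * pairEven e a b ≤ pairEven e a b - pairOdd θ a b := by
  linarith [(abs_le.1 (abs_pairOdd_le h0 he a b)).2]

theorem mul_pairEven_sq_le_sq_sub_sq (h0 : 0 ≤ θ) (he : 0 ≤ e) (a b : E) :
    (1 - θ ^ 2) * pairEven e a b ^ 2 ≤ pairEven e a b ^ 2 - pairOdd θ a b ^ 2 := by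
  have h := pow_le_pow_left₀ (abs_nonneg _) (abs_pairOdd_le h0 he a b) 2
  rw [sq_abs, mul_pow] at h
  linarith

theorem pairEven_sq_sub_pairOdd_sq_pos (h0 : 0 ≤ θ) (h1 : θ < 1) (he : 0 < e) (a b : E) :
    0 < pairEven e a b ^ 2 - pairOdd θ a b ^ 2 :=
  sub_pos.2 (sq_lt_sq.2 ((abs_pairOdd_lt h0 h1 he a b).trans_le (le_abs_self _)))

theorem mul_abs_inner_le_pairSymbol_mul (h1 : θ ^ 2 ≤ 1) (he : 0 ≤ e) (a b : E) :
    (1 - θ ^ 2) * |inner ℝ a b| ≤ pairSymbol θ e a * pairSymbol θ e b := by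
  have h1' : 0 ≤ 1 - θ ^ 2 := sub_nonneg.2 h1
  have hle : ∀ a : E, Real.sqrt (1 - θ ^ 2) * ‖a‖ ≤ pairSymbol θ e a := fun a =>
    Real.le_sqrt_of_sq_le (by
      rw [mul_pow, Real.sq_sqrt h1']
      exact le_add_of_nonneg_right he)
  calc (1 - θ ^ 2) * |inner ℝ a b| ≤ (1 - θ ^ 2) * (‖a‖ * ‖b‖) := by
        gcongr; exact abs_real_inner_le_norm a b
    _ = (Real.sqrt (1 - θ ^ 2) * ‖a‖) * (Real.sqrt (1 - θ ^ 2) * ‖b‖) := by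
        rw [mul_mul_mul_comm, Real.mul_self_sqrt h1']
    _ ≤ _ := mul_le_mul (hle a) (hle b) (by positivity) (Real.sqrt_nonneg _)

theorem posSemidef_pairEven_sq_div (h0 : 0 ≤ θ) (h1 : θ < 1) (he : 0 < e) :
    (Matrix.of fun a b : E =>
      pairEven e a b ^ 2 / (pairEven e a b ^ 2 - pairOdd θ a b ^ 2)).PosSemidef := by
  have h2θ : 0 ≤ 2 * θ := by positivity
  have hratio := posSemidef_pow (((posSemidef_inner (id : E → E)).smul h2θ).hadamard
    (posSemidef_inv_pairEven he)) 2
  refine posSemidef_of_hasSum (fun n => posSemidef_pow hratio n) fun a b => ?_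
  have hX := pairEven_pos he a b
  have hlt : (pairOdd θ a b * (pairEven e a b)⁻¹) ^ 2 < 1 := by
    rw [mul_pow, inv_pow, ← div_eq_mul_inv, div_lt_one (by positivity)]
    exact sub_pos.1 (pairEven_sq_sub_pairOdd_sq_pos h0 h1 he a b)
  have hsum : pairEven e a b ^ 2 / (pairEven e a b ^ 2 - pairOdd θ a b ^ 2)
      = (1 - (pairOdd θ a b * (pairEven e a b)⁻¹) ^ 2)⁻¹ := by
    rw [mul_pow, inv_pow, ← div_eq_mul_inv, one_sub_div (by positivity), inv_div]
  rw [Matrix.of_apply, hsum]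
  exact hasSum_geometric_of_lt_one (sq_nonneg _) hlt

theorem posSemidef_pairEven_div (h0 : 0 ≤ θ) (h1 : θ < 1) (he : 0 < e) :
    (Matrix.of fun a b : E =>
      pairEven e a b / (pairEven e a b ^ 2 - pairOdd θ a b ^ 2)).PosSemidef := by
  refine (congrArg Matrix.PosSemidef (Matrix.ext fun a b => ?_)).mpr
    ((posSemidef_inv_pairEven he).hadamard (posSemidef_pairEven_sq_div h0 h1 he))
  have hX := (pairEven_pos he a b).ne'
  simp only [Matrix.of_apply, Matrix.hadamard_apply]
  field_simp

theorem posSemidef_reg_add_mul_pairEven_div (h0 : 0 ≤ θ) (h1 : θ < 1) (he : 0 < e) {β ε c : ℝ}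
    (hβ0 : 0 ≤ β) (hβ2 : β ≤ 2) (hε : 0 ≤ ε) (hc : 0 ≤ c) :
    (Matrix.of fun a b : E =>
      (reg β ε (c * pairSymbol θ e a) + reg β ε (c * pairSymbol θ e b))
        * (pairEven e a b / (pairEven e a b ^ 2 - pairOdd θ a b ^ 2))).PosSemidef := by
  have h1' : θ ^ 2 ≤ 1 := pow_le_one₀ h0 h1.le
  refine posSemidef_reg_add_mul (fun a => mul_nonneg hc (pairSymbol_pos h1' he a).le) hε
    (posSemidef_pairEven_div h0 h1 he) ?_
  refine (congrArg Matrix.PosSemidef (Matrix.ext fun a b => ?_)).mpr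
    (((posSemidef_pairSymbol_rpow_add_div h1' he hβ0 hβ2).hadamard
      (posSemidef_pairEven_sq_div h0 h1 he)).smul (Real.rpow_nonneg hc β))
  have hX := (pairEven_pos he a b).ne'
  simp only [Matrix.of_apply, Matrix.hadamard_apply, Matrix.smul_apply, smul_eq_mul,
    Real.mul_rpow hc (pairSymbol_pos h1' he _).le]
  field_simp

end PairKernel

section Kernel

/-- The term `m / (1 + m) * (Q² + A K²)`, with `A = 1 / (2 + m)`, that makes `1 / G` and `ℓ_m` pair
energies in the shifted momenta `s + A K` and `t + A K` with coupling `1 / (1 + m)`. -/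
noncomputable def gap (m : ℝ) (K : E3) (Q : ℝ) : ℝ :=
  m / (1 + m) * (Q ^ 2 + (2 + m)⁻¹ * ‖K‖ ^ 2)

/-- The part of `1 / G` that is even under reflection of `s + A K`. -/
noncomputable def evenDen (m : ℝ) (K : E3) (Q : ℝ) (s t : E3) : ℝ :=
  pairEven (gap m K Q) (s + (2 + m)⁻¹ • K) (t + (2 + m)⁻¹ • K)

/-- The part of `1 / G` that is odd under reflection of `s + A K`. -/
noncomputable def oddDen (m : ℝ) (K : E3) (s t : E3) : ℝ :=
  pairOdd (1 + m)⁻¹ (s + (2 + m)⁻¹ • K) (t + (2 + m)⁻¹ • K)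

variable {m Q : ℝ} {K s t : E3}

theorem evenDen_comm : evenDen m K Q s t = evenDen m K Q t s := pairEven_comm _ _

theorem oddDen_comm : oddDen m K s t = oddDen m K t s := pairOdd_comm _ _

theorem inv_one_add_lt_one (hm : 0 < m) : (1 + m)⁻¹ < 1 := inv_lt_one_of_one_lt₀ (by linarith)

theorem inv_one_add_sq_le_one (hm : 0 < m) : (1 + m)⁻¹ ^ 2 ≤ 1 :=
  pow_le_one₀ (by positivity) (inv_one_add_lt_one hm).le

theorem one_sub_inv_one_add (hm : 0 < m) : 1 - (1 + m)⁻¹ = m / (m + 1) := by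
  field_simp
  ring

theorem gap_pos (hm : 0 < m) (hQ : 0 < Q) : 0 < gap m K Q := by
  unfold gap; positivity

theorem evenDen_pos (hm : 0 < m) (hQ : 0 < Q) : 0 < evenDen m K Q s t :=
  pairEven_pos (gap_pos hm hQ) _ _

theorem abs_oddDen_lt (hm : 0 < m) (hQ : 0 < Q) : |oddDen m K s t| < evenDen m K Q s t :=
  abs_pairOdd_lt (by positivity) (inv_one_add_lt_one hm) (gap_pos hm hQ) _ _

theorem evenDen_sq_sub_oddDen_sq_pos (hm : 0 < m) (hQ : 0 < Q) :
    0 < evenDen m K Q s t ^ 2 - oddDen m K s t ^ 2 :=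
  pairEven_sq_sub_pairOdd_sq_pos (by positivity) (inv_one_add_lt_one hm) (gap_pos hm hQ) _ _

theorem mul_evenDen_le_add (hm : 0 < m) (hQ : 0 < Q) :
    m / (m + 1) * evenDen m K Q s t ≤ evenDen m K Q s t + oddDen m K s t :=
  one_sub_inv_one_add hm ▸ mul_pairEven_le_add (by positivity) (gap_pos hm hQ).le _ _

theorem mul_evenDen_le_sub (hm : 0 < m) (hQ : 0 < Q) :
    m / (m + 1) * evenDen m K Q s t ≤ evenDen m K Q s t - oddDen m K s t :=
  one_sub_inv_one_add hm ▸ mul_pairEven_le_sub (by positivity) (gap_pos hm hQ).le _ _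

theorem ell_eq_pairSymbol (hm : 0 < m) (s K : E3) (Q : ℝ) :
    ell m s K Q = pairSymbol (1 + m)⁻¹ (gap m K Q) (s + (2 + m)⁻¹ • K) := by
  unfold ell pairSymbol gap
  congr 1
  rw [norm_add_sq_real, norm_add_sq_real, real_inner_smul_right, norm_smul,
    Real.norm_of_nonneg (by positivity)]
  field_simp
  ring

theorem ell_pos (hm : 0 < m) (hQ : 0 < Q) : 0 < ell m s K Q :=
  Real.sqrt_pos.2 (by positivity)

theorem half_ell_sq_add_le_evenDen (hm : 0 < m) (hQ : 0 < Q) :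
    (ell m s K Q ^ 2 + ell m t K Q ^ 2) / 2 ≤ evenDen m K Q s t := by
  rw [ell_eq_pairSymbol hm, ell_eq_pairSymbol hm]
  exact half_pairSymbol_sq_add_le_pairEven (inv_one_add_sq_le_one hm) (gap_pos hm hQ).le _ _

theorem mul_norm_sq_add_sq_le_ell_sq (hm : 0 < m) :
    m / (m + 1) * (‖s‖ ^ 2 + Q ^ 2) ≤ ell m s K Q ^ 2 := by
  rw [ell, Real.sq_sqrt (by positivity)]
  exact le_add_of_nonneg_left (by positivity)

theorem sqrt_mul_norm_le_ell (hm : 0 < m) : Real.sqrt (m / (m + 1)) * ‖s‖ ≤ ell m s K Q := by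
  refine Real.le_sqrt_of_sq_le ?_
  rw [mul_pow, Real.sq_sqrt (by positivity), mul_add]
  exact le_add_of_nonneg_of_le (by positivity) (le_add_of_nonneg_right (by positivity))

theorem mul_norm_sq_add_ell_sq_le (hm : 0 < m) :
    m / (m + 1) * (‖t‖ ^ 2 + ell m s K Q ^ 2) ≤ ell m t K Q ^ 2 + ell m s K Q ^ 2 := by
  rw [mul_add]
  refine add_le_add (le_trans ?_ (mul_norm_sq_add_sq_le_ell_sq (Q := Q) hm))
    (mul_le_of_le_one_left (sq_nonneg _) ?_)
  · gcongr
    exact le_add_of_nonneg_right (sq_nonneg Q)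
  · rw [div_le_one (by positivity)]
    linarith

theorem rpow_ell_le_mul_rpow_norm (hm : 0 < m) (ht : t ≠ 0) {a : ℝ} (ha : a ≤ 0) :
    ell m t K Q ^ a ≤ Real.sqrt (m / (m + 1)) ^ a * ‖t‖ ^ a := by
  have : 0 < ‖t‖ := norm_pos_iff.2 ht
  rw [← Real.mul_rpow (by positivity) (by positivity)]
  exact Real.rpow_le_rpow_of_nonpos (by positivity) (sqrt_mul_norm_le_ell hm) ha

theorem posSemidef_reg_ell_add_mul_evenDen_div (hm : 0 < m) (hQ : 0 < Q) {β ε : ℝ}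
    (hβ0 : 0 ≤ β) (hβ2 : β ≤ 2) (hε : 0 ≤ ε) :
    (Matrix.of fun s t : E3 =>
      (reg β ε (2 * Real.pi ^ 2 * ell m s K Q) + reg β ε (2 * Real.pi ^ 2 * ell m t K Q))
        * (evenDen m K Q s t / (evenDen m K Q s t ^ 2 - oddDen m K s t ^ 2))).PosSemidef := by
  simp only [ell_eq_pairSymbol hm]
  exact (posSemidef_reg_add_mul_pairEven_div (by positivity) (inv_one_add_lt_one hm)
    (gap_pos hm hQ) hβ0 hβ2 hε (by positivity)).submatrix fun s => s + (2 + m)⁻¹ • K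

theorem lambdaIntegrand_eq (β m : ℝ) (s K : E3) (Q : ℝ) (t : E3) :
    LambdaIntegrand β m s K Q t = 1 / ‖t‖ ^ 2
      * (ell m s K Q ^ ((β - 1) / 2) / ell m t K Q ^ ((β + 1) / 2)
        + ell m t K Q ^ ((β - 1) / 2) / ell m s K Q ^ ((β + 1) / 2))
      * (|inner ℝ (s + (2 + m)⁻¹ • K) (t + (2 + m)⁻¹ • K)|
        / (evenDen m K Q s t ^ 2 - oddDen m K s t ^ 2)) := by
  simp only [LambdaIntegrand, evenDen, oddDen, pairEven, pairOdd, gap, div_eq_mul_inv]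

end Kernel

section ManyBody

variable {n : ℕ} {m μ : ℝ}

/-- The value of `Q` for which `G` and `L` are expressed through `ℓ_m`: the length of `q` with the
mass term `μ` absorbed. -/
noncomputable def effQ (m μ : ℝ) (q : Fin n → E3) : ℝ :=
  Real.sqrt (∑ i, ‖q i‖ ^ 2 + (m + 1) / m * μ)

theorem effQ_sq (hm : 0 < m) (hμ : 0 < μ) (q : Fin n → E3) :
    effQ m μ q ^ 2 = ∑ i, ‖q i‖ ^ 2 + (m + 1) / m * μ := Real.sq_sqrt (by positivity)

theorem effQ_pos (hm : 0 < m) (hμ : 0 < μ) (q : Fin n → E3) : 0 < effQ m μ q :=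
  Real.sqrt_pos.2 (by positivity)

theorem sum_sum_Ioi_inner {E : Type*} [NormedAddCommGroup E] [InnerProductSpace ℝ E] {k : ℕ}
    (q : Fin k → E) :
    ∑ i, ∑ j ∈ Finset.Ioi i, inner ℝ (q i) (q j) = (‖∑ i, q i‖ ^ 2 - ∑ i, ‖q i‖ ^ 2) / 2 := by
  induction k with
  | zero => simp
  | succ k ih =>
    rw [Fin.sum_univ_succ, Fin.sum_univ_succ, Fin.sum_univ_succ, norm_add_sq_real]
    have hzero : ∑ j ∈ Finset.Ioi (0 : Fin (k + 1)), inner ℝ (q 0) (q j)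
        = inner ℝ (q 0) (∑ i : Fin k, q i.succ) := by
      rw [inner_sum, Fin.Ioi_zero_eq_map, Finset.sum_map]; rfl
    have hsucc : ∀ i : Fin k, ∑ j ∈ Finset.Ioi i.succ, inner ℝ (q i.succ) (q j)
        = ∑ j ∈ Finset.Ioi i, inner ℝ (q i.succ) (q j.succ) := fun i => by
      rw [Fin.Ioi_succ, Finset.sum_map]; rfl
    simp_rw [hzero, hsucc, ih fun i => q i.succ]
    ring

theorem L_cons (hm : 0 < m) (hμ : 0 < μ) (s : E3) (q : Fin n → E3) :
    L m μ (cons s q) = 2 * Real.pi ^ 2 * ell m s (∑ i, q i) (effQ m μ q) := by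
  unfold L ell
  congr 2
  rw [effQ_sq hm hμ, sum_sum_Ioi_inner]
  simp only [cons, Fin.sum_univ_succ, Fin.cons_zero, Fin.cons_succ]
  rw [norm_add_sq_real s]
  field_simp
  ring

theorem G_cons_cons (hm : 0 < m) (hμ : 0 < μ) (s t : E3) (q : Fin n → E3) :
    G m μ (Fin.cons s (Fin.cons t q : Fin (n + 1) → E3) : Fin (n + 2) → E3)
      = (evenDen m (∑ i, q i) (effQ m μ q) s t + oddDen m (∑ i, q i) s t)⁻¹ := by
  unfold G evenDen oddDen pairEven pairOdd gap
  congr 1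
  rw [effQ_sq hm hμ, sum_sum_Ioi_inner]
  simp only [Fin.sum_univ_succ, Fin.cons_zero, Fin.cons_succ]
  generalize ∑ i, q i = K
  simp only [← real_inner_self_eq_norm_sq, inner_add_left, inner_add_right, real_inner_smul_left,
    real_inner_smul_right]
  rw [real_inner_comm s t, real_inner_comm s K, real_inner_comm t K]
  field_simp
  ring

end ManyBody

section LambdaFinite

theorem lintegral_eq_mul_lintegral_comp_smul {E : Type*} [NormedAddCommGroup E]
    [InnerProductSpace ℝ E] [FiniteDimensional ℝ E] [MeasurableSpace E] [BorelSpace E]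
    {R : ℝ} (hR : 0 < R) (f : E → ℝ≥0∞) :
    ∫⁻ x, f x = ENNReal.ofReal (R ^ Module.finrank ℝ E) * ∫⁻ x, f (R • x) := by
  have e : MeasurableEmbedding fun x : E => R • x :=
    (Homeomorph.smulOfNeZero R hR.ne').measurableEmbedding
  rw [← e.lintegral_map, Measure.map_addHaar_smul volume hR.ne', lintegral_smul_measure,
    abs_of_pos (by positivity), smul_eq_mul, ← mul_assoc, ← ENNReal.ofReal_mul (by positivity),
    mul_inv_cancel₀ (by positivity), ENNReal.ofReal_one, one_mul]

theorem integrableOn_sq_mul_rpow_div {δ : ℝ} (h1 : 1 < δ) (h3 : δ < 3) :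
    IntegrableOn (fun r : ℝ => r ^ 2 * (r ^ (-δ) / (r ^ 2 + 1))) (Set.Ioi 0) := by
  have hm : Measurable fun r : ℝ => r ^ 2 * (r ^ (-δ) / (r ^ 2 + 1)) := by fun_prop
  rw [← Set.Ioc_union_Ioi_eq_Ioi zero_le_one]
  refine .union ?_ ?_
  · refine (intervalIntegral.intervalIntegrable_rpow' (a := 0) (b := 1) (r := 2 - δ)
      (by linarith)).1.mono' hm.aestronglyMeasurable ?_
    filter_upwards [ae_restrict_mem measurableSet_Ioc] with r hr
    have hr0 : 0 < r := hr.1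
    rw [Real.norm_of_nonneg (by positivity), mul_div_assoc', sub_eq_add_neg, Real.rpow_add hr0,
      Real.rpow_two]
    exact div_le_self (by positivity) (le_add_of_nonneg_left (sq_nonneg r))
  · refine (integrableOn_Ioi_rpow_of_lt (a := -δ) (by linarith) one_pos).mono'
      hm.aestronglyMeasurable ?_
    filter_upwards [ae_restrict_mem measurableSet_Ioi] with r hr
    have hr0 : 0 < r := one_pos.trans hr
    rw [Real.norm_of_nonneg (by positivity), mul_div_left_comm]
    exact mul_le_of_le_one_right (by positivity)
      ((div_le_one (by positivity)).2 (le_add_of_nonneg_right zero_le_one))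

theorem integrable_rpow_norm_div {δ : ℝ} (h1 : 1 < δ) (h3 : δ < 3) :
    Integrable fun t : E3 => ‖t‖ ^ (-δ) / (‖t‖ ^ 2 + 1) := by
  rw [integrable_fun_norm_addHaar (volume : Measure E3)
    (f := fun r : ℝ => r ^ (-δ) / (r ^ 2 + 1))]
  simpa only [finrank_euclideanSpace, Fintype.card_fin, smul_eq_mul, Nat.add_one_sub_one]
    using integrableOn_sq_mul_rpow_div h1 h3

theorem exists_lintegral_rpow_norm_div_eq {δ : ℝ} (h1 : 1 < δ) (h3 : δ < 3) :
    ∃ C : ℝ≥0∞, C ≠ ⊤ ∧ ∀ R : ℝ, 0 < R →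
      ∫⁻ t : E3, ENNReal.ofReal (‖t‖ ^ (-δ) / (‖t‖ ^ 2 + R ^ 2))
        = C * ENNReal.ofReal (R ^ (1 - δ)) := by
  refine ⟨∫⁻ t : E3, ENNReal.ofReal (‖t‖ ^ (-δ) / (‖t‖ ^ 2 + 1)),
    (integrable_rpow_norm_div h1 h3).lintegral_lt_top.ne, fun R hR => ?_⟩
  rw [lintegral_eq_mul_lintegral_comp_smul hR, ← lintegral_const_mul' _ _ ENNReal.ofReal_ne_top,
    mul_comm, ← lintegral_const_mul' _ _ ENNReal.ofReal_ne_top]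
  refine lintegral_congr fun t => ?_
  rw [← ENNReal.ofReal_mul (by positivity), ← ENNReal.ofReal_mul (by positivity)]
  congr 1
  rw [norm_smul, Real.norm_of_nonneg hR.le, Real.mul_rpow hR.le (norm_nonneg _),
    Real.rpow_sub hR, Real.rpow_one, Real.rpow_neg hR.le, finrank_euclideanSpace, Fintype.card_fin]
  field_simp

theorem abs_inner_div_le {E : Type*} [NormedAddCommGroup E] [InnerProductSpace ℝ E] {θ e : ℝ}
    (h0 : 0 ≤ θ) (h1 : θ < 1) (he : 0 < e) (a b : E) :
    |inner ℝ a b| / (pairEven e a b ^ 2 - pairOdd θ a b ^ 2)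
      ≤ 4 / (1 - θ ^ 2) ^ 2 * (pairSymbol θ e a * pairSymbol θ e b
        / (pairSymbol θ e a ^ 2 + pairSymbol θ e b ^ 2) ^ 2) := by
  have hθ : θ ^ 2 < 1 := pow_lt_one₀ h0 h1 two_ne_zero
  have hc : 0 < 1 - θ ^ 2 := sub_pos.2 hθ
  have hin := mul_abs_inner_le_pairSymbol_mul hθ.le he.le a b
  rw [← le_div_iff₀' hc] at hin
  have hden : (1 - θ ^ 2) * ((pairSymbol θ e a ^ 2 + pairSymbol θ e b ^ 2) / 2) ^ 2
      ≤ pairEven e a b ^ 2 - pairOdd θ a b ^ 2 :=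
    (mul_le_mul_of_nonneg_left (pow_le_pow_left₀ (by positivity)
      (half_pairSymbol_sq_add_le_pairEven hθ.le he.le a b) 2) hc.le).trans
      (mul_pairEven_sq_le_sq_sub_sq h0 he.le a b)
  have := pairSymbol_pos hθ.le he a
  calc _ ≤ pairSymbol θ e a * pairSymbol θ e b / (1 - θ ^ 2)
        / ((1 - θ ^ 2) * ((pairSymbol θ e a ^ 2 + pairSymbol θ e b ^ 2) / 2) ^ 2) :=
        div_le_div₀ ((abs_nonneg _).trans hin) hin (by positivity) hden
    _ = _ := by
        field_simp
        norm_num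

theorem rpow_div_rpow_mul_le {β x y z : ℝ} (h0 : 0 ≤ β) (h2 : β ≤ 2) (hx : 0 < x) (hy : 0 < y)
    (hxz : x ≤ z) (hyz : y ≤ z) :
    y ^ ((β - 1) / 2) / x ^ ((β + 1) / 2) * (x * y)
      ≤ z ^ (3 / 2 : ℝ) * x ^ (-(1 / 2) : ℝ) := by
  have hz : 0 < z := hx.trans_le hxz
  have hexp : y ^ ((β - 1) / 2) / x ^ ((β + 1) / 2) * (x * y)
      = y ^ ((β + 1) / 2) * x ^ ((2 - β) / 2) * x ^ (-(1 / 2) : ℝ) := by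
    rw [mul_assoc, ← Real.rpow_add hx, show (β + 1) / 2 = (β - 1) / 2 + 1 by ring,
      Real.rpow_add hy, Real.rpow_one,
      show (2 - β) / 2 + -(1 / 2) = 1 - ((β - 1) / 2 + 1) by ring, Real.rpow_sub hx, Real.rpow_one]
    field_simp
  rw [hexp, show (3 / 2 : ℝ) = (β + 1) / 2 + (2 - β) / 2 by ring, Real.rpow_add hz]
  gcongr

theorem rpow_div_rpow_add_mul_le {β x y : ℝ} (h0 : 0 ≤ β) (h2 : β ≤ 2) (hx : 0 < x)
    (hy : 0 < y) :
    (y ^ ((β - 1) / 2) / x ^ ((β + 1) / 2) + x ^ ((β - 1) / 2) / y ^ ((β + 1) / 2))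
        * (y * x / (y ^ 2 + x ^ 2) ^ 2)
      ≤ (x ^ (-(1 / 2) : ℝ) + y ^ (-(1 / 2) : ℝ)) * (y ^ (-(1 / 2) : ℝ) / (x ^ 2 + y ^ 2)) := by
  set z := Real.sqrt (x ^ 2 + y ^ 2)
  have hzz : z ^ 2 = x ^ 2 + y ^ 2 := Real.sq_sqrt (by positivity)
  have hz : 0 < z := Real.sqrt_pos.2 (by positivity)
  have hxz : x ≤ z := Real.le_sqrt_of_sq_le (le_add_of_nonneg_right (sq_nonneg y))
  have hyz : y ≤ z := Real.le_sqrt_of_sq_le (le_add_of_nonneg_left (sq_nonneg x))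
  have hzpow : z ^ (3 / 2 : ℝ) / (z ^ 2) ^ 2 = z ^ (-(1 / 2) : ℝ) / z ^ 2 := by
    rw [show (-(1 / 2) : ℝ) = 3 / 2 - 2 by norm_num, Real.rpow_sub hz, Real.rpow_two]
    field_simp
  rw [add_comm (y ^ 2), ← hzz]
  calc _ = (y ^ ((β - 1) / 2) / x ^ ((β + 1) / 2) * (x * y)
          + x ^ ((β - 1) / 2) / y ^ ((β + 1) / 2) * (y * x)) / (z ^ 2) ^ 2 := by ring
    _ ≤ (z ^ (3 / 2 : ℝ) * x ^ (-(1 / 2) : ℝ) + z ^ (3 / 2 : ℝ) * y ^ (-(1 / 2) : ℝ))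
          / (z ^ 2) ^ 2 :=
        div_le_div_of_nonneg_right (add_le_add (rpow_div_rpow_mul_le h0 h2 hx hy hxz hyz)
          (rpow_div_rpow_mul_le h0 h2 hy hx hyz hxz)) (by positivity)
    _ = (x ^ (-(1 / 2) : ℝ) + y ^ (-(1 / 2) : ℝ)) * (z ^ (-(1 / 2) : ℝ) / z ^ 2) := by
        rw [← hzpow]; ring
    _ ≤ _ := by
        have := Real.rpow_le_rpow_of_nonpos hy hyz (by norm_num : (-(1 / 2) : ℝ) ≤ 0)
        gcongr

theorem rpow_add_mul_div_div_sq_le {k x y r : ℝ} (hk : 0 < k) (hy : 0 < y) (hr : 0 < r)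
    (hsq : k * (r ^ 2 + y ^ 2) ≤ x ^ 2 + y ^ 2)
    (hx : x ^ (-(1 / 2) : ℝ) ≤ Real.sqrt k ^ (-(1 / 2) : ℝ) * r ^ (-(1 / 2) : ℝ)) :
    (x ^ (-(1 / 2) : ℝ) + y ^ (-(1 / 2) : ℝ)) * (y ^ (-(1 / 2) : ℝ) / (x ^ 2 + y ^ 2)) / r ^ 2
      ≤ k⁻¹ * (Real.sqrt k ^ (-(1 / 2) : ℝ) + 1)
        * (y ^ (-(1 / 2) : ℝ) * (r ^ (-(5 / 2) : ℝ) / (r ^ 2 + y ^ 2))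
          + y ^ (-1 : ℝ) * (r ^ (-2 : ℝ) / (r ^ 2 + y ^ 2))) := by
  have h52 : r ^ (-(5 / 2) : ℝ) = r ^ (-2 : ℝ) * r ^ (-(1 / 2) : ℝ) := by
    rw [← Real.rpow_add hr]; norm_num
  have h1 : y ^ (-1 : ℝ) = y ^ (-(1 / 2) : ℝ) * y ^ (-(1 / 2) : ℝ) := by
    rw [← Real.rpow_add hy]; norm_num
  calc _ ≤ (Real.sqrt k ^ (-(1 / 2) : ℝ) + 1) * (r ^ (-(1 / 2) : ℝ) + y ^ (-(1 / 2) : ℝ))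
          * (y ^ (-(1 / 2) : ℝ) / (k * (r ^ 2 + y ^ 2))) / r ^ 2 := by
        have : 0 ≤ Real.sqrt k ^ (-(1 / 2) : ℝ) * y ^ (-(1 / 2) : ℝ) := by positivity
        have : 0 ≤ r ^ (-(1 / 2) : ℝ) := by positivity
        gcongr
        linarith
    _ = _ := by
        rw [h52, h1, Real.rpow_neg hr.le 2, Real.rpow_two]
        field_simp

theorem exists_lambdaIntegrand_le {m : ℝ} (hm : 0 < m) :
    ∃ C : ℝ, 0 ≤ C ∧ ∀ β : ℝ, 0 ≤ β → β ≤ 2 → ∀ (s K : E3) (Q : ℝ), 0 < Q → ∀ t : E3, t ≠ 0 →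
      LambdaIntegrand β m s K Q t ≤
        C * (ell m s K Q ^ (-(1 / 2) : ℝ)
            * (‖t‖ ^ (-(5 / 2) : ℝ) / (‖t‖ ^ 2 + ell m s K Q ^ 2))
          + ell m s K Q ^ (-1 : ℝ) * (‖t‖ ^ (-2 : ℝ) / (‖t‖ ^ 2 + ell m s K Q ^ 2))) := by
  set c : ℝ := 1 - (1 + m)⁻¹ ^ 2
  set k : ℝ := m / (m + 1)
  have hk : 0 < k := by positivity
  refine ⟨4 / c ^ 2 * k⁻¹ * (Real.sqrt k ^ (-(1 / 2) : ℝ) + 1), by positivity, ?_⟩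
  intro β h0 h2 s K Q hQ t ht
  have ht0 : 0 < ‖t‖ := norm_pos_iff.2 ht
  have hinner := abs_inner_div_le (by positivity) (inv_one_add_lt_one hm)
    (gap_pos (K := K) hm hQ) (s + (2 + m)⁻¹ • K) (t + (2 + m)⁻¹ • K)
  rw [← ell_eq_pairSymbol hm, ← ell_eq_pairSymbol hm] at hinner
  have hy : 0 < ell m s K Q := ell_pos hm hQ
  have hx : 0 < ell m t K Q := ell_pos hm hQ
  have hweight := rpow_div_rpow_add_mul_le h0 h2 hx hy
  have hz : k * (‖t‖ ^ 2 + ell m s K Q ^ 2) ≤ ell m t K Q ^ 2 + ell m s K Q ^ 2 :=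
    mul_norm_sq_add_ell_sq_le hm
  have hxt : ell m t K Q ^ (-(1 / 2) : ℝ) ≤ Real.sqrt k ^ (-(1 / 2) : ℝ) * ‖t‖ ^ (-(1 / 2) : ℝ) :=
    rpow_ell_le_mul_rpow_norm hm ht (by norm_num)
  rw [lambdaIntegrand_eq]
  set y := ell m s K Q
  set x := ell m t K Q
  calc _ ≤ 1 / ‖t‖ ^ 2
        * (y ^ ((β - 1) / 2) / x ^ ((β + 1) / 2) + x ^ ((β - 1) / 2) / y ^ ((β + 1) / 2))
        * (4 / c ^ 2 * (y * x / (y ^ 2 + x ^ 2) ^ 2)) :=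
        mul_le_mul_of_nonneg_left hinner (by positivity)
    _ = 1 / ‖t‖ ^ 2 * (4 / c ^ 2)
        * ((y ^ ((β - 1) / 2) / x ^ ((β + 1) / 2) + x ^ ((β - 1) / 2) / y ^ ((β + 1) / 2))
          * (y * x / (y ^ 2 + x ^ 2) ^ 2)) := by ring
    _ ≤ 1 / ‖t‖ ^ 2 * (4 / c ^ 2)
        * ((x ^ (-(1 / 2) : ℝ) + y ^ (-(1 / 2) : ℝ)) * (y ^ (-(1 / 2) : ℝ) / (x ^ 2 + y ^ 2))) := by
        gcongr
    _ = 4 / c ^ 2 * ((x ^ (-(1 / 2) : ℝ) + y ^ (-(1 / 2) : ℝ))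
        * (y ^ (-(1 / 2) : ℝ) / (x ^ 2 + y ^ 2)) / ‖t‖ ^ 2) := by ring
    _ ≤ _ := by
        rw [mul_assoc (4 / c ^ 2), mul_assoc (4 / c ^ 2)]
        exact mul_le_mul_of_nonneg_left (rpow_add_mul_div_div_sq_le hk hy ht0 hz hxt)
          (by positivity)

theorem ae_ne_zero : ∀ᵐ t : E3, t ≠ 0 := by
  simp [ae_iff]

theorem exists_lintegral_lambdaIntegrand_le {m : ℝ} (hm : 0 < m) :
    ∃ C : ℝ≥0∞, C ≠ ⊤ ∧ ∀ β : ℝ, 0 ≤ β → β ≤ 2 → ∀ (s K : E3) (Q : ℝ), 0 < Q →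
      ∫⁻ t, ENNReal.ofReal (LambdaIntegrand β m s K Q t)
        ≤ ENNReal.ofReal (ell m s K Q ^ (-2 : ℝ)) * C := by
  obtain ⟨C, hC0, hC⟩ := exists_lambdaIntegrand_le hm
  obtain ⟨C₁, hC₁, h₁⟩ :=
    exists_lintegral_rpow_norm_div_eq (δ := 5 / 2) (by norm_num) (by norm_num)
  obtain ⟨C₂, hC₂, h₂⟩ := exists_lintegral_rpow_norm_div_eq (δ := 2) (by norm_num) (by norm_num)
  refine ⟨ENNReal.ofReal C * (C₁ + C₂), by finiteness, fun β h0 h2 s K Q hQ => ?_⟩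
  have hy : 0 < ell m s K Q := ell_pos hm hQ
  have hb := hC β h0 h2 s K Q hQ
  set y := ell m s K Q
  have hy₁ : y ^ (-2 : ℝ) = y ^ (-(1 / 2) : ℝ) * y ^ (1 - 5 / 2 : ℝ) := by
    rw [← Real.rpow_add hy]; norm_num
  have hy₂ : y ^ (-2 : ℝ) = y ^ (-1 : ℝ) * y ^ (1 - 2 : ℝ) := by
    rw [← Real.rpow_add hy]; norm_num
  calc _ ≤ ∫⁻ t : E3, ENNReal.ofReal C * (ENNReal.ofReal (y ^ (-(1 / 2) : ℝ))
          * ENNReal.ofReal (‖t‖ ^ (-(5 / 2) : ℝ) / (‖t‖ ^ 2 + y ^ 2))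
        + ENNReal.ofReal (y ^ (-1 : ℝ))
          * ENNReal.ofReal (‖t‖ ^ (-2 : ℝ) / (‖t‖ ^ 2 + y ^ 2))) := by
        refine lintegral_mono_ae ?_
        filter_upwards [ae_ne_zero] with t ht
        refine (ENNReal.ofReal_le_ofReal (hb t ht)).trans_eq ?_
        rw [ENNReal.ofReal_mul hC0, ENNReal.ofReal_add (by positivity) (by positivity),
          ENNReal.ofReal_mul (by positivity), ENNReal.ofReal_mul (by positivity)]
    _ = ENNReal.ofReal C
          * (ENNReal.ofReal (y ^ (-(1 / 2) : ℝ)) * ENNReal.ofReal (y ^ (1 - 5 / 2 : ℝ)) * C₁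
          + ENNReal.ofReal (y ^ (-1 : ℝ)) * ENNReal.ofReal (y ^ (1 - 2 : ℝ)) * C₂) := by
        rw [lintegral_const_mul' _ _ ENNReal.ofReal_ne_top, lintegral_add_left (by fun_prop),
          lintegral_const_mul' _ _ ENNReal.ofReal_ne_top,
          lintegral_const_mul' _ _ ENNReal.ofReal_ne_top, h₁ y hy, h₂ y hy]
        ring
    _ = _ := by
        rw [← ENNReal.ofReal_mul (by positivity), ← ENNReal.ofReal_mul (by positivity), ← hy₁,
          ← hy₂]
        ring

theorem lambda_ne_top {m : ℝ} (hm : 0 < m) {β : ℝ} (h0 : 0 ≤ β) (h2 : β ≤ 2) :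
    Lambda β m ≠ ⊤ := by
  obtain ⟨C, hC, hle⟩ := exists_lintegral_lambdaIntegrand_le hm
  refine ne_top_of_le_ne_top
    (b := ENNReal.ofReal ((m / (m + 1))⁻¹ / (Real.pi ^ 2 * (1 + m))) * C) (by finiteness) ?_
  refine iSup_le fun s => iSup_le fun K => iSup_le fun Q => iSup_le fun hQ => ?_
  have hy : 0 < ell m s K Q := ell_pos hm hQ
  have hsQ : ‖s‖ ^ 2 + Q ^ 2 ≤ (m / (m + 1))⁻¹ * ell m s K Q ^ 2 := by
    rw [inv_mul_eq_div, le_div_iff₀' (by positivity)]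
    exact mul_norm_sq_add_sq_le_ell_sq hm
  refine (mul_le_mul_right (hle β h0 h2 s K Q hQ) _).trans ?_
  rw [← mul_assoc, ← ENNReal.ofReal_mul (by positivity)]
  refine mul_le_mul_left (ENNReal.ofReal_le_ofReal ?_) _
  calc (‖s‖ ^ 2 + Q ^ 2) / (Real.pi ^ 2 * (1 + m)) * ell m s K Q ^ (-2 : ℝ)
      ≤ ((m / (m + 1))⁻¹ * ell m s K Q ^ 2) / (Real.pi ^ 2 * (1 + m))
        * ell m s K Q ^ (-2 : ℝ) := by gcongr
    _ = _ := by
        rw [Real.rpow_neg hy.le, Real.rpow_two]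
        field_simp

theorem exists_schurWeight_le {m : ℝ} (hm : 0 < m) {α : ℝ} (h1 : α ≤ 1) :
    ∃ C : ℝ, 0 ≤ C ∧ ∀ (s K : E3) (Q : ℝ), 0 < Q → ∀ t : E3, t ≠ 0 →
      ‖t‖ ^ (-(3 / 2) : ℝ) * (ell m s K Q ^ (-α) * ell m t K Q ^ (α - 1)
          * (evenDen m K Q s t + oddDen m K s t)⁻¹)
        ≤ C * ell m s K Q ^ (-α) * (‖t‖ ^ (-(5 / 2 - α)) / (‖t‖ ^ 2 + ell m s K Q ^ 2)) := by
  set k : ℝ := m / (m + 1)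
  have hk : 0 < k := by positivity
  refine ⟨Real.sqrt k ^ (α - 1) * (2 * k⁻¹ * k⁻¹), by positivity, fun s K Q hQ t ht => ?_⟩
  have ht0 : 0 < ‖t‖ := norm_pos_iff.2 ht
  have hy : 0 < ell m s K Q := ell_pos hm hQ
  have hxt : ell m t K Q ^ (α - 1) ≤ Real.sqrt k ^ (α - 1) * ‖t‖ ^ (α - 1) :=
    rpow_ell_le_mul_rpow_norm hm ht (by linarith)
  have hden : k * (k * (‖t‖ ^ 2 + ell m s K Q ^ 2) / 2) ≤ evenDen m K Q s t + oddDen m K s t := by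
    refine le_trans ?_ (mul_evenDen_le_add hm hQ)
    gcongr
    refine le_trans ?_ (half_ell_sq_add_le_evenDen hm hQ)
    rw [add_comm (ell m s K Q ^ 2)]
    gcongr
    exact mul_norm_sq_add_ell_sq_le hm
  have hden0 : 0 < k * (k * (‖t‖ ^ 2 + ell m s K Q ^ 2) / 2) := by positivity
  have hexp : ‖t‖ ^ (-(5 / 2 - α)) = ‖t‖ ^ (-(3 / 2) : ℝ) * ‖t‖ ^ (α - 1) := by
    rw [← Real.rpow_add ht0]; congr 1; ring
  calc _ ≤ ‖t‖ ^ (-(3 / 2) : ℝ) * (ell m s K Q ^ (-α)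
        * (Real.sqrt k ^ (α - 1) * ‖t‖ ^ (α - 1))
        * (k * (k * (‖t‖ ^ 2 + ell m s K Q ^ 2) / 2))⁻¹) := by
        have := inv_nonneg.2 (hden0.le.trans hden)
        gcongr
    _ = _ := by
        rw [hexp]
        field_simp

theorem rpow_norm_mul_rpow_ell_le {m : ℝ} (hm : 0 < m) {a : ℝ} (ha : 0 ≤ a) {s K : E3} {Q : ℝ}
    (hQ : 0 < Q) : ‖s‖ ^ a * ell m s K Q ^ (-a) ≤ Real.sqrt (m / (m + 1)) ^ (-a) := by
  have hy : 0 < ell m s K Q := ell_pos hm hQ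
  have hk : 0 < Real.sqrt (m / (m + 1)) := by positivity
  rw [Real.rpow_neg hy.le, Real.rpow_neg hk.le, ← div_eq_mul_inv, div_le_iff₀ (by positivity),
    inv_mul_eq_div, le_div_iff₀ (by positivity), ← Real.mul_rpow (norm_nonneg _) hk.le, mul_comm]
  gcongr
  exact sqrt_mul_norm_le_ell hm

theorem exists_lintegral_schurWeight_le {m : ℝ} (hm : 0 < m) {α : ℝ} (h0 : 0 ≤ α) (h1 : α ≤ 1) :
    ∃ C : ℝ≥0∞, C ≠ ⊤ ∧ ∀ (s K : E3) (Q : ℝ), 0 < Q →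
      ENNReal.ofReal (‖s‖ ^ (3 / 2 : ℝ)) * ∫⁻ t : E3, ENNReal.ofReal (‖t‖ ^ (-(3 / 2) : ℝ)
        * (ell m s K Q ^ (-α) * ell m t K Q ^ (α - 1)
          * (evenDen m K Q s t + oddDen m K s t)⁻¹)) ≤ C := by
  obtain ⟨C₁, hC₁, hint⟩ :=
    exists_lintegral_rpow_norm_div_eq (δ := 5 / 2 - α) (by linarith) (by linarith)
  obtain ⟨B, hB, hle⟩ := exists_schurWeight_le hm h1
  refine ⟨ENNReal.ofReal (B * Real.sqrt (m / (m + 1)) ^ (-(3 / 2) : ℝ)) * C₁, by finiteness,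
    fun s K Q hQ => ?_⟩
  have hy : 0 < ell m s K Q := ell_pos hm hQ
  calc _ ≤ ENNReal.ofReal (‖s‖ ^ (3 / 2 : ℝ)) * ∫⁻ t : E3,
        ENNReal.ofReal (B * ell m s K Q ^ (-α))
          * ENNReal.ofReal (‖t‖ ^ (-(5 / 2 - α)) / (‖t‖ ^ 2 + ell m s K Q ^ 2)) := by
        refine mul_le_mul_right (lintegral_mono_ae ?_) _
        filter_upwards [ae_ne_zero] with t ht
        rw [← ENNReal.ofReal_mul (by positivity)]
        exact ENNReal.ofReal_le_ofReal (hle s K Q hQ t ht)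
    _ = ENNReal.ofReal (‖s‖ ^ (3 / 2 : ℝ) * (B * ell m s K Q ^ (-α)
          * ell m s K Q ^ (1 - (5 / 2 - α)))) * C₁ := by
        rw [lintegral_const_mul' _ _ ENNReal.ofReal_ne_top, hint _ hy,
          ENNReal.ofReal_mul (p := ‖s‖ ^ (3 / 2 : ℝ)) (by positivity),
          ENNReal.ofReal_mul (p := B * ell m s K Q ^ (-α)) (by positivity)]
        ring
    _ ≤ _ := by
        refine mul_le_mul_left (ENNReal.ofReal_le_ofReal ?_) _
        rw [mul_assoc B, ← Real.rpow_add hy, show -α + (1 - (5 / 2 - α)) = -(3 / 2) by ring,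
          mul_left_comm]
        gcongr
        exact rpow_norm_mul_rpow_ell_le hm (by norm_num) hQ

end LambdaFinite

section EuclideanFourier

variable {E : Type*} [NormedAddCommGroup E] [InnerProductSpace ℝ E] [FiniteDimensional ℝ E]
  [MeasurableSpace E] [BorelSpace E]

theorem memLp_comp_smul_iff {F : Type*} [NormedAddCommGroup F] {c : ℝ} (hc : c ≠ 0) {f : E → F}
    {p : ℝ≥0∞} : MemLp (fun x => f (c • x)) p ↔ MemLp f p := by
  have hmap := Measure.map_addHaar_smul (volume : Measure E) hc
  have hscale : (ENNReal.ofReal |(c ^ Module.finrank ℝ E)⁻¹|) ≠ 0 := by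
    rw [ne_eq, ENNReal.ofReal_eq_zero, not_le]
    positivity
  have e : MemLp f p (Measure.map (c • ·) volume) ↔ MemLp (fun x => f (c • x)) p :=
    (Homeomorph.smulOfNeZero c hc).measurableEmbedding.memLp_map_measure_iff
  rw [← e, hmap]
  refine ⟨fun h => ?_, fun h => h.smul_measure ENNReal.ofReal_ne_top⟩
  have h' := h.smul_measure (ENNReal.inv_ne_top.mpr hscale)
  rwa [smul_smul, ENNReal.inv_mul_cancel hscale ENNReal.ofReal_ne_top, one_smul] at h'

theorem toLp_compMeasurePreserving (e : E ≃ₗᵢ[ℝ] E) (f : 𝓢(E, ℂ)) :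
    Lp.compMeasurePreserving e e.measurePreserving (f.toLp 2)
      = (SchwartzMap.compCLMOfContinuousLinearEquiv ℂ e.toContinuousLinearEquiv f).toLp 2 := by
  apply Lp.ext
  refine (Lp.coeFn_compMeasurePreserving _ _).trans
    (Filter.EventuallyEq.trans ?_ (SchwartzMap.coeFn_toLp _ _ _).symm)
  exact e.measurePreserving.quasiMeasurePreserving.ae_eq_comp (SchwartzMap.coeFn_toLp f 2 volume)

theorem fourier_compMeasurePreserving (e : E ≃ₗᵢ[ℝ] E) (f : Lp (α := E) ℂ 2) :
    𝓕 (Lp.compMeasurePreserving e e.measurePreserving f)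
      = Lp.compMeasurePreserving e e.measurePreserving (𝓕 f) := by
  have hc : Continuous (Lp.compMeasurePreserving (E := ℂ) (p := 2) e e.measurePreserving) :=
    (Lp.isometry_compMeasurePreserving e.measurePreserving).continuous
  have hF : Continuous (𝓕 : Lp (α := E) ℂ 2 → Lp (α := E) ℂ 2) :=
    (Lp.fourierTransformₗᵢ E ℂ).continuous
  refine DenseRange.induction_on
    (p := fun f => 𝓕 (Lp.compMeasurePreserving e e.measurePreserving f)
      = Lp.compMeasurePreserving e e.measurePreserving (𝓕 f))
    (SchwartzMap.denseRange_toLpCLM (E := E) (F := ℂ) (p := 2) ENNReal.ofNat_ne_top) f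
    (isClosed_eq (hF.comp hc) (hc.comp hF)) fun g => ?_
  simp only [SchwartzMap.toLpCLM_apply]
  rw [toLp_compMeasurePreserving, SchwartzMap.toLp_fourier_eq, SchwartzMap.toLp_fourier_eq,
    toLp_compMeasurePreserving]
  congr 1
  ext w
  rw [SchwartzMap.fourier_coe]
  exact Real.fourier_comp_linearIsometry e g w

theorem exists_smulLeftCLM_eq_iff_memLp {w v : E → ℂ} (hw : w.HasTemperateGrowth)
    (hv : v.HasTemperateGrowth) (hvtop : MemLp v ⊤) (hwv : ∀ x, w x * v x = 1)
    (f : Lp (α := E) ℂ 2) :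
    (∃ g : Lp (α := E) ℂ 2,
        TemperedDistribution.smulLeftCLM ℂ w (f : 𝓢'(E, ℂ)) = (g : 𝓢'(E, ℂ)))
      ↔ MemLp (fun x => w x * f x) 2 := by
  have hsmul : ∀ g : Lp (α := E) ℂ 2, ((hvtop.toLp _ • g : Lp (α := E) ℂ 2) : 𝓢'(E, ℂ))
      = TemperedDistribution.smulLeftCLM ℂ v (g : 𝓢'(E, ℂ)) :=
    Lp.toTemperedDistribution_smul_eq hv hvtop
  have hcoe : ∀ g : Lp (α := E) ℂ 2,
      (hvtop.toLp _ • g : Lp (α := E) ℂ 2) =ᵐ[volume] fun x => v x * g x := fun g => by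
    filter_upwards [Lp.coeFn_lpSMul (r := 2) (hvtop.toLp _) g, hvtop.coeFn_toLp] with x h₁ h₂
    rw [h₁, Pi.smul_apply', h₂, smul_eq_mul]
  have hone : w * v = fun _ => 1 := funext hwv
  constructor
  · rintro ⟨g, hg⟩
    have hfg : f = (hvtop.toLp _ • g : Lp (α := E) ℂ 2) := by
      refine LinearMap.ker_eq_bot.1 (Lp.ker_toTemperedDistributionCLM_eq_bot (F := ℂ)
        (μ := (volume : Measure E)) (p := 2)) ?_
      refine Eq.trans ?_ (hsmul g).symm
      rw [← hg, TemperedDistribution.smulLeftCLM_smulLeftCLM_apply hw hv]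
      simp [hone]
    refine (Lp.memLp g).ae_eq ?_
    filter_upwards [hcoe g] with x hx
    rw [hfg, hx, ← mul_assoc, hwv, one_mul]
  · intro h
    refine ⟨h.toLp _, ?_⟩
    have hf : f = (hvtop.toLp _ • h.toLp _ : Lp (α := E) ℂ 2) := by
      apply Lp.ext
      filter_upwards [hcoe (h.toLp _), h.coeFn_toLp] with x h₁ h₂
      rw [h₁, h₂, ← mul_assoc, mul_comm (v x), hwv, one_mul]
    refine (congrArg (fun g : Lp (α := E) ℂ 2 => TemperedDistribution.smulLeftCLM ℂ w
      (g : 𝓢'(E, ℂ))) hf).trans ?_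
    simp only [hsmul]
    rw [TemperedDistribution.smulLeftCLM_smulLeftCLM_apply hv hw, mul_comm]
    simp [hone]

theorem memSobolev_iff_memLp {r : ℝ} (hr : 0 ≤ r) (f : Lp (α := E) ℂ 2) :
    TemperedDistribution.MemSobolev r 2 (f : 𝓢'(E, ℂ)) ↔
      MemLp (fun x => (((1 + ‖x‖ ^ 2) ^ (r / 2) : ℝ) : ℂ) * (𝓕 f : Lp (α := E) ℂ 2) x) 2 := by
  have hbound : ∀ x : E, ‖(((1 + ‖x‖ ^ 2) ^ (-r / 2) : ℝ) : ℂ)‖ ≤ 1 := fun x => by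
    rw [Complex.norm_real, Real.norm_of_nonneg (by positivity)]
    exact Real.rpow_le_one_of_one_le_of_nonpos (by nlinarith [sq_nonneg ‖x‖]) (by linarith)
  have htemp : (fun x : E => (((1 + ‖x‖ ^ 2) ^ (-r / 2) : ℝ) : ℂ)).HasTemperateGrowth := by
    fun_prop
  rw [TemperedDistribution.memSobolev_iff_exists_smulLeftCLM_fourier,
    Lp.fourier_toTemperedDistribution_eq]
  refine exists_smulLeftCLM_eq_iff_memLp (by fun_prop) htemp
    (memLp_top_of_bound htemp.1.continuous.aestronglyMeasurable 1 (.of_forall hbound))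
    (fun x => ?_) _
  rw [← Complex.ofReal_mul, ← Real.rpow_add (by positivity), neg_div, add_neg_cancel,
    Real.rpow_zero, Complex.ofReal_one]

end EuclideanFourier

theorem memLp_two_iff {X : Type*} [MeasurableSpace X] {ν : Measure X} {f : X → ℂ}
    (hf : AEStronglyMeasurable f ν) : MemLp f 2 ν ↔ ∫⁻ x, ‖f x‖ₑ ^ 2 ∂ν < ⊤ := by
  have h := eLpNorm_lt_top_iff_lintegral_rpow_enorm_lt_top (f := f) (μ := ν) (p := 2)
    two_ne_zero ENNReal.ofNat_ne_top
  simp only [ENNReal.toReal_ofNat, ENNReal.rpow_ofNat] at h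
  rw [← h]
  exact ⟨fun h => h.2, fun h => ⟨hf, h⟩⟩

theorem enorm_sq_eq_lintegral {X : Type*} [MeasurableSpace X] {ν : Measure X} (f : Lp ℂ 2 ν) :
    ‖f‖ₑ ^ 2 = ∫⁻ x, ‖f x‖ₑ ^ 2 ∂ν := by
  rw [Lp.enorm_def, eLpNorm_eq_lintegral_rpow_enorm_toReal two_ne_zero ENNReal.ofNat_ne_top,
    ← ENNReal.rpow_natCast, ← ENNReal.rpow_mul]
  simp

theorem inner_eq_integral {X : Type*} [MeasurableSpace X] {ν : Measure X} (f g : Lp ℂ 2 ν) :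
    inner ℂ f g = ∫ x, conj (f x) * g x ∂ν := by
  simp only [L2.inner_def, RCLike.inner_apply, mul_comm]

theorem enorm_ofReal_of_nonneg {x : ℝ} (hx : 0 ≤ x) : ‖(x : ℂ)‖ₑ = ENNReal.ofReal x := by
  rw [← ofReal_norm, Complex.norm_real, Real.norm_of_nonneg hx]

section Config

theorem norm_sq_config {k : ℕ} (q : Config k) : ‖q‖ ^ 2 = ∑ i, ‖q i‖ ^ 2 :=
  PiLp.norm_sq_eq_of_L2 _ q

theorem finrank_config (k : ℕ) : Module.finrank ℝ (Config k) = 3 * k := by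
  rw [(WithLp.linearEquiv 2 ℝ (Fin k → E3)).finrank_eq, Module.finrank_pi_fintype]
  simp [mul_comm]

theorem norm_sum_sq_le {k : ℕ} (q : Config k) : ‖∑ i, q i‖ ^ 2 ≤ k * ‖q‖ ^ 2 := by
  have hcs := sq_sum_le_card_mul_sum_sq (s := Finset.univ) (f := fun i => ‖q i‖)
  rw [Finset.card_univ, Fintype.card_fin, ← norm_sq_config] at hcs
  exact (pow_le_pow_left₀ (norm_nonneg _) (norm_sum_le _ _) 2).trans hcs

/-- The splitting `(s, q) ↦ (s, q₁, …, q_n)` off of the first particle, as a linear isometry. -/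
noncomputable def consIso (n : ℕ) : WithLp 2 (E3 × Config n) ≃ₗᵢ[ℝ] Config (n + 1) where
  toFun x := cons x.fst x.snd.ofLp
  invFun p := WithLp.toLp 2 (p 0, WithLp.toLp 2 fun i => p i.succ)
  left_inv x := by
    simp only [cons, Fin.cons_zero, Fin.cons_succ]
    rfl
  right_inv p := by
    ext i : 1
    refine Fin.cases ?_ (fun j => ?_) i <;> simp [cons]
  map_add' x y := by
    ext i : 1
    refine Fin.cases ?_ (fun j => ?_) i <;> simp [cons]
  map_smul' c x := by
    ext i : 1
    refine Fin.cases ?_ (fun j => ?_) i <;> simp [cons]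
  norm_map' x := by
    refine (sq_eq_sq₀ (norm_nonneg _) (norm_nonneg _)).1 ?_
    rw [WithLp.prod_norm_sq_eq_of_L2, norm_sq_config x.snd]
    exact (norm_sq_config _).trans (Fin.sum_univ_succ _)

theorem measurable_toLp_config (k : ℕ) :
    Measurable (WithLp.toLp 2 : (Fin k → E3) → Config k) :=
  (PiLp.continuous_toLp 2 _).measurable

theorem measurePreserving_cons_of_toLp {n : ℕ}
    (h : MeasurePreserving (WithLp.toLp 2 : (Fin n → E3) → Config n)) :
    MeasurePreserving (fun z : E3 × (Fin n → E3) => cons z.1 z.2) :=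
  (consIso n).measurePreserving.comp ((WithLp.volume_preserving_toLp E3 (Config n)).comp
    ((MeasurePreserving.id volume).prod h))

theorem measurePreserving_toLp_config (k : ℕ) :
    MeasurePreserving (WithLp.toLp 2 : (Fin k → E3) → Config k) := by
  induction k with
  | zero =>
    refine ⟨measurable_toLp_config 0, ?_⟩
    let e : EuclideanSpace ℝ (Fin 0) ≃ₗᵢ[ℝ] Config 0 :=
      { toLinearEquiv := LinearEquiv.ofFinrankEq _ _
          (by rw [Module.finrank_zero_of_subsingleton, Module.finrank_zero_of_subsingleton])
        norm_map' := fun x => by simp [Subsingleton.elim x 0] }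
    rw [← e.measurePreserving.map_eq, volume_euclideanSpace_eq_dirac, Measure.volume_pi_eq_dirac 0,
      Measure.map_dirac, Measure.map_dirac]
    exact congrArg Measure.dirac (Subsingleton.elim _ _)
  | succ n ih =>
    convert (measurePreserving_cons_of_toLp ih).comp
      (volume_preserving_piFinSuccAbove (fun _ : Fin (n + 1) => E3) 0) using 1
    funext x
    ext i : 1
    refine Fin.cases ?_ (fun j => ?_) i <;> simp [cons, MeasurableEquiv.piFinSuccAbove]

theorem measurePreserving_cons (n : ℕ) :
    MeasurePreserving (fun z : E3 × (Fin n → E3) => cons z.1 z.2) :=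
  measurePreserving_cons_of_toLp (measurePreserving_toLp_config n)

theorem measurable_cons (n : ℕ) : Measurable (fun z : E3 × (Fin n → E3) => cons z.1 z.2) :=
  (measurePreserving_cons n).measurable

/-- The permutation `permute σ` of the particles as a linear isometry. -/
noncomputable def permuteIso {k : ℕ} (σ : Equiv.Perm (Fin k)) : Config k ≃ₗᵢ[ℝ] Config k where
  toFun := permute σ
  invFun := permute σ⁻¹
  left_inv x := by ext i : 1; simp [permute]
  right_inv x := by ext i : 1; simp [permute]
  map_add' x y := by ext i : 1; simp [permute]
  map_smul' c x := by ext i : 1; simp [permute]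
  norm_map' x := by
    refine (sq_eq_sq₀ (norm_nonneg _) (norm_nonneg _)).1 ?_
    rw [norm_sq_config, norm_sq_config]
    exact Equiv.sum_comp σ fun i => ‖x i‖ ^ 2

theorem measurePreserving_permute {k : ℕ} (σ : Equiv.Perm (Fin k)) :
    MeasurePreserving (permute σ : Config k → Config k) :=
  (permuteIso σ).measurePreserving

theorem permute_smul {k : ℕ} (σ : Equiv.Perm (Fin k)) (c : ℝ) (x : Config k) :
    permute σ (c • x) = c • permute σ x :=
  (permuteIso σ).map_smul c x

theorem Antisymm.congr {k : ℕ} {f g : Config k → ℂ} (hf : Antisymm f) (h : f =ᵐ[volume] g) :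
    Antisymm g := fun σ => by
  filter_upwards [hf σ, (measurePreserving_permute σ).quasiMeasurePreserving.ae h, h]
    with x hσ hperm hx
  rw [← hperm, hσ, hx]

theorem Antisymm.mul_left {k : ℕ} {f g : Config k → ℂ} (hg : Antisymm g)
    (hf : ∀ σ x, f (permute σ x) = f x) : Antisymm fun x => f x * g x := fun σ => by
  filter_upwards [hg σ] with x hx
  simp only [hf, hx]
  ring

end Config

section Symbol

variable {k : ℕ} {m μ : ℝ}

theorem L_eq_sqrt_sum (m μ : ℝ) (q : Config k) :
    L m μ q = 2 * Real.pi ^ 2 * Real.sqrt (m * (m + 2) / (m + 1) ^ 2 * ∑ i, ‖q i‖ ^ 2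
      + 2 * m / (m + 1) ^ 2 * ((‖∑ i, q i‖ ^ 2 - ∑ i, ‖q i‖ ^ 2) / 2) + μ) := by
  rw [L, sum_sum_Ioi_inner]

theorem L_permute (m μ : ℝ) (σ : Equiv.Perm (Fin k)) (q : Config k) :
    L m μ (permute σ q) = L m μ q := by
  have hsq : ∑ i, ‖permute σ q i‖ ^ 2 = ∑ i, ‖q i‖ ^ 2 := Equiv.sum_comp σ fun i => ‖q i‖ ^ 2
  have hsum : ∑ i, permute σ q i = ∑ i, q i := Equiv.sum_comp σ fun i => q i
  rw [L_eq_sqrt_sum, L_eq_sqrt_sum, hsq, hsum]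

theorem continuous_L (m μ : ℝ) : Continuous (L m μ : Config k → ℝ) := by
  unfold L; fun_prop

@[fun_prop]
theorem measurable_L (m μ : ℝ) : Measurable (L m μ : Config k → ℝ) :=
  (continuous_L m μ).measurable

theorem L_eq_sqrt_norm (hm : 0 < m) (μ : ℝ) (q : Config k) :
    L m μ q = 2 * Real.pi ^ 2 * Real.sqrt (m / (m + 1) * ‖q‖ ^ 2
      + m / (m + 1) ^ 2 * ‖∑ i, q i‖ ^ 2 + μ) := by
  rw [L_eq_sqrt_sum, norm_sq_config q]
  congr 2
  field_simp
  ring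

theorem L_pos (hm : 0 < m) (hμ : 0 < μ) (q : Config k) : 0 < L m μ q := by
  rw [L_eq_sqrt_norm hm]
  positivity

theorem exists_bessel_le_L (hm : 0 < m) (hμ : 0 < μ) {c : ℝ} (hc : 0 < c) :
    ∃ a : ℝ, 0 < a ∧ ∀ q : Config k, a * (1 + ‖c • q‖ ^ 2) ^ (1 / 2 : ℝ) ≤ L m μ q := by
  set a₀ := min (m / (m + 1) / c ^ 2) μ
  have ha₀ : 0 < a₀ := by positivity
  refine ⟨2 * Real.pi ^ 2 * √a₀, by positivity, fun q => ?_⟩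
  have hquad : a₀ * c ^ 2 ≤ m / (m + 1) := (le_div_iff₀ (by positivity)).1 (min_le_left _ _)
  have hconst : a₀ ≤ μ := min_le_right _ _
  rw [L_eq_sqrt_norm hm, ← Real.sqrt_eq_rpow, mul_assoc _ (√a₀), ← Real.sqrt_mul ha₀.le, norm_smul,
    mul_pow, Real.norm_of_nonneg hc.le]
  gcongr
  calc a₀ * (1 + c ^ 2 * ‖q‖ ^ 2) = a₀ * c ^ 2 * ‖q‖ ^ 2 + 0 + a₀ := by ring
    _ ≤ _ := by gcongr; positivity

theorem exists_L_le_bessel (hm : 0 < m) (hμ : 0 < μ) {c : ℝ} (hc : 0 < c) :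
    ∃ b : ℝ, 0 < b ∧ ∀ q : Config k, L m μ q ≤ b * (1 + ‖c • q‖ ^ 2) ^ (1 / 2 : ℝ) := by
  set b₀ := max ((m / (m + 1) + m / (m + 1) ^ 2 * k) / c ^ 2) μ
  have hb₀ : 0 < b₀ := lt_max_of_lt_right hμ
  refine ⟨2 * Real.pi ^ 2 * √b₀, by positivity, fun q => ?_⟩
  have hquad : m / (m + 1) + m / (m + 1) ^ 2 * k ≤ b₀ * c ^ 2 :=
    (div_le_iff₀ (by positivity)).1 (le_max_left _ _)
  have hconst : μ ≤ b₀ := le_max_right _ _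
  rw [L_eq_sqrt_norm hm, ← Real.sqrt_eq_rpow, mul_assoc _ (√b₀), ← Real.sqrt_mul hb₀.le, norm_smul,
    mul_pow, Real.norm_of_nonneg hc.le]
  gcongr
  calc m / (m + 1) * ‖q‖ ^ 2 + m / (m + 1) ^ 2 * ‖∑ i, q i‖ ^ 2 + μ
      ≤ m / (m + 1) * ‖q‖ ^ 2 + m / (m + 1) ^ 2 * (k * ‖q‖ ^ 2) + b₀ := by
        gcongr
        exact norm_sum_sq_le q
    _ = (m / (m + 1) + m / (m + 1) ^ 2 * k) * ‖q‖ ^ 2 + b₀ := by ring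
    _ ≤ b₀ * c ^ 2 * ‖q‖ ^ 2 + b₀ := by gcongr
    _ = b₀ * (1 + c ^ 2 * ‖q‖ ^ 2) := by ring

theorem aestronglyMeasurable_L_rpow_mul (m μ r : ℝ) {g : Config k → ℂ}
    (hg : AEStronglyMeasurable g) :
    AEStronglyMeasurable fun p => ((L m μ p ^ r : ℝ) : ℂ) * g p :=
  AEStronglyMeasurable.mul (by fun_prop : Measurable fun p : Config k =>
    ((L m μ p ^ r : ℝ) : ℂ)).aestronglyMeasurable hg

theorem lpowNormSq_lt_top_iff (m μ r : ℝ) {g : Config k → ℂ} (hg : AEStronglyMeasurable g) :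
    LpowNormSq m μ r g < ⊤ ↔ MemLp (fun p => ((L m μ p ^ r : ℝ) : ℂ) * g p) 2 :=
  (memLp_two_iff (aestronglyMeasurable_L_rpow_mul m μ r hg)).symm

theorem memLp_bessel_mul_iff_memLp_L_mul (hm : 0 < m) (hμ : 0 < μ) {c : ℝ} (hc : 0 < c) {r : ℝ}
    (hr : 0 ≤ r) {g : Config k → ℂ} (hg : AEStronglyMeasurable g) :
    MemLp (fun p => (((1 + ‖c • p‖ ^ 2) ^ (r / 2) : ℝ) : ℂ) * g p) 2 ↔
      MemLp (fun p => ((L m μ p ^ r : ℝ) : ℂ) * g p) 2 := by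
  obtain ⟨a, ha, haL⟩ := exists_bessel_le_L (k := k) hm hμ hc
  obtain ⟨b, hb, hbL⟩ := exists_L_le_bessel (k := k) hm hμ hc
  have hw : ∀ p : Config k, (1 + ‖c • p‖ ^ 2) ^ (r / 2) = ((1 + ‖c • p‖ ^ 2) ^ (1 / 2 : ℝ)) ^ r :=
    fun p => by
      rw [← Real.rpow_mul (by positivity)]
      congr 1
      ring
  have hnorm : ∀ {x : ℝ} (p), 0 ≤ x → ‖(x : ℂ) * g p‖ = x * ‖g p‖ := fun p hx => by
    rw [norm_mul, Complex.norm_real, Real.norm_of_nonneg hx]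
  have hmeas : AEStronglyMeasurable fun p => (((1 + ‖c • p‖ ^ 2) ^ (r / 2) : ℝ) : ℂ) * g p :=
    AEStronglyMeasurable.mul (Measurable.aestronglyMeasurable (by fun_prop)) hg
  constructor <;> intro h
  · refine h.of_le_mul (c := b ^ r) (aestronglyMeasurable_L_rpow_mul m μ r hg)
      (.of_forall fun p => ?_)
    rw [hnorm p (Real.rpow_nonneg (L_pos hm hμ p).le r), hnorm p (by positivity), ← mul_assoc, hw,
      ← Real.mul_rpow hb.le (by positivity)]
    gcongr
    · exact (L_pos hm hμ p).le
    · exact hbL p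
  · refine h.of_le_mul (c := (a ^ r)⁻¹) hmeas (.of_forall fun p => ?_)
    rw [hnorm p (Real.rpow_nonneg (L_pos hm hμ p).le r), hnorm p (by positivity), ← mul_assoc, hw]
    gcongr
    rw [le_inv_mul_iff₀ (by positivity), ← Real.mul_rpow ha.le (by positivity)]
    gcongr
    exact haL p

end Symbol

section Hat

variable {k : ℕ}

@[fun_prop]
theorem measurable_hat (ξ : L2 k) : Measurable (hat ξ) := by
  have h : Measurable (𝓕 ξ : L2 k) := (Lp.stronglyMeasurable _).measurable
  exact (h.comp (measurable_const_smul (2 * Real.pi)⁻¹)).const_mul _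

theorem hat_const_ne_zero (k : ℕ) : (((2 * Real.pi) ^ (-(3 * (k : ℝ)) / 2) : ℝ) : ℂ) ≠ 0 :=
  Complex.ofReal_ne_zero.mpr (Real.rpow_pos_of_pos Real.two_pi_pos _).ne'

theorem hat_const_sq (k : ℕ) :
    ((2 * Real.pi) ^ (-(3 * (k : ℝ)) / 2)) ^ 2 = ((2 * Real.pi)⁻¹) ^ (3 * k) := by
  have hpos := Real.two_pi_pos
  rw [← Real.rpow_mul_natCast hpos.le, inv_pow, ← Real.rpow_natCast (2 * Real.pi) (3 * k),
    ← Real.rpow_neg hpos.le]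
  congr 1
  push_cast
  ring

theorem integral_conj_hat_mul_hat (ζ η : L2 k) :
    ∫ p, conj (hat ζ p) * hat η p = inner ℂ ζ η := by
  have hscale : ∀ p, conj (hat ζ p) * hat η p
      = (((2 * Real.pi)⁻¹ ^ (3 * k) : ℝ) : ℂ) *
        (fun x => conj ((𝓕 ζ : L2 k) x) * (𝓕 η : L2 k) x) ((2 * Real.pi)⁻¹ • p) := fun p => by
    rw [hat, hat, ← hat_const_sq, map_mul, Complex.conj_ofReal, Complex.ofReal_pow]
    ring
  have hfourier : inner ℂ ζ η = inner ℂ (𝓕 ζ : L2 k) (𝓕 η : L2 k) := (Lp.inner_fourier_eq ζ η).symm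
  rw [integral_congr_ae (.of_forall hscale), hfourier, inner_eq_integral, integral_const_mul,
    Measure.integral_comp_smul_of_nonneg volume (fun x => conj ((𝓕 ζ : L2 k) x) * (𝓕 η : L2 k) x) _
      (hR := (inv_pos.mpr Real.two_pi_pos).le),
    finrank_config, Complex.real_smul, ← mul_assoc, ← Complex.ofReal_mul,
    mul_inv_cancel₀ (by positivity), Complex.ofReal_one, one_mul]

theorem memLp_weight_mul_hat_iff (w : Config k → ℂ) (ξ : L2 k) :
    MemLp (fun p => w ((2 * Real.pi)⁻¹ • p) * hat ξ p) 2 ↔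
      MemLp (fun x => w x * (𝓕 ξ : L2 k) x) 2 := by
  have hrw : (fun p => w ((2 * Real.pi)⁻¹ • p) * hat ξ p)
      = (((2 * Real.pi) ^ (-(3 * (k : ℝ)) / 2) : ℝ) : ℂ) •
        fun p : Config k => (fun x => w x * (𝓕 ξ : L2 k) x) ((2 * Real.pi)⁻¹ • p) := by
    funext p
    simp only [hat, Pi.smul_apply, smul_eq_mul]
    ring
  rw [hrw, ← memLp_comp_smul_iff (inv_pos.mpr Real.two_pi_pos).ne' (f := fun x => w x * _)]
  refine ⟨fun h => ?_, fun h => h.const_smul _⟩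
  simpa only [smul_smul, inv_mul_cancel₀ (hat_const_ne_zero k), one_smul] using
    h.const_smul ((((2 * Real.pi) ^ (-(3 * (k : ℝ)) / 2) : ℝ) : ℂ)⁻¹)

theorem memLp_hat (ξ : L2 k) : MemLp (hat ξ) 2 := by
  simpa only [one_mul] using (memLp_weight_mul_hat_iff (fun _ => 1) ξ).mpr
    (by simpa only [one_mul] using Lp.memLp (𝓕 ξ : L2 k))

theorem lintegral_enorm_hat_sq (ξ : L2 k) : ∫⁻ p, ‖hat ξ p‖ₑ ^ 2 = ‖ξ‖ₑ ^ 2 := by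
  have hcoe := (memLp_hat ξ).coeFn_toLp
  have hinner : inner ℂ ((memLp_hat ξ).toLp _ : L2 k) ((memLp_hat ξ).toLp _) = inner ℂ ξ ξ := by
    rw [inner_eq_integral, ← integral_conj_hat_mul_hat ξ ξ]
    exact integral_congr_ae (hcoe.mono fun p hp => by simp only [hp])
  have hnorm : ‖((memLp_hat ξ).toLp _ : L2 k)‖ = ‖ξ‖ := by
    rw [@norm_eq_sqrt_re_inner ℂ, hinner, ← @norm_eq_sqrt_re_inner ℂ]
  rw [← ofReal_norm, ← hnorm, ofReal_norm, enorm_sq_eq_lintegral]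
  exact lintegral_congr_ae (hcoe.mono fun p hp => by simp only [hp])

theorem exists_hat_eq {u : Config k → ℂ} (hu : MemLp u 2) : ∃ ξ : L2 k, hat ξ =ᵐ[volume] u := by
  have hpi := Real.two_pi_pos
  have hv : MemLp (fun x : Config k =>
      (((2 * Real.pi) ^ (-(3 * (k : ℝ)) / 2) : ℝ) : ℂ)⁻¹ * u ((2 * Real.pi) • x)) 2 :=
    ((memLp_comp_smul_iff hpi.ne').mpr hu).const_mul _
  refine ⟨𝓕⁻ hv.toLp, ?_⟩
  filter_upwards [(Measure.quasiMeasurePreserving_smul volume (inv_ne_zero hpi.ne')).ae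
    hv.coeFn_toLp] with p hp
  rw [hat, FourierTransform.fourier_fourierInv_eq, hp, ← mul_assoc,
    mul_inv_cancel₀ (hat_const_ne_zero k), one_mul, smul_inv_smul₀ hpi.ne']

theorem eq_zero_of_hat {ξ : L2 k} (h : hat ξ =ᵐ[volume] 0) : ξ = 0 := by
  rw [← inner_self_eq_zero (𝕜 := ℂ), ← integral_conj_hat_mul_hat]
  exact integral_eq_zero_of_ae (h.mono fun p hp => by simp [hp])

theorem antisymm_iff_compMeasurePreserving (ξ : L2 k) : Antisymm (ξ : Config k → ℂ) ↔
    ∀ σ : Equiv.Perm (Fin k),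
      Lp.compMeasurePreserving (permuteIso σ) (permuteIso σ).measurePreserving ξ
        = ((Equiv.Perm.sign σ : ℤ) : ℂ) • ξ := by
  refine forall_congr' fun σ => ?_
  have hcomp := Lp.coeFn_compMeasurePreserving ξ (permuteIso σ).measurePreserving
  have hsign := Lp.coeFn_smul ((Equiv.Perm.sign σ : ℤ) : ℂ) ξ
  rw [Lp.ext_iff]
  exact ⟨fun h => hcomp.trans (h.trans hsign.symm), fun h => hcomp.symm.trans (h.trans hsign)⟩

theorem antisymm_fourier_iff (ξ : L2 k) :
    Antisymm ((𝓕 ξ : L2 k) : Config k → ℂ) ↔ Antisymm (ξ : Config k → ℂ) := by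
  rw [antisymm_iff_compMeasurePreserving, antisymm_iff_compMeasurePreserving]
  refine forall_congr' fun σ => ?_
  rw [← fourier_compMeasurePreserving, ← FourierTransform.fourier_smul]
  exact (Lp.fourierTransformₗᵢ (Config k) ℂ).injective.eq_iff

theorem antisymm_hat_iff (ξ : L2 k) : Antisymm (hat ξ) ↔ Antisymm (ξ : Config k → ℂ) := by
  have hpi := Real.two_pi_pos
  rw [← antisymm_fourier_iff]
  refine forall_congr' fun σ => ⟨fun h => ?_, fun h => ?_⟩
  · filter_upwards [(Measure.quasiMeasurePreserving_smul volume hpi.ne').ae h] with x hx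
    simp only [hat, permute_smul, inv_smul_smul₀ hpi.ne'] at hx
    rw [mul_left_comm] at hx
    exact mul_left_cancel₀ (hat_const_ne_zero k) hx
  · filter_upwards [(Measure.quasiMeasurePreserving_smul volume (inv_ne_zero hpi.ne')).ae h]
      with x hx
    simp only [hat, ← permute_smul, hx]
    ring

theorem mem_Has_iff {m μ r : ℝ} (hm : 0 < m) (hμ : 0 < μ) (hr : 0 ≤ r) (ξ : L2 k) :
    ξ ∈ Has k r ↔ Antisymm (hat ξ) ∧ LpowNormSq m μ r (hat ξ) < ⊤ := by
  have hmeas := (measurable_hat ξ).aestronglyMeasurable (μ := volume)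
  rw [antisymm_hat_iff, lpowNormSq_lt_top_iff m μ r hmeas,
    ← memLp_bessel_mul_iff_memLp_L_mul hm hμ (inv_pos.mpr Real.two_pi_pos) hr hmeas,
    memLp_weight_mul_hat_iff (fun x => (((1 + ‖x‖ ^ 2) ^ (r / 2) : ℝ) : ℂ)),
    ← memSobolev_iff_memLp hr]
  rfl

theorem Has_mono {r r' : ℝ} (h : r' ≤ r) : Has k r ⊆ Has k r' :=
  fun _ hξ => ⟨hξ.1, hξ.2.mono h⟩

end Hat

section PairConfig

/-- The variables `(s, t, q)` of the off-diagonal form: two momenta `s`, `t` that are exchanged and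
the momenta `q` of the spectators. -/
abbrev PairConfig (n : ℕ) : Type := E3 × E3 × (Fin n → E3)

variable {n : ℕ} {m μ : ℝ}

namespace PairConfig

/-- The configuration `(s, q)` attached to `(s, t, q)`. -/
noncomputable def left (x : PairConfig n) : Config (n + 1) := cons x.1 x.2.2

/-- The configuration `(t, q)` attached to `(s, t, q)`. -/
noncomputable def right (x : PairConfig n) : Config (n + 1) := cons x.2.1 x.2.2

/-- The exchange `(s, t, q) ↦ (t, s, q)`. -/
def swap (x : PairConfig n) : PairConfig n := (x.2.1, x.1, x.2.2)

@[fun_prop]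
theorem measurable_left : Measurable (left : PairConfig n → _) :=
  (measurable_cons n).comp (by fun_prop : Measurable fun x : PairConfig n => (x.1, x.2.2))

@[fun_prop]
theorem measurable_right : Measurable (right : PairConfig n → _) :=
  (measurable_cons n).comp (by fun_prop : Measurable fun x : PairConfig n => (x.2.1, x.2.2))

theorem measurePreserving_swap : MeasurePreserving (swap : PairConfig n → PairConfig n) := by
  have hassoc := measurePreserving_prodAssoc (volume : Measure E3) (volume : Measure E3)
    (volume : Measure (Fin n → E3))
  exact (hassoc.comp (Measure.measurePreserving_swap.prod (MeasurePreserving.id _))).comp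
    hassoc.symm

@[fun_prop]
theorem measurable_swap : Measurable (swap : PairConfig n → PairConfig n) :=
  measurePreserving_swap.measurable

theorem measurableEmbedding_swap : MeasurableEmbedding (swap : PairConfig n → PairConfig n) :=
  (MeasurableEquiv.mk ⟨swap, swap, fun _ => rfl, fun _ => rfl⟩ measurable_swap
    measurable_swap).measurableEmbedding

theorem quasiMeasurePreserving_right :
    Measure.QuasiMeasurePreserving (right : PairConfig n → _) volume volume :=
  (measurePreserving_cons n).quasiMeasurePreserving.comp Measure.quasiMeasurePreserving_snd

theorem quasiMeasurePreserving_left :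
    Measure.QuasiMeasurePreserving (left : PairConfig n → _) volume volume :=
  quasiMeasurePreserving_right.comp measurePreserving_swap.quasiMeasurePreserving

theorem ae_ne_zero_and_ne_zero : ∀ᵐ x : PairConfig n, x.1 ≠ 0 ∧ x.2.1 ≠ 0 := by
  have hleft : ∀ᵐ x : PairConfig n, x.1 ≠ 0 := Measure.quasiMeasurePreserving_fst.ae ae_ne_zero
  exact hleft.and (measurePreserving_swap.quasiMeasurePreserving.ae hleft)

theorem lintegral_left_mul_le {φ ρ : Config (n + 1) → ℝ≥0∞} (hφ : Measurable φ)
    (hρ : Measurable ρ) {k : PairConfig n → ℝ≥0∞} (hk : Measurable k)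
    (h : ∀ (s : E3) (q : Fin n → E3), ∫⁻ t, k (s, t, q) ≤ ρ (cons s q)) :
    ∫⁻ x, φ x.left * k x ≤ ∫⁻ p, φ p * ρ p := by
  have hf : Measurable fun x : PairConfig n => φ x.left * k x := by fun_prop
  rw [← measurePreserving_swap.lintegral_comp hf,
    ← (measurePreserving_cons n).lintegral_comp (by fun_prop : Measurable fun p => φ p * ρ p)]
  refine (lintegral_prod_symm' _ (hf.comp measurable_swap)).trans_le (lintegral_mono fun z => ?_)
  simp only [Function.comp_apply, swap, left]
  rw [lintegral_const_mul _ (by fun_prop)]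
  exact mul_le_mul_right (h _ _) _

end PairConfig

theorem two_mul_mul_le_add_sq_mul_inv (a b : ℝ≥0∞) {w : ℝ} (hw : 0 < w) :
    2 * (a * b) ≤ a ^ 2 * ENNReal.ofReal w + b ^ 2 * ENNReal.ofReal w⁻¹ := by
  rcases eq_or_ne a ⊤ with rfl | ha
  · simp [ENNReal.top_mul, hw]
  rcases eq_or_ne b ⊤ with rfl | hb
  · simp [ENNReal.top_mul, hw]
  lift a to NNReal using ha
  lift b to NNReal using hb
  lift w to NNReal using hw.le
  have hw' : w ≠ 0 := (NNReal.coe_pos.1 hw).ne'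
  rw [← NNReal.coe_inv, ENNReal.ofReal_coe_nnreal, ENNReal.ofReal_coe_nnreal]
  norm_cast
  rw [← NNReal.coe_le_coe]
  push_cast
  have hsq : (w : ℝ)⁻¹ * (a * w - b) ^ 2 = a ^ 2 * w + b ^ 2 * (w : ℝ)⁻¹ - 2 * (a * b) := by
    field_simp
    ring
  have : (0 : ℝ) ≤ (w : ℝ)⁻¹ * (a * w - b) ^ 2 := by positivity
  linarith

theorem two_mul_lintegral_left_mul_right_le {φ ψ : Config (n + 1) → ℝ≥0∞} (hφ : Measurable φ)
    (hψ : Measurable ψ) {w k : PairConfig n → ℝ} (hw : Measurable w) (hk : Measurable k)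
    (hw0 : ∀ᵐ x, 0 < w x) (hws : ∀ x, w x.swap = (w x)⁻¹) :
    2 * ∫⁻ x, φ x.left * ψ x.right * ENNReal.ofReal (k x)
      ≤ (∫⁻ x, φ x.left ^ 2 * ENNReal.ofReal (w x * k x))
        + ∫⁻ x, ψ x.left ^ 2 * ENNReal.ofReal (w x * k x.swap) := by
  have hf : Measurable fun x => φ x.left ^ 2 * ENNReal.ofReal (w x * k x) := by fun_prop
  have hg : Measurable fun x => ψ x.left ^ 2 * ENNReal.ofReal (w x * k x.swap) := by fun_prop
  rw [← PairConfig.measurePreserving_swap.lintegral_comp hg, ← lintegral_add_left hf,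
    ← lintegral_const_mul' _ _ ENNReal.ofNat_ne_top]
  refine lintegral_mono_ae ?_
  filter_upwards [hw0] with x hx
  have hswap : ψ x.swap.left ^ 2 * ENNReal.ofReal (w x.swap * k x.swap.swap)
      = ψ x.right ^ 2 * ENNReal.ofReal ((w x)⁻¹ * k x) := by rw [hws]; rfl
  rw [hswap, ENNReal.ofReal_mul hx.le, ENNReal.ofReal_mul (inv_nonneg.2 hx.le), ← mul_assoc 2,
    ← mul_assoc (φ _ ^ 2), ← mul_assoc (ψ _ ^ 2), ← add_mul]
  exact mul_le_mul_left (two_mul_mul_le_add_sq_mul_inv _ _ hx) _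

section OffKernel

/-- The kernel `G(s, t, q)` of the off-diagonal form. -/
noncomputable def offKernel (m μ : ℝ) (x : PairConfig n) : ℝ :=
  G m μ (Fin.cons x.1 (Fin.cons x.2.1 x.2.2 : Fin (n + 1) → E3) : Fin (n + 2) → E3)

/-- The part of `G(s, t, q)` that is even under reflection of `s + A K`, where `K` is the total
momentum of `q`. -/
noncomputable def offKernelEven (m μ : ℝ) (x : PairConfig n) : ℝ :=
  evenDen m (∑ i, x.2.2 i) (effQ m μ x.2.2) x.1 x.2.1
    / (evenDen m (∑ i, x.2.2 i) (effQ m μ x.2.2) x.1 x.2.1 ^ 2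
      - oddDen m (∑ i, x.2.2 i) x.1 x.2.1 ^ 2)

/-- The part of `G(s, t, q)` that is odd under reflection of `s + A K`, where `K` is the total
momentum of `q`. -/
noncomputable def offKernelOdd (m μ : ℝ) (x : PairConfig n) : ℝ :=
  -oddDen m (∑ i, x.2.2 i) x.1 x.2.1
    / (evenDen m (∑ i, x.2.2 i) (effQ m μ x.2.2) x.1 x.2.1 ^ 2
      - oddDen m (∑ i, x.2.2 i) x.1 x.2.1 ^ 2)

theorem offKernel_eq (hm : 0 < m) (hμ : 0 < μ) (x : PairConfig n) :
    offKernel m μ x = (evenDen m (∑ i, x.2.2 i) (effQ m μ x.2.2) x.1 x.2.1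
      + oddDen m (∑ i, x.2.2 i) x.1 x.2.1)⁻¹ := G_cons_cons hm hμ _ _ _

theorem offKernel_pos (hm : 0 < m) (hμ : 0 < μ) (x : PairConfig n) : 0 < offKernel m μ x := by
  rw [offKernel_eq hm hμ, inv_pos]
  linarith [(abs_lt.1 (abs_oddDen_lt (K := ∑ i, x.2.2 i) (s := x.1) (t := x.2.1) hm
    (effQ_pos hm hμ x.2.2))).1]

theorem offKernel_swap (hm : 0 < m) (hμ : 0 < μ) (x : PairConfig n) :
    offKernel m μ x.swap = offKernel m μ x := by
  rw [offKernel_eq hm hμ, offKernel_eq hm hμ, evenDen_comm, oddDen_comm]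
  rfl

theorem offKernelOdd_swap (x : PairConfig n) : offKernelOdd m μ x.swap = offKernelOdd m μ x := by
  simp only [offKernelOdd, PairConfig.swap]
  rw [evenDen_comm, oddDen_comm]

theorem offKernelEven_add_offKernelOdd (hm : 0 < m) (hμ : 0 < μ) (x : PairConfig n) :
    offKernelEven m μ x + offKernelOdd m μ x = offKernel m μ x := by
  have hB := abs_lt.1 (abs_oddDen_lt (K := ∑ i, x.2.2 i) (s := x.1) (t := x.2.1) hm
    (effQ_pos hm hμ x.2.2))
  rw [offKernel_eq hm hμ, offKernelEven, offKernelOdd, ← add_div, ← sub_eq_add_neg, sq_sub_sq,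
    div_mul_cancel_right₀ (by linarith [hB.2])]

theorem offKernelEven_nonneg (hm : 0 < m) (hμ : 0 < μ) (x : PairConfig n) :
    0 ≤ offKernelEven m μ x :=
  have hQ := effQ_pos hm hμ x.2.2
  div_nonneg (evenDen_pos hm hQ).le (evenDen_sq_sub_oddDen_sq_pos hm hQ).le

theorem offKernelEven_le (hm : 0 < m) (hμ : 0 < μ) (x : PairConfig n) :
    offKernelEven m μ x ≤ (m + 1) / m * offKernel m μ x := by
  have hQ := effQ_pos hm hμ x.2.2
  have hden := evenDen_sq_sub_oddDen_sq_pos (K := ∑ i, x.2.2 i) (s := x.1) (t := x.2.1) hm hQ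
  have hle := mul_evenDen_le_sub (K := ∑ i, x.2.2 i) (s := x.1) (t := x.2.1) hm hQ
  have hpos := inv_pos.1 (offKernel_eq hm hμ x ▸ offKernel_pos hm hμ x)
  rw [offKernelEven, offKernel_eq hm hμ, div_le_iff₀ hden, sq_sub_sq, ← mul_assoc,
    inv_mul_cancel_right₀ hpos.ne', div_mul_eq_mul_div, le_div_iff₀ hm]
  rw [div_mul_eq_mul_div, div_le_iff₀ (by linarith)] at hle
  linarith

theorem abs_offKernelOdd (hm : 0 < m) (hμ : 0 < μ) (x : PairConfig n) :
    |offKernelOdd m μ x| = |oddDen m (∑ i, x.2.2 i) x.1 x.2.1|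
      / (evenDen m (∑ i, x.2.2 i) (effQ m μ x.2.2) x.1 x.2.1 ^ 2
        - oddDen m (∑ i, x.2.2 i) x.1 x.2.1 ^ 2) := by
  rw [offKernelOdd, abs_div, abs_neg,
    abs_of_pos (evenDen_sq_sub_oddDen_sq_pos hm (effQ_pos hm hμ x.2.2))]

@[fun_prop]
theorem measurable_offKernelEven : Measurable (offKernelEven m μ : PairConfig n → ℝ) := by
  unfold offKernelEven evenDen oddDen pairEven pairOdd gap effQ
  fun_prop

@[fun_prop]
theorem measurable_offKernelOdd : Measurable (offKernelOdd m μ : PairConfig n → ℝ) := by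
  unfold offKernelOdd evenDen oddDen pairEven pairOdd gap effQ
  fun_prop

theorem measurable_offKernel (hm : 0 < m) (hμ : 0 < μ) :
    Measurable (offKernel m μ : PairConfig n → ℝ) := by
  simp only [funext fun x : PairConfig n => (offKernelEven_add_offKernelOdd hm hμ x).symm]
  fun_prop

end OffKernel

section SchurTest

/-- The kernel of `L^{-α} G L^{α-1}`. -/
noncomputable def schurKernel (m μ α : ℝ) (x : PairConfig n) : ℝ :=
  L m μ x.left ^ (-α) * L m μ x.right ^ (α - 1) * offKernel m μ x

theorem measurable_schurKernel (hm : 0 < m) (hμ : 0 < μ) (α : ℝ) :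
    Measurable (schurKernel m μ α : PairConfig n → ℝ) := by
  have := measurable_offKernel (n := n) hm hμ
  unfold schurKernel
  fun_prop

theorem schurKernel_nonneg (hm : 0 < m) (hμ : 0 < μ) (α : ℝ) (x : PairConfig n) :
    0 ≤ schurKernel m μ α x := by
  have := L_pos hm hμ x.left
  have := L_pos hm hμ x.right
  have := offKernel_pos hm hμ x
  unfold schurKernel
  positivity

theorem schurKernel_swap (hm : 0 < m) (hμ : 0 < μ) (α : ℝ) (x : PairConfig n) :
    schurKernel m μ α x.swap = schurKernel m μ (1 - α) x := by
  have hleft : x.swap.left = x.right := rfl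
  have hright : x.swap.right = x.left := rfl
  rw [schurKernel, schurKernel, offKernel_swap hm hμ, hleft, hright, neg_sub, sub_sub_cancel_left,
    mul_comm (L m μ x.right ^ _)]

theorem schurKernel_cons_le (hm : 0 < m) (hμ : 0 < μ) (α : ℝ) (s t : E3) (q : Fin n → E3) :
    schurKernel m μ α (s, t, q) ≤ ell m s (∑ i, q i) (effQ m μ q) ^ (-α)
      * ell m t (∑ i, q i) (effQ m μ q) ^ (α - 1)
      * (evenDen m (∑ i, q i) (effQ m μ q) s t + oddDen m (∑ i, q i) s t)⁻¹ := by
  have hQ := effQ_pos hm hμ q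
  have hs := ell_pos (s := s) (K := ∑ i, q i) hm hQ
  have ht := ell_pos (s := t) (K := ∑ i, q i) hm hQ
  have hpi : (1 : ℝ) ≤ 2 * Real.pi ^ 2 := by nlinarith [Real.pi_gt_three]
  have hscale : (2 * Real.pi ^ 2) ^ (-α) * (2 * Real.pi ^ 2) ^ (α - 1) ≤ 1 := by
    rw [← Real.rpow_add (by positivity)]
    exact Real.rpow_le_one_of_one_le_of_nonpos hpi (by linarith)
  have hG := offKernel_pos hm hμ (s, t, q)
  rw [schurKernel, PairConfig.left, PairConfig.right, L_cons hm hμ, L_cons hm hμ,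
    Real.mul_rpow (by positivity) hs.le, Real.mul_rpow (by positivity) ht.le,
    ← G_cons_cons hm hμ, mul_mul_mul_comm]
  refine mul_le_mul_of_nonneg_right ?_ hG.le
  exact mul_le_of_le_one_left (by positivity) hscale

/-- The weight `(‖s‖ / ‖t‖) ^ a` of the Schur tests. -/
noncomputable def schurWeight (a : ℝ) (x : PairConfig n) : ℝ := ‖x.1‖ ^ a * ‖x.2.1‖ ^ (-a)

@[fun_prop]
theorem measurable_schurWeight (a : ℝ) : Measurable (schurWeight a : PairConfig n → ℝ) := by
  unfold schurWeight; fun_prop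

theorem ae_schurWeight_pos (a : ℝ) : ∀ᵐ x : PairConfig n, 0 < schurWeight a x := by
  filter_upwards [PairConfig.ae_ne_zero_and_ne_zero] with x ⟨hs, ht⟩
  have := norm_pos_iff.2 hs
  have := norm_pos_iff.2 ht
  unfold schurWeight
  positivity

theorem schurWeight_swap (a : ℝ) (x : PairConfig n) :
    schurWeight a x.swap = (schurWeight a x)⁻¹ := by
  simp only [schurWeight, PairConfig.swap]
  rw [mul_inv, Real.rpow_neg (norm_nonneg _), Real.rpow_neg (norm_nonneg _), inv_inv, mul_comm]

theorem exists_lintegral_schurWeight_mul_schurKernel_le (hm : 0 < m) (hμ : 0 < μ) (n : ℕ) {α : ℝ}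
    (h0 : 0 ≤ α) (h1 : α ≤ 1) :
    ∃ C : ℝ≥0∞, C ≠ ⊤ ∧ ∀ φ : Config (n + 1) → ℝ≥0∞, Measurable φ →
      ∫⁻ x : PairConfig n, φ x.left
        * ENNReal.ofReal (schurWeight (3 / 2) x * schurKernel m μ α x) ≤ C * ∫⁻ p, φ p := by
  obtain ⟨C, hC, hle⟩ := exists_lintegral_schurWeight_le hm h0 h1
  refine ⟨C, hC, fun φ hφ => ?_⟩
  have := measurable_schurKernel (n := n) hm hμ α
  refine (PairConfig.lintegral_left_mul_le hφ (ρ := fun _ => C) measurable_const (by fun_prop)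
    fun s q => ?_).trans_eq (by rw [lintegral_mul_const _ hφ, mul_comm])
  refine le_trans ?_ (hle s (∑ i, q i) (effQ m μ q) (effQ_pos hm hμ q))
  rw [← lintegral_const_mul' _ _ ENNReal.ofReal_ne_top]
  refine lintegral_mono fun t => ?_
  rw [← ENNReal.ofReal_mul (by positivity), schurWeight, mul_assoc]
  gcongr
  exact schurKernel_cons_le hm hμ α s t q

theorem exists_lintegral_schurKernel_le (hm : 0 < m) (hμ : 0 < μ) (n : ℕ) {α : ℝ}
    (h0 : 0 ≤ α) (h1 : α ≤ 1) :
    ∃ C : ℝ≥0∞, C ≠ ⊤ ∧ ∀ φ ψ : Config (n + 1) → ℝ≥0∞, Measurable φ → Measurable ψ →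
      ∫⁻ x : PairConfig n, φ x.left * ψ x.right * ENNReal.ofReal (schurKernel m μ α x)
        ≤ C * ((∫⁻ p, φ p ^ 2) + ∫⁻ p, ψ p ^ 2) := by
  obtain ⟨C₁, hC₁, hle₁⟩ := exists_lintegral_schurWeight_mul_schurKernel_le hm hμ n h0 h1
  obtain ⟨C₂, hC₂, hle₂⟩ := exists_lintegral_schurWeight_mul_schurKernel_le hm hμ n
    (sub_nonneg.2 h1) (sub_le_self 1 h0)
  refine ⟨C₁ + C₂, by finiteness, fun φ ψ hφ hψ => ?_⟩
  have htwo := two_mul_lintegral_left_mul_right_le hφ hψ (measurable_schurWeight (3 / 2))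
    (measurable_schurKernel hm hμ α) (ae_schurWeight_pos _) (schurWeight_swap _)
  simp only [schurKernel_swap hm hμ] at htwo
  calc _ ≤ 2 * ∫⁻ x : PairConfig n, φ x.left * ψ x.right
          * ENNReal.ofReal (schurKernel m μ α x) := le_mul_of_one_le_left' one_le_two
    _ ≤ C₁ * (∫⁻ p, φ p ^ 2) + C₂ * ∫⁻ p, ψ p ^ 2 :=
      htwo.trans (add_le_add (hle₁ _ (hφ.pow_const 2)) (hle₂ _ (hψ.pow_const 2)))
    _ ≤ (C₁ + C₂) * (∫⁻ p, φ p ^ 2) + (C₁ + C₂) * ∫⁻ p, ψ p ^ 2 := by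
      gcongr
      · exact le_self_add
      · exact le_add_self
    _ = _ := (mul_add _ _ _).symm

end SchurTest

end PairConfig

section SymmWeight

/-- The symmetric weight `(x ^ β + y ^ β) / (x y) ^ ((β + 1) / 2)` that enters `Λ_β`. -/
noncomputable def symmWeight (β x y : ℝ) : ℝ :=
  x ^ ((β - 1) / 2) / y ^ ((β + 1) / 2) + y ^ ((β - 1) / 2) / x ^ ((β + 1) / 2)

variable {β x y : ℝ}

theorem symmWeight_comm (β x y : ℝ) : symmWeight β x y = symmWeight β y x := add_comm _ _

theorem symmWeight_mul {c : ℝ} (hc : 0 < c) (hx : 0 < x) (hy : 0 < y) :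
    symmWeight β (c * x) (c * y) = c⁻¹ * symmWeight β x y := by
  unfold symmWeight
  have hpow : c ^ ((β + 1) / 2) = c ^ ((β - 1) / 2) * c := by
    rw [show (β + 1) / 2 = (β - 1) / 2 + 1 by ring, Real.rpow_add hc, Real.rpow_one]
  rw [Real.mul_rpow hc.le hx.le, Real.mul_rpow hc.le hy.le, Real.mul_rpow hc.le hx.le,
    Real.mul_rpow hc.le hy.le, hpow]
  field_simp

theorem symmWeight_eq_div_sqrt (hx : 0 < x) (hy : 0 < y) : symmWeight β x y
    = (x ^ β + y ^ β) / (Real.sqrt (x ^ β * y ^ β) * Real.sqrt (x * y)) := by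
  have hden : Real.sqrt (x ^ β * y ^ β) * Real.sqrt (x * y)
      = x ^ ((β + 1) / 2) * y ^ ((β + 1) / 2) := by
    rw [← Real.sqrt_mul (by positivity), Real.sqrt_eq_rpow, ← Real.mul_rpow hx.le hy.le,
      ← Real.rpow_add_one (by positivity), ← Real.rpow_mul (by positivity),
      ← Real.mul_rpow hx.le hy.le, mul_one_div]
  have hnum {z : ℝ} (hz : 0 < z) : z ^ β = z ^ ((β - 1) / 2) * z ^ ((β + 1) / 2) := by
    rw [← Real.rpow_add hz]
    ring_nf
  rw [hden, symmWeight, hnum hx, hnum hy]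
  field_simp

theorem reg_add_reg_le {ε : ℝ} (hε : 0 ≤ ε) (hx : 0 < x) (hy : 0 < y) :
    reg β ε x + reg β ε y
      ≤ Real.sqrt (reg β ε x * x) * Real.sqrt (reg β ε y * y) * symmWeight β x y := by
  have hrx := (reg_pos (β := β) hε hx).le
  have hry := (reg_pos (β := β) hε hy).le
  have hpow : 0 < Real.sqrt (x ^ β * y ^ β) := Real.sqrt_pos.2 (by positivity)
  have := Real.sqrt_pos.2 hx
  have := Real.sqrt_pos.2 hy
  refine ((le_div_iff₀ hpow).2 (reg_add_mul_sqrt_le hε hx hy)).trans_eq ?_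
  rw [symmWeight_eq_div_sqrt hx hy, Real.sqrt_mul hrx, Real.sqrt_mul hry, Real.sqrt_mul hrx,
    Real.sqrt_mul hx.le]
  field_simp

end SymmWeight

section LambdaSchurTest

variable {n : ℕ} {m μ : ℝ}

/-- The kernel that `Λ_β` controls by a Schur test. -/
noncomputable def lambdaKernel (m μ β : ℝ) (x : PairConfig n) : ℝ :=
  symmWeight β (L m μ x.left) (L m μ x.right) * |offKernelOdd m μ x|

@[fun_prop]
theorem measurable_lambdaKernel (m μ β : ℝ) :
    Measurable (lambdaKernel m μ β : PairConfig n → ℝ) := by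
  unfold lambdaKernel symmWeight
  fun_prop

theorem lambdaKernel_swap (m μ β : ℝ) (x : PairConfig n) :
    lambdaKernel m μ β x.swap = lambdaKernel m μ β x := by
  rw [lambdaKernel, offKernelOdd_swap, symmWeight_comm]
  rfl

theorem inv_norm_sq_mul_lambdaKernel (hm : 0 < m) (hμ : 0 < μ) (β : ℝ) (s t : E3)
    (q : Fin n → E3) :
    1 / ‖t‖ ^ 2 * lambdaKernel m μ β (s, t, q)
      = (Real.pi ^ 2 * (1 + m))⁻¹ * LambdaIntegrand β m s (∑ i, q i) (effQ m μ q) t := by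
  have hQ := effQ_pos hm hμ q
  have hodd : |oddDen m (∑ i, q i) s t| = 2 / (1 + m) * |inner ℝ (s + (2 + m)⁻¹ • ∑ i, q i)
      (t + (2 + m)⁻¹ • ∑ i, q i)| := by
    rw [oddDen, pairOdd, abs_mul, ← div_eq_mul_inv, abs_of_pos (by positivity)]
  rw [lambdaIntegrand_eq, lambdaKernel, PairConfig.left, PairConfig.right, L_cons hm hμ,
    L_cons hm hμ, symmWeight_mul (by positivity) (ell_pos hm hQ) (ell_pos hm hQ),
    abs_offKernelOdd hm hμ, hodd, symmWeight]
  field_simp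

theorem le_lambda (β m : ℝ) (s K : E3) {Q : ℝ} (hQ : 0 < Q) :
    ENNReal.ofReal ((‖s‖ ^ 2 + Q ^ 2) / (Real.pi ^ 2 * (1 + m))) *
      ∫⁻ t, ENNReal.ofReal (LambdaIntegrand β m s K Q t) ≤ Lambda β m :=
  le_iSup_of_le s (le_iSup_of_le K (le_iSup_of_le Q (le_iSup_of_le hQ le_rfl)))

theorem norm_cons_sq (s : E3) (q : Fin n → E3) :
    ‖cons s q‖ ^ 2 = ‖s‖ ^ 2 + ∑ i, ‖q i‖ ^ 2 := by
  rw [norm_sq_config]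
  simp only [cons, Fin.sum_univ_succ, Fin.cons_zero, Fin.cons_succ]

theorem norm_sq_div_le (hm : 0 < m) (hμ : 0 < μ) {s : E3} (hs : s ≠ 0) (q : Fin n → E3) :
    ‖s‖ ^ 2 / (‖s‖ ^ 2 + effQ m μ q ^ 2) ≤ ‖s‖ ^ 2 / ‖cons s q‖ ^ 2 := by
  have hsp : 0 < ‖s‖ ^ 2 := pow_pos (norm_pos_iff.2 hs) 2
  have hq : 0 ≤ ∑ i, ‖q i‖ ^ 2 := Finset.sum_nonneg fun i _ => sq_nonneg _
  have hc : 0 ≤ (m + 1) / m * μ := by positivity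
  rw [norm_cons_sq, effQ_sq hm hμ]
  exact div_le_div_of_nonneg_left hsp.le (add_pos_of_pos_of_nonneg hsp hq)
    (add_le_add_right (le_add_of_nonneg_right hc) _)

theorem lintegral_schurWeight_mul_lambdaKernel_le (hm : 0 < m) (hμ : 0 < μ) (β : ℝ) (s : E3)
    (q : Fin n → E3) :
    ∫⁻ t, ENNReal.ofReal (schurWeight 2 (s, t, q) * lambdaKernel m μ β (s, t, q))
      ≤ Lambda β m * ENNReal.ofReal (‖cons s q 0‖ ^ 2 / ‖cons s q‖ ^ 2) := by
  change _ ≤ Lambda β m * ENNReal.ofReal (‖s‖ ^ 2 / ‖cons s q‖ ^ 2)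
  rcases eq_or_ne s 0 with rfl | hs
  · simp [schurWeight]
  have := norm_pos_iff.2 hs
  have hintegrand (t : E3) :
      ENNReal.ofReal (schurWeight 2 (s, t, q) * lambdaKernel m μ β (s, t, q))
        = ENNReal.ofReal (‖s‖ ^ 2 / (‖s‖ ^ 2 + effQ m μ q ^ 2))
          * (ENNReal.ofReal ((‖s‖ ^ 2 + effQ m μ q ^ 2) / (Real.pi ^ 2 * (1 + m)))
            * ENNReal.ofReal (LambdaIntegrand β m s (∑ i, q i) (effQ m μ q) t)) := by
    rw [← ENNReal.ofReal_mul (by positivity), ← ENNReal.ofReal_mul (by positivity), schurWeight,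
      Real.rpow_two, Real.rpow_neg (norm_nonneg _), Real.rpow_two, mul_assoc, ← one_div,
      inv_norm_sq_mul_lambdaKernel hm hμ]
    field_simp
  rw [lintegral_congr hintegrand, lintegral_const_mul' _ _ ENNReal.ofReal_ne_top,
    lintegral_const_mul' _ _ ENNReal.ofReal_ne_top, mul_comm (Lambda β m)]
  exact mul_le_mul' (ENNReal.ofReal_le_ofReal (norm_sq_div_le hm hμ hs q))
    (le_lambda β m s _ (effQ_pos hm hμ q))

theorem lintegral_mul_norm_apply_sq_div_eq {k : ℕ} {Φ : Config k → ℝ≥0∞} (hΦ : Measurable Φ)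
    (hperm : ∀ σ, (fun p => Φ (permute σ p)) =ᵐ[volume] Φ) (i j : Fin k) :
    ∫⁻ p, Φ p * ENNReal.ofReal (‖p i‖ ^ 2 / ‖p‖ ^ 2)
      = ∫⁻ p, Φ p * ENNReal.ofReal (‖p j‖ ^ 2 / ‖p‖ ^ 2) := by
  rw [← (measurePreserving_permute (Equiv.swap j i)).lintegral_comp (by fun_prop)]
  refine lintegral_congr_ae ?_
  filter_upwards [hperm (Equiv.swap j i)] with p hp
  have happly : permute (Equiv.swap j i) p i = p j := by simp [permute]
  have hnorm : ‖permute (Equiv.swap j i) p‖ = ‖p‖ := (permuteIso (Equiv.swap j i)).norm_map p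
  rw [hp, happly, hnorm]

theorem mul_lintegral_mul_norm_apply_sq_div_le {k : ℕ} {Φ : Config k → ℝ≥0∞} (hΦ : Measurable Φ)
    (hperm : ∀ σ, (fun p => Φ (permute σ p)) =ᵐ[volume] Φ) (i : Fin k) :
    (k : ℝ≥0∞) * ∫⁻ p, Φ p * ENNReal.ofReal (‖p i‖ ^ 2 / ‖p‖ ^ 2) ≤ ∫⁻ p, Φ p := by
  have hsum : (k : ℝ≥0∞) * ∫⁻ p, Φ p * ENNReal.ofReal (‖p i‖ ^ 2 / ‖p‖ ^ 2)
      = ∫⁻ p, ∑ j, Φ p * ENNReal.ofReal (‖p j‖ ^ 2 / ‖p‖ ^ 2) := by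
    rw [lintegral_finsetSum _ fun j _ => by fun_prop,
      Finset.sum_congr rfl fun j _ => lintegral_mul_norm_apply_sq_div_eq hΦ hperm j i]
    simp
  rw [hsum]
  refine lintegral_mono fun p => ?_
  simp only
  rw [← Finset.mul_sum, ← ENNReal.ofReal_sum_of_nonneg fun j _ => by positivity,
    ← Finset.sum_div, ← norm_sq_config]
  exact mul_le_of_le_one_right' (ENNReal.ofReal_le_one.2 (div_self_le_one _))

theorem mul_lintegral_lambdaKernel_le (hm : 0 < m) (hμ : 0 < μ) (β : ℝ)
    {Φ : Config (n + 1) → ℝ≥0∞} (hΦ : Measurable Φ)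
    (hperm : ∀ σ, (fun p => Φ (permute σ p)) =ᵐ[volume] Φ) :
    ((n + 1 : ℕ) : ℝ≥0∞)
        * ∫⁻ x : PairConfig n, Φ x.left * Φ x.right * ENNReal.ofReal (lambdaKernel m μ β x)
      ≤ Lambda β m * ∫⁻ p, Φ p ^ 2 := by
  have htwo := two_mul_lintegral_left_mul_right_le hΦ hΦ (measurable_schurWeight 2)
    (measurable_lambdaKernel m μ β) (ae_schurWeight_pos (n := n) _) (schurWeight_swap _)
  simp only [lambdaKernel_swap] at htwo
  rw [← two_mul, ENNReal.mul_le_mul_iff_right two_ne_zero ENNReal.ofNat_ne_top] at htwo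
  have hschur : ∫⁻ x : PairConfig n, Φ x.left ^ 2
        * ENNReal.ofReal (schurWeight 2 x * lambdaKernel m μ β x)
      ≤ Lambda β m * ∫⁻ p, Φ p ^ 2 * ENNReal.ofReal (‖p 0‖ ^ 2 / ‖p‖ ^ 2) := by
    refine (PairConfig.lintegral_left_mul_le
      (ρ := fun p => Lambda β m * ENNReal.ofReal (‖p 0‖ ^ 2 / ‖p‖ ^ 2)) (hΦ.pow_const 2)
      (by fun_prop) (by fun_prop) (lintegral_schurWeight_mul_lambdaKernel_le hm hμ β)).trans_eq ?_
    rw [← lintegral_const_mul _ (by fun_prop)]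
    exact lintegral_congr fun p => mul_left_comm _ _ _
  have hsymm := mul_lintegral_mul_norm_apply_sq_div_le (hΦ.pow_const 2)
    (fun σ => (hperm σ).pow_const 2) 0
  calc _ ≤ ((n + 1 : ℕ) : ℝ≥0∞) * (Lambda β m
        * ∫⁻ p, Φ p ^ 2 * ENNReal.ofReal (‖p 0‖ ^ 2 / ‖p‖ ^ 2)) :=
        mul_le_mul_right (htwo.trans hschur) _
    _ = Lambda β m * (((n + 1 : ℕ) : ℝ≥0∞)
        * ∫⁻ p, Φ p ^ 2 * ENNReal.ofReal (‖p 0‖ ^ 2 / ‖p‖ ^ 2)) := mul_left_comm _ _ _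
    _ ≤ _ := mul_le_mul_right hsymm _

end LambdaSchurTest

section OffForm

variable {n : ℕ} {m μ : ℝ}

/-- The off-diagonal form `T_off` as a sesquilinear form of two functions in momentum space. -/
noncomputable def offForm (m μ : ℝ) (u v : Config (n + 1) → ℂ) : ℂ :=
  ((n : ℂ) + 1) * ∫ x : PairConfig n, conj (u x.left) * v x.right * (offKernel m μ x : ℂ)

theorem Toff_eq_offForm (m μ : ℝ) (ζ ξ : L2 (n + 1)) :
    Toff m μ ζ ξ = offForm m μ (hat ζ) (hat ξ) := rfl

theorem offForm_congr (m μ : ℝ) {u u' v v' : Config (n + 1) → ℂ} (hu : u =ᵐ[volume] u')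
    (hv : v =ᵐ[volume] v') : offForm m μ u v = offForm m μ u' v' := by
  unfold offForm
  congr 1
  refine integral_congr_ae ?_
  filter_upwards [PairConfig.quasiMeasurePreserving_left.ae hu,
    PairConfig.quasiMeasurePreserving_right.ae hv] with x hux hvx
  rw [hux, hvx]

theorem offKernel_eq_rpow_mul_schurKernel (hm : 0 < m) (hμ : 0 < μ) (α : ℝ) (x : PairConfig n) :
    offKernel m μ x = L m μ x.left ^ α * L m μ x.right ^ (1 - α) * schurKernel m μ α x := by
  have hleft : L m μ x.left ^ α * L m μ x.left ^ (-α) = 1 := by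
    rw [← Real.rpow_add (L_pos hm hμ _), add_neg_cancel, Real.rpow_zero]
  have hright : L m μ x.right ^ (1 - α) * L m μ x.right ^ (α - 1) = 1 := by
    rw [← Real.rpow_add (L_pos hm hμ _), sub_add_sub_cancel', sub_self, Real.rpow_zero]
  calc offKernel m μ x = (L m μ x.left ^ α * L m μ x.left ^ (-α))
        * (L m μ x.right ^ (1 - α) * L m μ x.right ^ (α - 1)) * offKernel m μ x := by
        rw [hleft, hright, one_mul, one_mul]
    _ = _ := by unfold schurKernel; ring

theorem exists_lintegral_enorm_off_le (hm : 0 < m) (hμ : 0 < μ) (n : ℕ) {α : ℝ} (h0 : 0 ≤ α)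
    (h1 : α ≤ 1) :
    ∃ C : ℝ≥0∞, C ≠ ⊤ ∧ ∀ u v : Config (n + 1) → ℂ, Measurable u → Measurable v →
      ∫⁻ x : PairConfig n, ‖conj (u x.left) * v x.right * (offKernel m μ x : ℂ)‖ₑ
        ≤ C * (LpowNormSq m μ α u + LpowNormSq m μ (1 - α) v) := by
  obtain ⟨C, hC, h⟩ := exists_lintegral_schurKernel_le hm hμ n h0 h1
  refine ⟨C, hC, fun u v hu hv => le_of_eq_of_le (lintegral_congr fun x => ?_)
    (h (fun p => ‖((L m μ p ^ α : ℝ) : ℂ) * u p‖ₑ)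
      (fun p => ‖((L m μ p ^ (1 - α) : ℝ) : ℂ) * v p‖ₑ) (by fun_prop) (by fun_prop))⟩
  rw [offKernel_eq_rpow_mul_schurKernel hm hμ α]
  simp only [enorm_mul, RCLike.enorm_conj, Complex.ofReal_mul]
  rw [enorm_ofReal_of_nonneg (schurKernel_nonneg hm hμ α x)]
  ring

theorem integrable_off (hm : 0 < m) (hμ : 0 < μ) {α : ℝ} (h0 : 0 ≤ α) (h1 : α ≤ 1)
    {u v : Config (n + 1) → ℂ} (hu : Measurable u) (hv : Measurable v)
    (hu' : LpowNormSq m μ α u < ⊤) (hv' : LpowNormSq m μ (1 - α) v < ⊤) :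
    Integrable fun x : PairConfig n => conj (u x.left) * v x.right * (offKernel m μ x : ℂ) := by
  obtain ⟨C, hC, h⟩ := exists_lintegral_enorm_off_le hm hμ n h0 h1
  have := measurable_offKernel (n := n) hm hμ
  have := Complex.continuous_conj.measurable
  exact ⟨Measurable.aestronglyMeasurable (by fun_prop), (h u v hu hv).trans_lt (by finiteness)⟩

theorem integrable_off_self (hm : 0 < m) (hμ : 0 < μ) {u : Config (n + 1) → ℂ} (hu : Measurable u)
    (hu' : LpowNormSq m μ (1 / 2) u < ⊤) :
    Integrable fun x : PairConfig n => conj (u x.left) * u x.right * (offKernel m μ x : ℂ) :=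
  integrable_off hm hμ (α := 1 / 2) (by norm_num) (by norm_num) hu hu hu'
    (by rwa [sub_half])

end OffForm

section Cross

variable {n : ℕ} {u : Config (n + 1) → ℂ}

/-- `Re (conj u(s, q) u(t, q))`, the factor of the wave function in the real part of `T_off`. -/
noncomputable def cross (u : Config (n + 1) → ℂ) (x : PairConfig n) : ℝ :=
  (conj (u x.left) * u x.right).re

theorem cross_eq (u : Config (n + 1) → ℂ) (x : PairConfig n) :
    cross u x = (u x.left).re * (u x.right).re + (u x.left).im * (u x.right).im := by
  simp only [cross, Complex.mul_re, Complex.conj_re, Complex.conj_im]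
  ring

theorem cross_swap (u : Config (n + 1) → ℂ) (x : PairConfig n) : cross u x.swap = cross u x := by
  rw [cross_eq, cross_eq, mul_comm (u x.left).re, mul_comm (u x.left).im]
  rfl

@[fun_prop]
theorem measurable_cross (hu : Measurable u) : Measurable (cross u : PairConfig n → ℝ) := by
  simp only [funext (cross_eq u)]
  fun_prop

theorem abs_cross_le (u : Config (n + 1) → ℂ) (x : PairConfig n) :
    |cross u x| ≤ ‖u x.left‖ * ‖u x.right‖ := by
  refine (Complex.abs_re_le_norm _).trans_eq ?_
  rw [norm_mul, RCLike.norm_conj]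

theorem integral_pairConfig_nonneg {f : PairConfig n → ℝ} (hf : Integrable f)
    (h : ∀ q : Fin n → E3, Integrable (fun z : E3 × E3 => f (z.1, z.2, q)) →
      0 ≤ ∫ z : E3 × E3, f (z.1, z.2, q)) : 0 ≤ ∫ x, f x := by
  have hassoc := measurePreserving_prodAssoc (volume : Measure E3) (volume : Measure E3)
    (volume : Measure (Fin n → E3))
  have hf' : Integrable (fun z => f (MeasurableEquiv.prodAssoc z))
      (((volume : Measure E3).prod volume).prod volume) :=
    (hassoc.integrable_comp_emb MeasurableEquiv.prodAssoc.measurableEmbedding).2 hf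
  refine le_of_le_of_eq ?_ (hassoc.integral_comp MeasurableEquiv.prodAssoc.measurableEmbedding f)
  rw [integral_prod_symm _ hf']
  refine integral_nonneg_of_ae ?_
  filter_upwards [hf'.prod_left_ae] with q hq using h q hq

end Cross

section RegularisedEnergy

variable {k : ℕ} {m μ β ε : ℝ}

/-- The energy `∫ f(L) L |u|²` of the regularisation `f = reg β ε` of `x ^ β`. -/
noncomputable def regEnergy (m μ β ε : ℝ) (u : Config k → ℂ) : ℝ≥0∞ :=
  ∫⁻ p, ENNReal.ofReal (reg β ε (L m μ p) * L m μ p) * ‖u p‖ₑ ^ 2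

theorem lpowNormSq_eq (hm : 0 < m) (hμ : 0 < μ) (r : ℝ) (u : Config k → ℂ) :
    LpowNormSq m μ r u = ∫⁻ p, ENNReal.ofReal (L m μ p ^ (2 * r)) * ‖u p‖ₑ ^ 2 := by
  refine lintegral_congr fun p => ?_
  have hp := L_pos hm hμ p
  rw [enorm_mul, enorm_ofReal_of_nonneg (by positivity), mul_pow,
    ← ENNReal.ofReal_pow (by positivity), ← Real.rpow_mul_natCast hp.le, mul_comm r]
  rfl

theorem regEnergy_lt_top (hm : 0 < m) (hμ : 0 < μ) (hε : 0 < ε) {u : Config k → ℂ}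
    (hu : LpowNormSq m μ (1 / 2) u < ⊤) : regEnergy m μ β ε u < ⊤ := by
  refine lt_of_le_of_lt ?_ (ENNReal.mul_lt_top (ENNReal.ofReal_lt_top (r := ε⁻¹)) hu)
  rw [lpowNormSq_eq hm hμ, ← lintegral_const_mul' _ _ ENNReal.ofReal_ne_top]
  refine lintegral_mono fun p => ?_
  have hp := L_pos hm hμ p
  rw [← mul_assoc, ← ENNReal.ofReal_mul (by positivity), mul_one_div_cancel two_ne_zero,
    Real.rpow_one]
  gcongr
  exact reg_le_inv hε hp.le

theorem norm_reg_L_le (hm : 0 < m) (hμ : 0 < μ) (hε : 0 < ε) (p : Config k) :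
    ‖reg β ε (L m μ p)‖ ≤ ε⁻¹ := by
  have hp := (L_pos hm hμ p).le
  rw [Real.norm_of_nonneg (reg_nonneg hε.le hp)]
  exact reg_le_inv hε hp

/-- The density whose square integrates to `regEnergy`. -/
noncomputable def regDensity (m μ β ε : ℝ) (u : Config k → ℂ) (p : Config k) : ℝ≥0∞ :=
  ENNReal.ofReal (Real.sqrt (reg β ε (L m μ p) * L m μ p)) * ‖u p‖ₑ

theorem measurable_regDensity {u : Config k → ℂ} (hu : Measurable u) :
    Measurable (regDensity m μ β ε u) := by
  unfold regDensity
  fun_prop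

theorem lintegral_regDensity_sq (hm : 0 < m) (hμ : 0 < μ) (hε : 0 ≤ ε) (u : Config k → ℂ) :
    ∫⁻ p, regDensity m μ β ε u p ^ 2 = regEnergy m μ β ε u := by
  refine lintegral_congr fun p => ?_
  have hp := L_pos hm hμ p
  have hr := reg_nonneg (β := β) hε hp.le
  rw [regDensity, mul_pow, ← ENNReal.ofReal_pow (by positivity), Real.sq_sqrt (by positivity)]

theorem regDensity_permute {u : Config k → ℂ} (hu : Antisymm u) (σ : Equiv.Perm (Fin k)) :
    (fun p => regDensity m μ β ε u (permute σ p)) =ᵐ[volume] regDensity m μ β ε u := by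
  have hsign : ‖((Equiv.Perm.sign σ : ℤ) : ℂ)‖ₑ = 1 := by
    rcases Int.units_eq_one_or (Equiv.Perm.sign σ) with h | h <;> simp [h]
  filter_upwards [hu σ] with p hp
  rw [regDensity, regDensity, L_permute, hp, enorm_mul, hsign, one_mul]

end RegularisedEnergy

section RegularisedForm

variable {n : ℕ} {m μ β ε : ℝ} {u : Config (n + 1) → ℂ}

/-- The symbol `f(L(s, q)) + f(L(t, q))` with `f = reg β ε`. -/
noncomputable def regSum (m μ β ε : ℝ) (x : PairConfig n) : ℝ :=
  reg β ε (L m μ x.left) + reg β ε (L m μ x.right)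

@[fun_prop]
theorem measurable_regSum : Measurable (regSum m μ β ε : PairConfig n → ℝ) := by
  unfold regSum
  fun_prop

theorem regSum_nonneg (hm : 0 < m) (hμ : 0 < μ) (hε : 0 ≤ ε) (x : PairConfig n) :
    0 ≤ regSum m μ β ε x :=
  add_nonneg (reg_nonneg hε (L_pos hm hμ _).le) (reg_nonneg hε (L_pos hm hμ _).le)

theorem integrable_reg_left_cross_offKernel (hm : 0 < m) (hμ : 0 < μ) (hε : 0 < ε)
    (hu : Measurable u) (hu' : LpowNormSq m μ (1 / 2) u < ⊤) :
    Integrable fun x : PairConfig n =>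
      reg β ε (L m μ x.left) * (cross u x * offKernel m μ x) := by
  have hcross : Integrable fun x : PairConfig n => cross u x * offKernel m μ x :=
    (integrable_off_self hm hμ hu hu').re.congr (.of_forall fun x => Complex.re_mul_ofReal _ _)
  exact hcross.bdd_mul (Measurable.aestronglyMeasurable (by fun_prop))
    (.of_forall fun _ => norm_reg_L_le hm hμ hε _)

theorem re_offForm_reg (hm : 0 < m) (hμ : 0 < μ) (hε : 0 < ε) (hu : Measurable u)
    (hu' : LpowNormSq m μ (1 / 2) u < ⊤) :
    (offForm m μ (fun p => (reg β ε (L m μ p) : ℂ) * u p) u).re = ((n : ℝ) + 1)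
      * ∫ x : PairConfig n, reg β ε (L m μ x.left) * (cross u x * offKernel m μ x) := by
  have hint : Integrable fun x : PairConfig n =>
      conj ((reg β ε (L m μ x.left) : ℂ) * u x.left) * u x.right * (offKernel m μ x : ℂ) := by
    refine ((integrable_off_self hm hμ hu hu').bdd_mul (c := ε⁻¹)
      (f := fun x => (reg β ε (L m μ x.left) : ℂ)) (Measurable.aestronglyMeasurable (by fun_prop))
      (.of_forall fun x => ?_)).congr (.of_forall fun x => ?_)
    · rw [Complex.norm_real]
      exact norm_reg_L_le hm hμ hε _
    · simp only [map_mul, Complex.conj_ofReal]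
      ring
  have hre := Complex.reCLM.integral_comp_comm hint
  simp only [Complex.reCLM_apply] at hre
  rw [offForm, show ((n : ℂ) + 1) = (((n : ℝ) + 1 : ℝ) : ℂ) by push_cast; rfl,
    Complex.re_ofReal_mul, ← hre]
  congr 1
  refine integral_congr_ae (.of_forall fun x => ?_)
  simp only [map_mul, Complex.conj_ofReal, mul_assoc, Complex.re_ofReal_mul]
  rw [← mul_assoc, Complex.re_mul_ofReal]
  rfl

theorem regSum_mul_cross_mul_offKernel (hm : 0 < m) (hμ : 0 < μ) (x : PairConfig n) :
    regSum m μ β ε x * (cross u x * offKernel m μ x)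
      = reg β ε (L m μ x.left) * (cross u x * offKernel m μ x)
        + reg β ε (L m μ x.swap.left) * (cross u x.swap * offKernel m μ x.swap) := by
  rw [cross_swap, offKernel_swap hm hμ, ← add_mul]
  rfl

theorem integrable_regSum_cross_offKernel (hm : 0 < m) (hμ : 0 < μ) (hε : 0 < ε)
    (hu : Measurable u) (hu' : LpowNormSq m μ (1 / 2) u < ⊤) :
    Integrable fun x : PairConfig n => regSum m μ β ε x * (cross u x * offKernel m μ x) := by
  have hint := integrable_reg_left_cross_offKernel (β := β) hm hμ hε hu hu'
  simp only [regSum_mul_cross_mul_offKernel hm hμ]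
  exact hint.add ((PairConfig.measurePreserving_swap.integrable_comp_emb
    PairConfig.measurableEmbedding_swap).2 hint)

theorem two_mul_re_offForm_reg (hm : 0 < m) (hμ : 0 < μ) (hε : 0 < ε)
    (hu : Measurable u) (hu' : LpowNormSq m μ (1 / 2) u < ⊤) :
    2 * (offForm m μ (fun p => (reg β ε (L m μ p) : ℂ) * u p) u).re = ((n : ℝ) + 1)
      * ∫ x : PairConfig n, regSum m μ β ε x * (cross u x * offKernel m μ x) := by
  have hint := integrable_reg_left_cross_offKernel (β := β) hm hμ hε hu hu'
  have hint' := (PairConfig.measurePreserving_swap.integrable_comp_emb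
    PairConfig.measurableEmbedding_swap).2 hint
  have hswap := PairConfig.measurePreserving_swap.integral_comp
    PairConfig.measurableEmbedding_swap
    fun x : PairConfig n => reg β ε (L m μ x.left) * (cross u x * offKernel m μ x)
  simp only [regSum_mul_cross_mul_offKernel hm hμ]
  rw [re_offForm_reg hm hμ hε hu hu', mul_left_comm, two_mul]
  exact congrArg _ ((integral_add hint hint').trans (congrArg _ hswap)).symm

theorem integrable_regSum_cross_offKernelEven (hm : 0 < m) (hμ : 0 < μ) (hε : 0 < ε)
    (hu : Measurable u) (hu' : LpowNormSq m μ (1 / 2) u < ⊤) :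
    Integrable fun x : PairConfig n => regSum m μ β ε x * (cross u x * offKernelEven m μ x) := by
  refine ((integrable_regSum_cross_offKernel (β := β) hm hμ hε hu hu').const_mul
    ((m + 1) / m)).mono (Measurable.aestronglyMeasurable (by fun_prop)) (.of_forall fun x => ?_)
  have heven := offKernelEven_nonneg hm hμ x
  have hoff := offKernel_pos hm hμ x
  rw [norm_mul, norm_mul, norm_mul, norm_mul, norm_mul, Real.norm_of_nonneg heven,
    Real.norm_of_nonneg hoff.le, Real.norm_of_nonneg (by positivity : 0 ≤ (m + 1) / m)]
  calc _ ≤ ‖regSum m μ β ε x‖ * (‖cross u x‖ * ((m + 1) / m * offKernel m μ x)) := by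
        gcongr
        exact offKernelEven_le hm hμ x
    _ = _ := by ring

theorem integral_regSum_cross_offKernelEven_nonneg (hm : 0 < m) (hμ : 0 < μ) (h0 : 0 ≤ β)
    (h2 : β ≤ 2) (hε : 0 < ε) (hu : Measurable u) (hu' : LpowNormSq m μ (1 / 2) u < ⊤) :
    0 ≤ ∫ x : PairConfig n, regSum m μ β ε x * (cross u x * offKernelEven m μ x) := by
  refine integral_pairConfig_nonneg
    (integrable_regSum_cross_offKernelEven hm hμ hε hu hu') fun q hq => ?_
  have hsymbol := posSemidef_reg_ell_add_mul_evenDen_div (K := ∑ i, q i) hm (effQ_pos hm hμ q)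
    h0 h2 hε.le
  have hcross := (posSemidef_mul_self fun s : E3 => (u (cons s q)).re).add
    (posSemidef_mul_self fun s : E3 => (u (cons s q)).im)
  refine integral_prod_nonneg_of_posSemidef (K := Matrix.of fun s t =>
    regSum m μ β ε (s, t, q) * (cross u (s, t, q) * offKernelEven m μ (s, t, q)))
    ((congrArg Matrix.PosSemidef (Matrix.ext fun s t => ?_)).mpr (hsymbol.hadamard hcross))
    ?_ hq
  · simp only [Matrix.of_apply, Matrix.hadamard_apply, Matrix.add_apply, cross_eq, regSum,
      PairConfig.left, PairConfig.right, offKernelEven, L_cons hm hμ]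
    ring
  · have hmeas : Measurable fun x : PairConfig n =>
        regSum m μ β ε x * (cross u x * offKernelEven m μ x) := by fun_prop
    exact hmeas.comp (by fun_prop : Measurable fun z : E3 × E3 => (z.1, z.2, q))

theorem enorm_regSum_cross_offKernelOdd_le (hm : 0 < m) (hμ : 0 < μ) (hε : 0 ≤ ε)
    (u : Config (n + 1) → ℂ) (x : PairConfig n) :
    ‖regSum m μ β ε x * (cross u x * offKernelOdd m μ x)‖ₑ
      ≤ regDensity m μ β ε u x.left * regDensity m μ β ε u x.right
        * ENNReal.ofReal (lambdaKernel m μ β x) := by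
  have hreg := reg_add_reg_le (β := β) hε (L_pos hm hμ x.left) (L_pos hm hμ x.right)
  rw [regDensity, regDensity, lambdaKernel, ← ofReal_norm (u x.left), ← ofReal_norm (u x.right),
    ← ofReal_norm, ← ENNReal.ofReal_mul (by positivity), ← ENNReal.ofReal_mul (by positivity),
    ← ENNReal.ofReal_mul (by positivity), ← ENNReal.ofReal_mul (by positivity), norm_mul,
    norm_mul, Real.norm_of_nonneg (regSum_nonneg hm hμ hε x)]
  refine ENNReal.ofReal_le_ofReal ?_
  have hsum := (regSum_nonneg (β := β) hm hμ hε x).trans hreg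
  calc _ ≤ (Real.sqrt (reg β ε (L m μ x.left) * L m μ x.left)
          * Real.sqrt (reg β ε (L m μ x.right) * L m μ x.right)
          * symmWeight β (L m μ x.left) (L m μ x.right))
        * (‖u x.left‖ * ‖u x.right‖ * |offKernelOdd m μ x|) :=
        mul_le_mul hreg (mul_le_mul_of_nonneg_right (abs_cross_le u x) (abs_nonneg _))
          (by positivity) hsum
    _ = _ := by ring

theorem abs_integral_regSum_cross_offKernelOdd_le (hm : 0 < m) (hμ : 0 < μ) (h0 : 0 ≤ β)
    (h2 : β ≤ 2) (hε : 0 < ε) (hu : Measurable u) (ha : Antisymm u)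
    (hu' : LpowNormSq m μ (1 / 2) u < ⊤) :
    ((n : ℝ) + 1) * |∫ x : PairConfig n, regSum m μ β ε x * (cross u x * offKernelOdd m μ x)|
      ≤ (Lambda β m * regEnergy m μ β ε u).toReal := by
  have henergy := regEnergy_lt_top hm hμ (β := β) hε hu'
  have hΛ := lambda_ne_top hm h0 h2
  have hle := (mul_le_mul_right ((enorm_integral_le_lintegral_enorm _).trans
      (lintegral_mono (enorm_regSum_cross_offKernelOdd_le hm hμ hε.le u))) _).trans
    (mul_lintegral_lambdaKernel_le hm hμ β
      (measurable_regDensity (m := m) (μ := μ) (β := β) (ε := ε) hu) (regDensity_permute ha))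
  rw [lintegral_regDensity_sq hm hμ hε.le] at hle
  have hreal := ENNReal.toReal_mono (by finiteness) hle
  rwa [ENNReal.toReal_mul (a := ((n + 1 : ℕ) : ℝ≥0∞)), toReal_enorm, Real.norm_eq_abs,
    ENNReal.toReal_natCast, Nat.cast_add_one] at hreal

theorem neg_lambda_mul_regEnergy_le_re_offForm (hm : 0 < m) (hμ : 0 < μ) (h0 : 0 ≤ β) (h2 : β ≤ 2)
    (hε : 0 < ε) (hu : Measurable u) (ha : Antisymm u) (hu' : LpowNormSq m μ (1 / 2) u < ⊤) :
    -((Lambda β m * regEnergy m μ β ε u).toReal / 2)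
      ≤ (offForm m μ (fun p => (reg β ε (L m μ p) : ℂ) * u p) u).re := by
  have hint := integrable_regSum_cross_offKernel (β := β) hm hμ hε hu hu'
  have hinteven := integrable_regSum_cross_offKernelEven (β := β) hm hμ hε hu hu'
  have hodd : ∫ x : PairConfig n, regSum m μ β ε x * (cross u x * offKernelOdd m μ x)
      = (∫ x : PairConfig n, regSum m μ β ε x * (cross u x * offKernel m μ x))
        - ∫ x : PairConfig n, regSum m μ β ε x * (cross u x * offKernelEven m μ x) := by
    rw [← integral_sub hint hinteven]
    refine integral_congr_ae (.of_forall fun x => ?_)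
    simp only [← offKernelEven_add_offKernelOdd hm hμ x]
    ring
  have hn : (0 : ℝ) ≤ (n : ℝ) + 1 := by positivity
  have heven := mul_nonneg hn
    (integral_regSum_cross_offKernelEven_nonneg hm hμ h0 h2 hε hu hu')
  have hbound := abs_integral_regSum_cross_offKernelOdd_le hm hμ h0 h2 hε hu ha hu'
  have habs := mul_le_mul_of_nonneg_left (neg_le_abs
    (∫ x : PairConfig n, regSum m μ β ε x * (cross u x * offKernelOdd m μ x))) hn
  have htwo := two_mul_re_offForm_reg (β := β) hm hμ hε hu hu'
  rw [hodd] at habs hbound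
  linarith

end RegularisedForm

section LowerBound

variable {n k : ℕ} {m μ r r' β ε : ℝ}

theorem le_L (hm : 0 < m) (μ : ℝ) (p : Config k) :
    2 * Real.pi ^ 2 * Real.sqrt μ ≤ L m μ p := by
  rw [L_eq_sqrt_norm hm]
  gcongr
  exact le_add_of_nonneg_left (by positivity)

theorem lpowNormSq_congr {u v : Config k → ℂ} (h : u =ᵐ[volume] v) :
    LpowNormSq m μ r u = LpowNormSq m μ r v :=
  lintegral_congr_ae (h.mono fun p hp => by simp only [hp])

theorem lpowNormSq_zero (m μ : ℝ) (u : Config k → ℂ) :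
    LpowNormSq m μ 0 u = ∫⁻ p, ‖u p‖ₑ ^ 2 := by
  simp [LpowNormSq]

theorem lpowNormSq_lt_top_mono (hm : 0 < m) (hμ : 0 < μ) (h : r' ≤ r) {u : Config k → ℂ}
    (hu : LpowNormSq m μ r u < ⊤) : LpowNormSq m μ r' u < ⊤ := by
  have hinf : 0 < 2 * Real.pi ^ 2 * Real.sqrt μ := by positivity
  refine lt_of_le_of_lt ?_ (ENNReal.mul_lt_top (ENNReal.ofReal_lt_top
    (r := (2 * Real.pi ^ 2 * Real.sqrt μ) ^ (2 * r' - 2 * r))) hu)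
  rw [lpowNormSq_eq hm hμ, lpowNormSq_eq hm hμ, ← lintegral_const_mul' _ _ ENNReal.ofReal_ne_top]
  refine lintegral_mono fun p => ?_
  have hp := L_pos hm hμ p
  rw [← mul_assoc, ← ENNReal.ofReal_mul (by positivity)]
  gcongr
  calc L m μ p ^ (2 * r') = L m μ p ^ (2 * r' - 2 * r) * L m μ p ^ (2 * r) := by
        rw [← Real.rpow_add hp, sub_add_cancel]
    _ ≤ _ := mul_le_mul_of_nonneg_right
        (Real.rpow_le_rpow_of_nonpos hinf (le_L hm μ p) (by linarith)) (by positivity)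

theorem lpowNormSq_ofReal_mul_le {c : ℝ} {f : Config k → ℝ} (hf : ∀ p, ‖f p‖ ≤ c)
    (u : Config k → ℂ) :
    LpowNormSq m μ r (fun p => (f p : ℂ) * u p) ≤ ENNReal.ofReal c ^ 2 * LpowNormSq m μ r u := by
  unfold LpowNormSq
  rw [← lintegral_const_mul' _ _ (by finiteness)]
  refine lintegral_mono fun p => ?_
  rw [← mul_pow, mul_left_comm, enorm_mul (f p : ℂ), ← ofReal_norm, Complex.norm_real]
  gcongr
  exact hf p

theorem exists_mem_Has (hm : 0 < m) (hμ : 0 < μ) (hr : 0 ≤ r) {u : Config k → ℂ}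
    (hu : AEStronglyMeasurable u) (ha : Antisymm u) (h : LpowNormSq m μ r u < ⊤) :
    ∃ ζ ∈ Has k r, hat ζ =ᵐ[volume] u := by
  have h0 := lpowNormSq_lt_top_mono hm hμ hr h
  rw [lpowNormSq_zero, ← memLp_two_iff hu] at h0
  obtain ⟨ζ, hζ⟩ := exists_hat_eq h0
  exact ⟨ζ, (mem_Has_iff hm hμ hr ζ).2 ⟨ha.congr hζ.symm, by rwa [lpowNormSq_congr hζ]⟩, hζ⟩

theorem exists_mem_Has_hat_eq_reg_mul (hm : 0 < m) (hμ : 0 < μ) (β : ℝ) (hε : 0 < ε) {ξ : L2 k}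
    (hξ : ξ ∈ Has k (1 / 2)) :
    ∃ ζ ∈ Has k (1 / 2), hat ζ =ᵐ[volume] fun p => (reg β ε (L m μ p) : ℂ) * hat ξ p := by
  obtain ⟨ha, hf⟩ := (mem_Has_iff hm hμ (by norm_num) ξ).1 hξ
  refine exists_mem_Has hm hμ (by norm_num) (Measurable.aestronglyMeasurable (by fun_prop))
    (ha.mul_left fun σ x => by rw [L_permute]) ?_
  exact (lpowNormSq_ofReal_mul_le (fun p => norm_reg_L_le hm hμ hε p) _).trans_lt
    (ENNReal.mul_lt_top (by finiteness) hf)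

theorem Tdiag_eq_regEnergy (hm : 0 < m) (hμ : 0 < μ) (hε : 0 ≤ ε) {ζ ξ : L2 k}
    (hζ : hat ζ =ᵐ[volume] fun p => (reg β ε (L m μ p) : ℂ) * hat ξ p) :
    Tdiag m μ ζ ξ = ((regEnergy m μ β ε (hat ξ)).toReal : ℂ) := by
  have hnonneg (p : Config k) : 0 ≤ reg β ε (L m μ p) * L m μ p :=
    mul_nonneg (reg_nonneg hε (L_pos hm hμ p).le) (L_pos hm hμ p).le
  have hreal : Tdiag m μ ζ ξ
      = ((∫ p, reg β ε (L m μ p) * L m μ p * ‖hat ξ p‖ ^ 2 : ℝ) : ℂ) := by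
    refine Eq.trans (integral_congr_ae ?_) integral_complex_ofReal
    filter_upwards [hζ] with p hp
    rw [hp, map_mul, Complex.conj_ofReal]
    push_cast
    rw [← Complex.conj_mul']
    ring
  rw [hreal, integral_eq_lintegral_of_nonneg_ae
    (.of_forall fun p => mul_nonneg (hnonneg p) (sq_nonneg _))
    (Measurable.aestronglyMeasurable (by fun_prop))]
  congr 2
  refine lintegral_congr fun p => ?_
  rw [ENNReal.ofReal_mul (hnonneg p), ENNReal.ofReal_pow (norm_nonneg _), ofReal_norm]

theorem reg_le_sqrt_reg_mul_mul_rpow {x : ℝ} (hε : 0 ≤ ε) (hx : 0 < x) :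
    reg β ε x ≤ Real.sqrt (reg β ε x * x) * x ^ ((β - 1) / 2) := by
  have hreg := reg_nonneg (β := β) hε hx.le
  refine (pow_le_pow_iff_left₀ hreg (by positivity) two_ne_zero).1 ?_
  calc reg β ε x ^ 2 ≤ reg β ε x * x ^ β := by
        rw [sq]
        exact mul_le_mul_of_nonneg_left (reg_le_rpow hε hx.le) hreg
    _ = reg β ε x * (x ^ (β - 1) * x) := by rw [← Real.rpow_add_one hx.ne', sub_add_cancel]
    _ = (Real.sqrt (reg β ε x * x) * x ^ ((β - 1) / 2)) ^ 2 := by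
        rw [mul_pow, Real.sq_sqrt (by positivity), ← Real.rpow_mul_natCast hx.le,
          Nat.cast_ofNat, div_mul_cancel₀ _ two_ne_zero]
        ring

theorem enorm_conj_reg_mul_mul_le (hm : 0 < m) (hμ : 0 < μ) (hε : 0 ≤ ε) (u : Config k → ℂ)
    (p : Config k) (w : ℂ) :
    ‖conj ((reg β ε (L m μ p) : ℂ) * u p) * w‖ₑ
      ≤ regDensity m μ β ε u p * ‖((L m μ p ^ ((β - 1) / 2) : ℝ) : ℂ) * w‖ₑ := by
  have hp := L_pos hm hμ p
  rw [enorm_mul, RCLike.enorm_conj, enorm_mul, enorm_mul,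
    enorm_ofReal_of_nonneg (reg_nonneg hε hp.le), enorm_ofReal_of_nonneg (by positivity),
    regDensity, mul_mul_mul_comm, ← ENNReal.ofReal_mul (by positivity), mul_assoc]
  gcongr
  exact reg_le_sqrt_reg_mul_mul_rpow hε hp

theorem two_mul_enorm_integral_le_regEnergy_add (hm : 0 < m) (hμ : 0 < μ) (hε : 0 ≤ ε) {c : ℝ}
    (hc : 0 < c) {ζ ξ : L2 k} (g : Config k → ℂ)
    (hζ : hat ζ =ᵐ[volume] fun p => (reg β ε (L m μ p) : ℂ) * hat ξ p) :
    2 * ‖∫ p, conj (hat ζ p) * g p‖ₑ ≤ ENNReal.ofReal c * regEnergy m μ β ε (hat ξ)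
      + ENNReal.ofReal c⁻¹ * LpowNormSq m μ ((β - 1) / 2) g := by
  have hdensity := measurable_regDensity (m := m) (μ := μ) (β := β) (ε := ε) (measurable_hat ξ)
  rw [← lintegral_regDensity_sq hm hμ hε, LpowNormSq, ← lintegral_const_mul' _ _ (by finiteness),
    ← lintegral_const_mul' _ _ (by finiteness),
    ← lintegral_add_left ((hdensity.pow_const 2).const_mul _)]
  refine (mul_le_mul_right (enorm_integral_le_lintegral_enorm _) 2).trans ?_
  rw [← lintegral_const_mul' _ _ (by finiteness)]
  refine lintegral_mono_ae ?_
  filter_upwards [hζ] with p hp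
  rw [hp]
  exact (mul_le_mul_right (enorm_conj_reg_mul_mul_le hm hμ hε _ p (g p)) 2).trans
    ((two_mul_mul_le_add_sq_mul_inv _ _ hc).trans_eq (by ring))

theorem mul_regEnergy_le_enorm_integral (hm : 0 < m) (hμ : 0 < μ) (h0 : 0 ≤ β) (h2 : β ≤ 2)
    (hε : 0 < ε) {ζ ξ : L2 (n + 1)} {g : Config (n + 1) → ℂ} (hg : IsGammaHat m μ ξ g)
    (hζ : ζ ∈ Has (n + 1) (1 / 2))
    (hζξ : hat ζ =ᵐ[volume] fun p => (reg β ε (L m μ p) : ℂ) * hat ξ p) :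
    ENNReal.ofReal (1 - (Lambda β m).toReal / 2) * regEnergy m μ β ε (hat ξ)
      ≤ ‖∫ p, conj (hat ζ p) * g p‖ₑ := by
  obtain ⟨ha, hf⟩ := (mem_Has_iff hm hμ (by norm_num) ξ).1 hg.mem_form_domain
  have hoff := neg_lambda_mul_regEnergy_le_re_offForm hm hμ h0 h2 hε (measurable_hat ξ) ha hf
  have hform := hg.form_eq ζ hζ
  rw [Tdiag_eq_regEnergy hm hμ hε.le hζξ, Toff_eq_offForm,
    offForm_congr m μ hζξ (ae_eq_refl _)] at hform
  have hre := congrArg Complex.re hform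
  rw [Complex.add_re, Complex.ofReal_re] at hre
  rw [ENNReal.toReal_mul] at hoff
  rw [← ENNReal.ofReal_toReal (regEnergy_lt_top hm hμ (β := β) hε hf).ne,
    ← ENNReal.ofReal_mul' ENNReal.toReal_nonneg, ← ofReal_norm]
  refine ENNReal.ofReal_le_ofReal (le_trans ?_ (Complex.re_le_norm _))
  linarith

theorem IsGammaHat.mul_regEnergy_le (hm : 0 < m) (hμ : 0 < μ) (h0 : 0 ≤ β) (h2 : β ≤ 2)
    (hε : 0 < ε) {ξ : L2 (n + 1)} {g : Config (n + 1) → ℂ} (hg : IsGammaHat m μ ξ g)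
    (hΛ : (Lambda β m).toReal < 1) :
    ENNReal.ofReal (1 - (Lambda β m).toReal) * regEnergy m μ β ε (hat ξ)
      ≤ LpowNormSq m μ ((β - 1) / 2) g := by
  obtain ⟨-, hf⟩ := (mem_Has_iff hm hμ (by norm_num) ξ).1 hg.mem_form_domain
  obtain ⟨ζ, hζ, hζξ⟩ := exists_mem_Has_hat_eq_reg_mul hm hμ β hε hg.mem_form_domain
  have hfin := (regEnergy_lt_top hm hμ (β := β) hε hf).ne
  set Λ := (Lambda β m).toReal
  have hc : 0 < 1 - Λ / 2 := by
    have : 0 ≤ Λ := ENNReal.toReal_nonneg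
    linarith
  have hdouble := (mul_le_mul_right (mul_regEnergy_le_enorm_integral hm hμ h0 h2 hε hg hζ hζξ)
    2).trans (two_mul_enorm_integral_le_regEnergy_add hm hμ hε.le hc g hζξ)
  rw [two_mul, ENNReal.add_le_add_iff_left (by finiteness)] at hdouble
  calc ENNReal.ofReal (1 - Λ) * regEnergy m μ β ε (hat ξ)
      ≤ ENNReal.ofReal ((1 - Λ / 2) * (1 - Λ / 2)) * regEnergy m μ β ε (hat ξ) := by
        gcongr
        linarith [sq_nonneg Λ]
    _ = ENNReal.ofReal (1 - Λ / 2) * (ENNReal.ofReal (1 - Λ / 2) * regEnergy m μ β ε (hat ξ)) := by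
        rw [ENNReal.ofReal_mul hc.le, mul_assoc]
    _ ≤ ENNReal.ofReal (1 - Λ / 2)
        * (ENNReal.ofReal (1 - Λ / 2)⁻¹ * LpowNormSq m μ ((β - 1) / 2) g) := by
        gcongr
    _ = LpowNormSq m μ ((β - 1) / 2) g := by
        rw [← mul_assoc, ← ENNReal.ofReal_mul hc.le, mul_inv_cancel₀ hc.ne', ENNReal.ofReal_one,
          one_mul]

theorem tendsto_reg_one_div (β x : ℝ) :
    Filter.Tendsto (fun j : ℕ => reg β (1 / ((j : ℝ) + 1)) x) Filter.atTop (nhds (x ^ β)) := by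
  have hden := (tendsto_one_div_add_atTop_nhds_zero_nat (𝕜 := ℝ)).mul_const (x ^ β)
  have hquot := (tendsto_const_nhds (x := x ^ β)).div (hden.const_add 1) (by norm_num)
  rwa [zero_mul, add_zero, div_one] at hquot

theorem lpowNormSq_le_of_regEnergy_le (hm : 0 < m) (hμ : 0 < μ) {u : Config k → ℂ}
    (hu : Measurable u) {M : ℝ≥0∞} (h : ∀ ε, 0 < ε → regEnergy m μ β ε u ≤ M) :
    LpowNormSq m μ ((β + 1) / 2) u ≤ M := by
  have hlim (p : Config k) : Filter.Tendsto (fun j : ℕ => ENNReal.ofReal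
      (reg β (1 / ((j : ℝ) + 1)) (L m μ p) * L m μ p) * ‖u p‖ₑ ^ 2) Filter.atTop
      (nhds (ENNReal.ofReal (L m μ p ^ (2 * ((β + 1) / 2))) * ‖u p‖ₑ ^ 2)) := by
    refine ENNReal.Tendsto.mul_const (ENNReal.tendsto_ofReal ?_) (Or.inr (by finiteness))
    rw [mul_div_cancel₀ _ two_ne_zero, Real.rpow_add_one (L_pos hm hμ p).ne']
    exact (tendsto_reg_one_div β _).mul_const _
  rw [lpowNormSq_eq hm hμ]
  calc _ = ∫⁻ p, Filter.liminf (fun j : ℕ => ENNReal.ofReal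
        (reg β (1 / ((j : ℝ) + 1)) (L m μ p) * L m μ p) * ‖u p‖ₑ ^ 2) Filter.atTop :=
        lintegral_congr fun p => (hlim p).liminf_eq.symm
    _ ≤ Filter.liminf (fun j : ℕ => regEnergy m μ β (1 / ((j : ℝ) + 1)) u) Filter.atTop :=
        lintegral_liminf_le fun _ => by fun_prop
    _ ≤ Filter.liminf (fun _ : ℕ => M) Filter.atTop :=
        Filter.liminf_le_liminf (.of_forall fun _ => h _ (by positivity))
    _ = M := Filter.liminf_const _

theorem IsGammaHat.lower_bound (hm : 0 < m) (hμ : 0 < μ) (h0 : 0 ≤ β) (h2 : β ≤ 2)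
    {ξ : L2 (n + 1)} {g : Config (n + 1) → ℂ} (hg : IsGammaHat m μ ξ g) :
    ENNReal.ofReal (1 - (Lambda β m).toReal) * LpowNormSq m μ ((β + 1) / 2) (hat ξ)
      ≤ LpowNormSq m μ ((β - 1) / 2) g := by
  rcases le_or_gt 1 (Lambda β m).toReal with hΛ | hΛ
  · rw [ENNReal.ofReal_of_nonpos (by linarith), zero_mul]
    exact zero_le
  have hne : ENNReal.ofReal (1 - (Lambda β m).toReal) ≠ 0 := by
    simpa only [ne_eq, ENNReal.ofReal_eq_zero, sub_nonpos, not_le] using hΛ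
  rw [mul_comm, ← ENNReal.le_div_iff_mul_le (.inl hne) (.inl ENNReal.ofReal_ne_top)]
  refine lpowNormSq_le_of_regEnergy_le hm hμ (measurable_hat ξ) fun ε hε => ?_
  rw [ENNReal.le_div_iff_mul_le (.inl hne) (.inl ENNReal.ofReal_ne_top), mul_comm]
  exact hg.mul_regEnergy_le hm hμ h0 h2 hε hΛ

end LowerBound

section FormOperator

variable {n k : ℕ} {m μ α r : ℝ}

/-- `L²_as` as a submodule of `L²`. -/
noncomputable def antisymmSubmodule (k : ℕ) : Submodule ℂ (L2 k) :=
  ⨅ σ : Equiv.Perm (Fin k), LinearMap.eqLocus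
    (Lp.compMeasurePreservingₗᵢ ℂ (permuteIso σ) (permuteIso σ).measurePreserving).toLinearMap
    (((Equiv.Perm.sign σ : ℤ) : ℂ) • (LinearMap.id : L2 k →ₗ[ℂ] L2 k))

theorem mem_antisymmSubmodule (ξ : L2 k) : ξ ∈ antisymmSubmodule k ↔ ξ ∈ L2as k := by
  refine Iff.trans ?_ (antisymm_iff_compMeasurePreserving ξ).symm
  simp only [antisymmSubmodule, Submodule.mem_iInf, LinearMap.mem_eqLocus]
  rfl

theorem isClosed_antisymmSubmodule (k : ℕ) :
    IsClosed (antisymmSubmodule k : Set (L2 k)) := by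
  rw [antisymmSubmodule, Submodule.coe_iInf]
  refine isClosed_iInter fun σ => isClosed_eq (LinearIsometry.continuous _) ?_
  exact continuous_const_smul ((Equiv.Perm.sign σ : ℤ) : ℂ)

instance : CompleteSpace (antisymmSubmodule k) :=
  (isClosed_antisymmSubmodule k).completeSpace_coe

/-- The sesquilinear form `Tdiag + Toff`, as a form on functions of momentum. -/
noncomputable def fullForm (m μ : ℝ) (φ u : Config (n + 1) → ℂ) : ℂ :=
  (∫ p, conj (φ p) * u p * (L m μ p : ℂ)) + offForm m μ φ u

theorem fullForm_hat (m μ : ℝ) (ζ ξ : L2 (n + 1)) :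
    fullForm m μ (hat ζ) (hat ξ) = Tdiag m μ ζ ξ + Toff m μ ζ ξ :=
  rfl

theorem fullForm_congr_left {φ φ' : Config (n + 1) → ℂ} (h : φ =ᵐ[volume] φ')
    (u : Config (n + 1) → ℂ) : fullForm m μ φ u = fullForm m μ φ' u := by
  unfold fullForm
  rw [offForm_congr m μ h (ae_eq_refl u)]
  congr 1
  refine integral_congr_ae ?_
  filter_upwards [h] with p hp
  rw [hp]

theorem lintegral_enorm_diag_le (hm : 0 < m) (hμ : 0 < μ) (α : ℝ) {φ : Config k → ℂ}
    (hφ : Measurable φ) (u : Config k → ℂ) :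
    ∫⁻ p, ‖conj (φ p) * u p * (L m μ p : ℂ)‖ₑ
      ≤ LpowNormSq m μ α φ + LpowNormSq m μ (1 - α) u := by
  unfold LpowNormSq
  rw [← lintegral_add_left (by fun_prop)]
  refine lintegral_mono fun p => ?_
  have hsplit : L m μ p = L m μ p ^ α * L m μ p ^ (1 - α) := by
    rw [← Real.rpow_add (L_pos hm hμ p), add_sub_cancel, Real.rpow_one]
  have hamgm := two_mul_mul_le_add_sq_mul_inv ‖((L m μ p ^ α : ℝ) : ℂ) * φ p‖ₑ
    ‖((L m μ p ^ (1 - α) : ℝ) : ℂ) * u p‖ₑ one_pos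
  rw [inv_one, ENNReal.ofReal_one, mul_one, mul_one] at hamgm
  refine (le_of_eq ?_).trans ((le_mul_of_one_le_left' one_le_two).trans hamgm)
  conv_lhs => rw [hsplit]
  simp only [enorm_mul, RCLike.enorm_conj, Complex.ofReal_mul]
  ring

theorem integrable_diag (hm : 0 < m) (hμ : 0 < μ) (α : ℝ) {φ u : Config k → ℂ}
    (hφ : Measurable φ) (hu : Measurable u) (hφ' : LpowNormSq m μ α φ < ⊤)
    (hu' : LpowNormSq m μ (1 - α) u < ⊤) :
    Integrable fun p => conj (φ p) * u p * (L m μ p : ℂ) :=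
  ⟨Measurable.aestronglyMeasurable (by fun_prop),
    (lintegral_enorm_diag_le hm hμ α hφ u).trans_lt (by finiteness)⟩

theorem exists_enorm_fullForm_le (hm : 0 < m) (hμ : 0 < μ) (n : ℕ) (h0 : 0 ≤ α) (h1 : α ≤ 1) :
    ∃ C : ℝ≥0∞, C ≠ ⊤ ∧ ∀ φ u : Config (n + 1) → ℂ, Measurable φ → Measurable u →
      ‖fullForm m μ φ u‖ₑ ≤ C * (LpowNormSq m μ α φ + LpowNormSq m μ (1 - α) u) := by
  obtain ⟨C, hC, hoff⟩ := exists_lintegral_enorm_off_le hm hμ n h0 h1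
  refine ⟨1 + ‖(n : ℂ) + 1‖ₑ * C, by finiteness, fun φ u hφ hu => ?_⟩
  unfold fullForm offForm
  refine (enorm_add_le _ _).trans ?_
  rw [add_mul (1 : ℝ≥0∞), one_mul, enorm_mul, mul_assoc ‖(n : ℂ) + 1‖ₑ]
  gcongr
  · exact (enorm_integral_le_lintegral_enorm _).trans (lintegral_enorm_diag_le hm hμ α hφ u)
  · exact (enorm_integral_le_lintegral_enorm _).trans (hoff φ u hφ hu)

theorem fullForm_add_left (hm : 0 < m) (hμ : 0 < μ) (h0 : 0 ≤ α) (h1 : α ≤ 1)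
    {φ φ' u : Config (n + 1) → ℂ} (hφ : Measurable φ) (hφ' : Measurable φ') (hu : Measurable u)
    (fφ : LpowNormSq m μ α φ < ⊤) (fφ' : LpowNormSq m μ α φ' < ⊤)
    (fu : LpowNormSq m μ (1 - α) u < ⊤) :
    fullForm m μ (fun p => φ p + φ' p) u = fullForm m μ φ u + fullForm m μ φ' u := by
  unfold fullForm offForm
  simp only [map_add, add_mul]
  rw [integral_add (integrable_diag hm hμ α hφ hu fφ fu) (integrable_diag hm hμ α hφ' hu fφ' fu),
    integral_add (integrable_off hm hμ h0 h1 hφ hu fφ fu)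
      (integrable_off hm hμ h0 h1 hφ' hu fφ' fu)]
  ring

theorem fullForm_const_mul_left (a : ℂ) (φ u : Config (n + 1) → ℂ) :
    fullForm m μ (fun p => a * φ p) u = conj a * fullForm m μ φ u := by
  unfold fullForm offForm
  simp only [map_mul, mul_assoc, integral_const_mul]
  ring

/-- Multiplication by `L^r` in momentum space. -/
noncomputable def lpowMul (m μ r : ℝ) (w : Config k → ℂ) (p : Config k) : ℂ :=
  ((L m μ p ^ r : ℝ) : ℂ) * w p

theorem measurable_lpowMul {w : Config k → ℂ} (hw : Measurable w) :
    Measurable (lpowMul m μ r w) := by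
  unfold lpowMul
  fun_prop

theorem lpowMul_lpowMul (hm : 0 < m) (hμ : 0 < μ) (r s : ℝ) (w : Config k → ℂ) :
    lpowMul m μ r (lpowMul m μ s w) = lpowMul m μ (r + s) w := by
  funext p
  simp only [lpowMul, Real.rpow_add (L_pos hm hμ p), Complex.ofReal_mul, mul_assoc]

theorem lpowMul_zero (w : Config k → ℂ) : lpowMul m μ 0 w = w := by
  funext p
  simp [lpowMul]

theorem lpowMul_congr {w w' : Config k → ℂ} (h : w =ᵐ[volume] w') :
    lpowMul m μ r w =ᵐ[volume] lpowMul m μ r w' :=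
  h.mono fun p hp => by simp only [lpowMul, hp]

theorem lpowNormSq_lpowMul (hm : 0 < m) (hμ : 0 < μ) (r s : ℝ) (w : Config k → ℂ) :
    LpowNormSq m μ r (lpowMul m μ s w) = LpowNormSq m μ (r + s) w := by
  change ∫⁻ p, ‖lpowMul m μ r (lpowMul m μ s w) p‖ₑ ^ 2 = _
  rw [lpowMul_lpowMul hm hμ]
  rfl

theorem Antisymm.lpowMul {w : Config k → ℂ} (hw : Antisymm w) (m μ r : ℝ) :
    Antisymm (lpowMul m μ r w) :=
  hw.mul_left fun σ x => by rw [L_permute]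

theorem measurable_L2 (w : L2 k) : Measurable (w : Config k → ℂ) :=
  (Lp.stronglyMeasurable w).measurable

theorem lpowNormSq_lpowMul_neg (hm : 0 < m) (hμ : 0 < μ) (α : ℝ) (w : L2 k) :
    LpowNormSq m μ α (lpowMul m μ (-α) w) = ‖w‖ₑ ^ 2 := by
  rw [lpowNormSq_lpowMul hm hμ, add_neg_cancel, lpowNormSq_zero, enorm_sq_eq_lintegral]

theorem lpowNormSq_lpowMul_neg_lt_top (hm : 0 < m) (hμ : 0 < μ) (α : ℝ) (w : L2 k) :
    LpowNormSq m μ α (lpowMul m μ (-α) w) < ⊤ := by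
  rw [lpowNormSq_lpowMul_neg hm hμ]
  finiteness

/-- The functional `w ↦ conj (t(L^{-α} w, u))` on `L²`, where `t` is the form `fullForm`. Weighting
by `L^{-α}` makes it bounded when `u` lies in the domain of `L^{1-α}`. -/
noncomputable def formFunctional (hm : 0 < m) (hμ : 0 < μ) (h0 : 0 ≤ α) (h1 : α ≤ 1)
    {u : Config (n + 1) → ℂ} (hu : Measurable u) (hu' : LpowNormSq m μ (1 - α) u < ⊤) :
    L2 (n + 1) →ₗ[ℂ] ℂ where
  toFun w := conj (fullForm m μ (lpowMul m μ (-α) w) u)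
  map_add' w w' := by
    rw [← map_add, ← fullForm_add_left hm hμ h0 h1 (measurable_lpowMul (measurable_L2 w))
      (measurable_lpowMul (measurable_L2 w')) hu (lpowNormSq_lpowMul_neg_lt_top hm hμ α w)
      (lpowNormSq_lpowMul_neg_lt_top hm hμ α w') hu']
    congr 1
    refine fullForm_congr_left ?_ u
    filter_upwards [Lp.coeFn_add w w'] with p hp
    simp only [lpowMul, hp, Pi.add_apply, mul_add]
  map_smul' a w := by
    rw [RingHom.id_apply, smul_eq_mul, ← Complex.conj_conj a, ← map_mul, Complex.conj_conj,
      ← fullForm_const_mul_left]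
    congr 1
    refine fullForm_congr_left ?_ u
    filter_upwards [Lp.coeFn_smul a w] with p hp
    simp only [lpowMul, hp, Pi.smul_apply, smul_eq_mul, mul_left_comm]

theorem exists_norm_formFunctional_le (hm : 0 < m) (hμ : 0 < μ) (h0 : 0 ≤ α) (h1 : α ≤ 1)
    {u : Config (n + 1) → ℂ} (hu : Measurable u) (hu' : LpowNormSq m μ (1 - α) u < ⊤) :
    ∃ M : ℝ, ∀ w, ‖w‖ ≤ 1 → ‖formFunctional hm hμ h0 h1 hu hu' w‖ ≤ M := by
  obtain ⟨C, hC, hform⟩ := exists_enorm_fullForm_le hm hμ n h0 h1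
  refine ⟨(C * (1 + LpowNormSq m μ (1 - α) u)).toReal, fun w hw => ?_⟩
  have hw' : ‖w‖ₑ ≤ 1 := by
    simpa only [ofReal_norm, ENNReal.ofReal_one] using ENNReal.ofReal_le_ofReal hw
  rw [← toReal_enorm]
  refine ENNReal.toReal_mono (by finiteness) ?_
  calc _ = ‖fullForm m μ (lpowMul m μ (-α) w) u‖ₑ := RCLike.enorm_conj _
    _ ≤ C * (‖w‖ₑ ^ 2 + LpowNormSq m μ (1 - α) u) := by
        rw [← lpowNormSq_lpowMul_neg hm hμ α w]
        exact hform _ _ (measurable_lpowMul (measurable_L2 w)) hu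
    _ ≤ _ := by
        gcongr
        exact pow_le_one' hw' 2

theorem exists_inner_eq_of_norm_le {H : Type*} [NormedAddCommGroup H] [InnerProductSpace ℂ H]
    [CompleteSpace H] (f : H →ₗ[ℂ] ℂ) {M : ℝ} (hf : ∀ w, ‖w‖ ≤ 1 → ‖f w‖ ≤ M) :
    ∃ v, ∀ w, inner ℂ v w = f w := by
  have hbound := LinearMap.bound_of_ball_bound' one_pos M f fun w hw => hf w (by simpa using hw)
  exact ⟨(InnerProductSpace.toDual ℂ H).symm (f.mkContinuous (M / 1) hbound),
    fun w => InnerProductSpace.toDual_symm_apply⟩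

theorem exists_inner_eq_fullForm (hm : 0 < m) (hμ : 0 < μ) (h0 : 0 ≤ α) (h1 : α ≤ 1)
    {u : Config (n + 1) → ℂ} (hu : Measurable u) (hu' : LpowNormSq m μ (1 - α) u < ⊤) :
    ∃ v ∈ L2as (n + 1), ∀ w ∈ L2as (n + 1),
      inner ℂ w v = fullForm m μ (lpowMul m μ (-α) w) u := by
  obtain ⟨M, hM⟩ := exists_norm_formFunctional_le hm hμ h0 h1 hu hu'
  obtain ⟨v, hv⟩ := exists_inner_eq_of_norm_le
    ((formFunctional hm hμ h0 h1 hu hu').comp (antisymmSubmodule (n + 1)).subtype)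
    fun w hw => hM w hw
  refine ⟨v, (mem_antisymmSubmodule _).1 v.2, fun w hw => ?_⟩
  have hinner : inner ℂ (v : L2 (n + 1)) w = conj (fullForm m μ (lpowMul m μ (-α) w) u) :=
    hv ⟨w, (mem_antisymmSubmodule w).2 hw⟩
  rw [← inner_conj_symm, hinner, Complex.conj_conj]

theorem exists_integral_eq_fullForm (hm : 0 < m) (hμ : 0 < μ) (h0 : 0 ≤ α) (h1 : α ≤ 1)
    {u : Config (n + 1) → ℂ} (hu : Measurable u) (hu' : LpowNormSq m μ (1 - α) u < ⊤) :
    ∃ g : Config (n + 1) → ℂ, Measurable g ∧ Antisymm g ∧ LpowNormSq m μ (-α) g < ⊤ ∧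
      ∀ φ : Config (n + 1) → ℂ, Measurable φ → Antisymm φ → LpowNormSq m μ α φ < ⊤ →
        ∫ p, conj (φ p) * g p = fullForm m μ φ u := by
  obtain ⟨v, hva, hv⟩ := exists_inner_eq_fullForm hm hμ h0 h1 hu hu'
  refine ⟨lpowMul m μ α v, measurable_lpowMul (measurable_L2 v), hva.lpowMul m μ α, ?_,
    fun φ hφ hφa hφ' => ?_⟩
  · simpa only [neg_neg] using lpowNormSq_lpowMul_neg_lt_top hm hμ (-α) v
  have hmem : MemLp (lpowMul m μ α φ) 2 :=
    (memLp_two_iff (measurable_lpowMul hφ).aestronglyMeasurable).2 hφ'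
  have hcoe := hmem.coeFn_toLp
  have hunweight : lpowMul m μ (-α) (hmem.toLp : L2 (n + 1)) =ᵐ[volume] φ := by
    refine (lpowMul_congr hcoe).trans (.of_eq ?_)
    rw [lpowMul_lpowMul hm hμ, neg_add_cancel, lpowMul_zero]
  rw [← fullForm_congr_left hunweight, ← hv _ ((hφa.lpowMul m μ α).congr hcoe.symm),
    inner_eq_integral]
  refine integral_congr_ae ?_
  filter_upwards [hcoe] with p hp
  simp only [hp, lpowMul, map_mul, Complex.conj_ofReal]
  ring

theorem exists_isGammaHat (hm : 0 < m) (hμ : 0 < μ) {ξ : L2 (n + 1)}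
    (hξ : ξ ∈ Has (n + 1) (1 / 2)) : ∃ g : Config (n + 1) → ℂ, IsGammaHat m μ ξ g := by
  obtain ⟨-, hξ'⟩ := (mem_Has_iff hm hμ (by norm_num) ξ).1 hξ
  obtain ⟨g, hg, hga, hg', hform⟩ := exists_integral_eq_fullForm hm hμ (α := 1 / 2) (by norm_num)
    (by norm_num) (measurable_hat ξ) (by rwa [sub_half])
  refine ⟨g, hξ, hg.aestronglyMeasurable, hga, by rwa [neg_div], fun ζ hζ => ?_⟩
  obtain ⟨hζa, hζ'⟩ := (mem_Has_iff hm hμ (by norm_num) ζ).1 hζ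
  rw [hform _ (measurable_hat ζ) hζa hζ', fullForm_hat]

theorem exists_isGamma (hm : 0 < m) (hμ : 0 < μ) {ξ : L2 (n + 1)}
    (hξ : ξ ∈ Has (n + 1) 1) : ∃ η : L2 (n + 1), IsGamma m μ ξ η := by
  obtain ⟨-, hξ'⟩ := (mem_Has_iff hm hμ zero_le_one ξ).1 hξ
  obtain ⟨g, hg, hga, hg', hform⟩ := exists_integral_eq_fullForm hm hμ (α := 0) le_rfl
    zero_le_one (measurable_hat ξ) (by rwa [sub_zero])
  rw [neg_zero, lpowNormSq_zero, ← memLp_two_iff hg.aestronglyMeasurable] at hg'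
  obtain ⟨η, hη⟩ := exists_hat_eq hg'
  refine ⟨η, Has_mono (by norm_num) hξ, (antisymm_hat_iff η).1 (hga.congr hη.symm),
    fun ζ hζ => ?_⟩
  obtain ⟨hζa, hζ'⟩ := (mem_Has_iff hm hμ (by norm_num) ζ).1 hζ
  rw [← fullForm_hat, ← integral_conj_hat_mul_hat, ← hform _ (measurable_hat ζ) hζa
    (lpowNormSq_lt_top_mono hm hμ (by norm_num) hζ')]
  refine integral_congr_ae ?_
  filter_upwards [hη] with p hp
  rw [hp]

theorem lpowNormSq_hat_lt_top (hm : 0 < m) (hμ : 0 < μ) (hr : r ≤ 0) (ξ : L2 k) :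
    LpowNormSq m μ r (hat ξ) < ⊤ := by
  refine lpowNormSq_lt_top_mono hm hμ hr ?_
  rw [lpowNormSq_zero, lintegral_enorm_hat_sq]
  finiteness

theorem eq_zero_of_forall_inner_eq_zero (hm : 0 < m) (hμ : 0 < μ) (hr : 0 ≤ r) {ξ : L2 k}
    (hξ : ξ ∈ L2as k) (h : ∀ ζ ∈ Has k r, inner ℂ ζ ξ = 0) : ξ = 0 := by
  have hmeas (s : ℝ) : AEStronglyMeasurable (lpowMul m μ s (hat ξ)) :=
    (measurable_lpowMul (measurable_hat ξ)).aestronglyMeasurable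
  obtain ⟨ζ, hζ, hζξ⟩ := exists_mem_Has hm hμ hr (hmeas (-r))
    (((antisymm_hat_iff ξ).2 hξ).lpowMul m μ (-r)) (by
      rw [lpowNormSq_lpowMul hm hμ, add_neg_cancel]
      exact lpowNormSq_hat_lt_top hm hμ le_rfl ξ)
  have hmem : MemLp (lpowMul m μ (-r / 2) (hat ξ)) 2 :=
    (memLp_two_iff (hmeas _)).2 (lpowNormSq_hat_lt_top hm hμ (by linarith) ξ)
  have hcoe := hmem.coeFn_toLp
  have hinner : inner ℂ ζ ξ = inner ℂ hmem.toLp hmem.toLp := by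
    rw [← integral_conj_hat_mul_hat, inner_eq_integral]
    refine integral_congr_ae ?_
    filter_upwards [hζξ, hcoe] with p hp hp'
    rw [hp, hp', lpowMul, lpowMul, ← add_halves (-r), Real.rpow_add (L_pos hm hμ p), add_halves]
    simp only [map_mul, Complex.ofReal_mul, Complex.conj_ofReal]
    ring
  have hzero := inner_self_eq_zero.1 (hinner.symm.trans (h ζ hζ))
  rw [hzero] at hcoe
  refine eq_zero_of_hat ?_
  filter_upwards [hcoe, Lp.coeFn_zero ℂ 2 volume] with p hp hp'
  rw [hp', lpowMul, Pi.zero_apply, eq_comm] at hp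
  exact (mul_eq_zero.1 hp).resolve_left
    (Complex.ofReal_ne_zero.2 (Real.rpow_pos_of_pos (L_pos hm hμ p) _).ne')

theorem IsGamma.unique (hm : 0 < m) (hμ : 0 < μ) {ξ η η' : L2 (n + 1)} (h : IsGamma m μ ξ η)
    (h' : IsGamma m μ ξ η') : η = η' := by
  obtain ⟨-, hη, hform⟩ := h
  obtain ⟨-, hη', hform'⟩ := h'
  refine sub_eq_zero.1
    (eq_zero_of_forall_inner_eq_zero hm hμ (r := 1 / 2) (by norm_num) ?_ fun ζ hζ => ?_)
  · rw [← mem_antisymmSubmodule] at hη hη' ⊢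
    exact sub_mem hη hη'
  · rw [inner_sub_right, hform ζ hζ, hform' ζ hζ, sub_self]

theorem IsGamma.isGammaHat (hm : 0 < m) (hμ : 0 < μ) {ξ η : L2 (n + 1)} (h : IsGamma m μ ξ η) :
    IsGammaHat m μ ξ (hat η) where
  mem_form_domain := h.1
  aestronglyMeasurable := (measurable_hat η).aestronglyMeasurable
  antisymm := (antisymm_hat_iff η).2 h.2.1
  finite_norm := lpowNormSq_hat_lt_top hm hμ (by norm_num) η
  form_eq ζ hζ := by rw [integral_conj_hat_mul_hat, h.2.2 ζ hζ]

theorem IsGamma.lower_bound (hm : 0 < m) (hμ : 0 < μ) {ξ η : L2 (n + 1)} (h : IsGamma m μ ξ η) :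
    ENNReal.ofReal (1 - (Lambda 1 m).toReal) * LpowNormSq m μ 1 (hat ξ) ≤ ‖η‖ₑ ^ 2 := by
  have hbound := (h.isGammaHat hm hμ).lower_bound hm hμ zero_le_one one_le_two
  rwa [add_self_div_two, sub_self, zero_div, lpowNormSq_zero, lintegral_enorm_hat_sq] at hbound

theorem domL_eq_Has (hm : 0 < m) (hμ : 0 < μ) (k : ℕ) : domL k m μ = Has k 1 := by
  ext ξ
  rw [mem_Has_iff hm hμ zero_le_one, antisymm_hat_iff]
  rfl

theorem domGamma_eq_Has (hm : 0 < m) (hμ : 0 < μ) (n : ℕ) (hΛ : Lambda 1 m < 1) :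
    domGamma n m μ = Has (n + 1) 1 := by
  refine Set.Subset.antisymm ?_ fun ξ hξ => exists_isGamma hm hμ hξ
  rintro ξ ⟨η, hη⟩
  rw [mem_Has_iff hm hμ zero_le_one]
  refine ⟨((mem_Has_iff hm hμ (by norm_num) ξ).1 hη.1).1, ?_⟩
  have hfin := (hη.lower_bound hm hμ).trans_lt (by finiteness)
  refine ENNReal.lt_top_of_mul_ne_top_right hfin.ne ?_
  rw [ne_eq, ENNReal.ofReal_eq_zero, not_le, sub_pos, ← ENNReal.toReal_one]
  exact (ENNReal.toReal_lt_toReal hΛ.ne_top ENNReal.one_ne_top).2 hΛ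

end FormOperator

end PointInteraction

theorem theorem2_general (n : ℕ) (m μ : ℝ) (hm : 0 < m) (hμ : 0 < μ) :
    (∀ ξ ∈ Has (n + 1) 1, ∃! η : L2 (n + 1), IsGamma m μ ξ η) ∧
    (∀ ξ η : L2 (n + 1), IsGamma m μ ξ η →
      ENNReal.ofReal (1 - (Lambda 1 m).toReal) * LpowNormSq m μ 1 (hat ξ) ≤ ‖η‖ₑ ^ 2) ∧
    (Lambda 1 m < 1 →
      domGamma n m μ = domL (n + 1) m μ ∧ domL (n + 1) m μ = Has (n + 1) 1) ∧
    (∀ β : ℝ, 0 ≤ β → β ≤ 2 →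
      Lambda β m ≠ ⊤ ∧
      ∀ ξ ∈ Has (n + 1) (1 / 2),
        (∃ g : Config (n + 1) → ℂ, IsGammaHat m μ ξ g) ∧
        ∀ g : Config (n + 1) → ℂ, IsGammaHat m μ ξ g →
          ENNReal.ofReal (1 - (Lambda β m).toReal) * LpowNormSq m μ ((β + 1) / 2) (hat ξ)
            ≤ LpowNormSq m μ ((β - 1) / 2) g) := by
  refine ⟨fun ξ hξ => ?_, fun ξ η hη => hη.lower_bound hm hμ, fun hΛ => ?_, fun β h0 h2 =>
    ⟨lambda_ne_top hm h0 h2, fun ξ hξ => ⟨exists_isGammaHat hm hμ hξ,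
      fun g hg => hg.lower_bound hm hμ h0 h2⟩⟩⟩
  · obtain ⟨η, hη⟩ := exists_isGamma hm hμ hξ
    exact ⟨η, hη, fun η' hη' => hη'.unique hm hμ hη⟩
  · rw [domL_eq_Has hm hμ, domGamma_eq_Has hm hμ n hΛ]
    exact ⟨rfl, rfl⟩

/-- The number of fermions is `N = n + 2 ≥ 2`, and `ξ` is a function on `ℝ^{3(N-1)}`. -/
theorem theorem2 (n : ℕ) (m μ : ℝ) (hm : 0 < m) (hμ : 0 < μ) :
    (∀ ξ ∈ Has (n + 1) 1,
      (∃! η : L2 (n + 1), IsGamma m μ ξ η) ∧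
      ∀ η : L2 (n + 1), IsGamma m μ ξ η →
        ENNReal.ofReal (1 - (Lambda 1 m).toReal) * LpowNormSq m μ 1 (hat ξ) ≤ ‖η‖ₑ ^ 2) ∧
    (Lambda 1 m < 1 →
      domGamma n m μ = domL (n + 1) m μ ∧ domL (n + 1) m μ = Has (n + 1) 1) ∧
    (∀ β : ℝ, 0 ≤ β → β ≤ 2 →
      Lambda β m ≠ ⊤ ∧
      ∀ ξ ∈ Has (n + 1) ((β + 1) / 2),
        (∃ g : Config (n + 1) → ℂ, IsGammaHat m μ ξ g) ∧
        ∀ g : Config (n + 1) → ℂ, IsGammaHat m μ ξ g →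
          ENNReal.ofReal (1 - (Lambda β m).toReal) * LpowNormSq m μ ((β + 1) / 2) (hat ξ)
            ≤ LpowNormSq m μ ((β - 1) / 2) g) := by
  obtain ⟨hΓ, hbound, hdom, hβ⟩ := theorem2_general n m μ hm hμ
  exact ⟨fun ξ hξ => ⟨hΓ ξ hξ, hbound ξ⟩, hdom, fun β h0 h2 =>
    ⟨(hβ β h0 h2).1, fun ξ hξ => (hβ β h0 h2).2 ξ (Has_mono (by linarith) hξ)⟩⟩
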